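/- Let $P$ be a closed region of the plane bounded by a simple closed polygon whose edges are alternately horizontal and vertical (a simple rectilinear polygon), with $n$ vertices, of which $r$ are reflex (internal angle $270^\circ$). Call $P$ monotone if every vertical line meets $P$ in at most one connected component, or every horizontal line does. A beacon $b\in P$ attracts a point $p\in P$ if an object starting at $p$ reaches $b$ by moving as follows: it moves straight towards $b$ as long as this is possible within $P$; where this is impossible, it slides along an edge of $P$ in the direction in which its Euclidean distance to $b$ strictly decreases, until it can move straight towards $b$ again (it stops if there is no such direction; at a reflex vertex where both incident edges allow such a slide, either may be chosen). A finite set of beacons in $P$ covers $P$ if every point of $P$ is attracted by at least one of them. (a) If $P$ is monotone, then $\lfloor\frac{n+4}{8}\rfloor=\lfloor\frac r4\rfloor+1$, and $P$ can be covered by $\lfloor\frac{n+4}{8}\rfloor$ beacons. (b) This number is sometimes necessary: for every integer $r\ge 0$ there is a monotone simple rectilinear polygon with $n=2r+4$ vertices, $r$ of them reflex, that cannot be covered by fewer than $\lfloor\frac r4\rfloor+1=\lfloor\frac{n+4}{8}\rfloor$ beacons; moreover it can be chosen such that no horizontal or vertical chord connects two of its reflex vertices (a chord being a segment between two boundary points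 whose other points lie in the interior). -/

import Mathlib

open Set Filter Topology

/-- The Euclidean plane; `p 0` and `p 1` are the `x`- and `y`-coordinates of `p`. -/
abbrev Plane : Type := EuclideanSpace ℝ (Fin 2)

/-- The closed vertex cycle `v` is a simple closed polygonal curve: it has at least three
vertices, consecutive edges share only their common vertex, and other pairs of distinct edges are
disjoint. Here `finRotate n i` is the cyclic successor of the index `i`. -/
structure IsSimpleClosedPolygonalCurve {n : ℕ} (v : Polygon Plane n) : Prop where
  three_le : 3 ≤ n
  nondegenerate : v.HasNondegenerateEdges
  adjacent : ∀ i : Fin n,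
    v.edgeSet ℝ i ∩ v.edgeSet ℝ (finRotate n i) = {v (finRotate n i)}
  nonadjacent : ∀ i j : Fin n, j ≠ i → j ≠ finRotate n i → i ≠ finRotate n j →
    Disjoint (v.edgeSet ℝ i) (v.edgeSet ℝ j)

/-- `P` is a simple rectilinear polygon with vertex cycle `v`: the curve `v` is simple, its edges
are alternately horizontal and vertical (so that every internal angle is 90 or 270 degrees), and
`P` is the closed region that `v` bounds, that is, the compact set that is the closure of its
interior and whose frontier is the curve `v`. -/
structure IsSimpleRectilinearPolygon {n : ℕ} (v : Polygon Plane n) (P : Set Plane) : Prop where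
  simple : IsSimpleClosedPolygonalCurve v
  rectilinear : ∀ i : Fin n,
    (v i 0 = v (finRotate n i) 0 ∧
      v (finRotate n i) 1 = v (finRotate n (finRotate n i)) 1) ∨
    (v i 1 = v (finRotate n i) 1 ∧
      v (finRotate n i) 0 = v (finRotate n (finRotate n i)) 0)
  isCompact : IsCompact P
  closure_interior : closure (interior P) = P
  frontier_eq : frontier P = v.boundary ℝ

/-- The `i`-th vertex is reflex (internal angle 270 degrees): close to it, the quadrant spanned by
its two incident edges lies outside `P`. -/
def IsReflexVertex {n : ℕ} (v : Polygon Plane n) (P : Set Plane) (i : Fin n) : Prop :=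
  ∀ᶠ ε : ℝ in 𝓝[>] 0,
    v i + ε • ((v (finRotate n i) - v i) + (v ((finRotate n).symm i) - v i)) ∉ P

/-- The number of reflex vertices. -/
noncomputable def numReflex {n : ℕ} (v : Polygon Plane n) (P : Set Plane) : ℕ :=
  {i : Fin n | IsReflexVertex v P i}.ncard

/-- Every line on which the `k`-th coordinate is constant meets `P` in at most one connected
component. -/
def HasConnectedSections (k : Fin 2) (P : Set Plane) : Prop :=
  ∀ c : ℝ, IsPreconnected (P ∩ {p : Plane | p k = c})

/-- `x`-monotone (all vertical sections are connected) or `y`-monotone (all horizontal sections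
are connected). -/
def IsMonotonePolygon (P : Set Plane) : Prop :=
  HasConnectedSections 0 P ∨ HasConnectedSections 1 P

/-- General position: no horizontal or vertical chord of `P` connects two reflex vertices. -/
def InGeneralPosition {n : ℕ} (v : Polygon Plane n) (P : Set Plane) : Prop :=
  ∀ i j : Fin n, i ≠ j → IsReflexVertex v P i → IsReflexVertex v P j →
    (v i 0 = v j 0 ∨ v i 1 = v j 1) → ¬ openSegment ℝ (v i) (v j) ⊆ interior P

/-- The object moves from `p` to `q` on the ray towards the beacon `b`, inside `P`. -/
def MovesStraight (P : Set Plane) (b p q : Plane) : Prop :=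
  q ∈ segment ℝ p b ∧ segment ℝ p q ⊆ P

/-- At `z`, the ray towards the beacon `b` immediately leaves `P`. -/
def IsBlocked (P : Set Plane) (b z : Plane) : Prop :=
  ∀ᶠ t : ℝ in 𝓝[>] 0, (AffineMap.lineMap z b t : Plane) ∉ P

/-- The object slides from `p` to `q` along an edge, in the direction in which the Euclidean
distance to the beacon `b` strictly decreases, the straight move towards `b` being impossible
at every point before `q`. -/
def SlidesAlongEdge {n : ℕ} (v : Polygon Plane n) (P : Set Plane) (b p q : Plane) : Prop :=
  (∃ i : Fin n, p ∈ v.edgeSet ℝ i ∧ q ∈ v.edgeSet ℝ i) ∧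
  (∀ z ∈ segment ℝ p q, z ≠ q → IsBlocked P b z) ∧
  StrictAntiOn (fun t : ℝ => dist (AffineMap.lineMap p q t : Plane) b) (Icc 0 1)

/-- The beacon `b` attracts `p`: an attraction path, made of finitely many straight moves and
slides, leads from `p` to `b`. -/
def Attracts {n : ℕ} (v : Polygon Plane n) (P : Set Plane) (b p : Plane) : Prop :=
  Relation.ReflTransGen (fun q q' => MovesStraight P b q q' ∨ SlidesAlongEdge v P b q q') p b

/-- The set `S` of beacons lies in `P` and covers (guards) `P`: every point of `P` is attracted
by at least one beacon of `S`. -/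
def Covers {n : ℕ} (v : Polygon Plane n) (P : Set Plane) (S : Finset Plane) : Prop :=
  (∀ b ∈ S, b ∈ P) ∧ ∀ p ∈ P, ∃ b ∈ S, Attracts v P b p

/-!
# Covering monotone rectilinear polygons by beacons

Let the vertical sections of the polygon be connected. Between consecutive abscissae of vertices
the boundary consists of horizontal edges that cross the whole slab, so that connectedness of the
sections leaves just one rectangle `[x i, x (i + 1)] × [l i, u i]` over each slab
(`IsAxisPolygon.exists_rect`), and the polygon is a chain of rectangles
(`IsSlabDecomp.isRectChain`). A vertical edge is the left side, the right side or a wall, that is,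
a height change of the bottom or of the top chain. Both ends of the sides are convex and a wall has
exactly one reflex end (`IsSlabDecomp.vert_cases`). Since each vertex is an end of exactly one
vertical edge, `n = 2 * r + 4`, and there are at most `r` height changes.

A beacon attracts an object through a chain of rectangles unless a wall facing away from it stands
between the object and the height of the beacon (`reaches_next`). If the bottom chain changes its
height at most once, a beacon on a lowest bottom side is never obstructed: it is below all openings
of the top chain, and the bottom chain does not rise towards it
(`IsRectChain.exists_beacon_of_bot`). With at most three changes in total, this applies to the
bottom or, upside down, to the top. Cutting the chain greedily into pieces with at most three
changes costs at least four changes per cut and gives at most `r / 4 + 1` beacons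
(`IsRectChain.exists_finset_attracting`).

For the lower bound, consider a strip of unit slabs of height range `[0, 3]` in which every slab
`i ≡ 1 (mod 4)` is narrowed to the low corridor `[0, 1]` and every slab `i ≡ 3 (mod 4)` to the
high corridor `[2, 3]`, so that each height change gives one reflex vertex. An object above height
`1` does not pass a low corridor towards a beacon above height `1`, as its height stays above `1`;
likewise a beacon below height `2` does not pull objects below that height through a high corridor
(`not_attracts_of_wall`). Hence points of height `3 / 2` that are separated by both kinds of
corridors need different beacons (`Corridors.not_attracts_both`). The vertices of this polygon are
given by explicit formulas with natural numbers, so that its simplicity reduces to arithmetic.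
-/

/-! ### Orthonormal coordinates -/

/-- A pair of orthonormal linear coordinates `X`, `Y` of the plane. Replacing `X` or `Y` by its
negative, or exchanging them, gives another frame, so that a statement proved for every frame
comes with its mirror images. -/
structure Frame where
  X : Plane →ₗ[ℝ] ℝ
  Y : Plane →ₗ[ℝ] ℝ
  norm_sq : ∀ p, ‖p‖ ^ 2 = X p ^ 2 + Y p ^ 2
  exists_eq : ∀ a b, ∃ p, X p = a ∧ Y p = b

namespace Frame

/-- The frame with the horizontal axis reversed. -/
def negX (F : Frame) : Frame where
  X := -F.X
  Y := F.Y
  norm_sq p := by simp [F.norm_sq p]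
  exists_eq a b := by
    obtain ⟨p, h1, h2⟩ := F.exists_eq (-a) b
    exact ⟨p, by simp [h1], h2⟩

/-- The frame with the vertical axis reversed. -/
def negY (F : Frame) : Frame where
  X := F.X
  Y := -F.Y
  norm_sq p := by simp [F.norm_sq p]
  exists_eq a b := by
    obtain ⟨p, h1, h2⟩ := F.exists_eq a (-b)
    exact ⟨p, h1, by simp [h2]⟩

@[simp] lemma negX_X (F : Frame) (p : Plane) : F.negX.X p = -F.X p := rfl
@[simp] lemma negX_Y (F : Frame) (p : Plane) : F.negX.Y p = F.Y p := rfl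
@[simp] lemma negY_X (F : Frame) (p : Plane) : F.negY.X p = F.X p := rfl
@[simp] lemma negY_Y (F : Frame) (p : Plane) : F.negY.Y p = -F.Y p := rfl

/-- The frame whose horizontal coordinate is `p k` and whose vertical coordinate is the
other one. -/
noncomputable def std (k : Fin 2) : Frame where
  X := (EuclideanSpace.proj k : Plane →L[ℝ] ℝ).toLinearMap
  Y := (EuclideanSpace.proj (k + 1) : Plane →L[ℝ] ℝ).toLinearMap
  norm_sq p := by
    rw [EuclideanSpace.norm_sq_eq]
    fin_cases k <;> simp [add_comm]
  exists_eq a b := by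
    fin_cases k
    · exact ⟨!₂[a, b], by simp⟩
    · exact ⟨!₂[b, a], by simp⟩

@[simp] lemma std_X (k : Fin 2) (p : Plane) : (std k).X p = p k := rfl
@[simp] lemma std_Y (k : Fin 2) (p : Plane) : (std k).Y p = p (k + 1) := rfl

variable (F : Frame)

/-- The point with given coordinates. -/
noncomputable def pt (a b : ℝ) : Plane := (F.exists_eq a b).choose

@[simp] lemma X_pt (a b : ℝ) : F.X (F.pt a b) = a := (F.exists_eq a b).choose_spec.1
@[simp] lemma Y_pt (a b : ℝ) : F.Y (F.pt a b) = b := (F.exists_eq a b).choose_spec.2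

lemma dist_sq (p q : Plane) :
    dist p q ^ 2 = (F.X p - F.X q) ^ 2 + (F.Y p - F.Y q) ^ 2 := by
  rw [dist_eq_norm, F.norm_sq, map_sub, map_sub]

variable {F}

lemma ext {p q : Plane} (h1 : F.X p = F.X q) (h2 : F.Y p = F.Y q) : p = q := by
  have h := F.dist_sq p q
  rw [h1, h2] at h
  simpa using h

lemma dist_lt_iff {p q b : Plane} : dist p b < dist q b ↔
    (F.X p - F.X b) ^ 2 + (F.Y p - F.Y b) ^ 2 < (F.X q - F.X b) ^ 2 + (F.Y q - F.Y b) ^ 2 := by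
  rw [← F.dist_sq, ← F.dist_sq, sq_lt_sq₀ dist_nonneg dist_nonneg]

variable (F)

lemma continuous_X : Continuous F.X := F.X.continuous_of_finiteDimensional
lemma continuous_Y : Continuous F.Y := F.Y.continuous_of_finiteDimensional

lemma X_lineMap (p q : Plane) (t : ℝ) :
    F.X (AffineMap.lineMap p q t : Plane) = F.X p + t * (F.X q - F.X p) := by
  simp [AffineMap.lineMap_apply]; ring

lemma Y_lineMap (p q : Plane) (t : ℝ) :
    F.Y (AffineMap.lineMap p q t : Plane) = F.Y p + t * (F.Y q - F.Y p) := by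
  simp [AffineMap.lineMap_apply]; ring

variable {F}

lemma mem_segment_iff {p q z : Plane} : z ∈ segment ℝ p q ↔ ∃ t : ℝ, 0 ≤ t ∧ t ≤ 1 ∧
    F.X z = F.X p + t * (F.X q - F.X p) ∧ F.Y z = F.Y p + t * (F.Y q - F.Y p) := by
  rw [segment_eq_image_lineMap]
  constructor
  · rintro ⟨t, ht, rfl⟩
    exact ⟨t, ht.1, ht.2, F.X_lineMap p q t, F.Y_lineMap p q t⟩
  · rintro ⟨t, h0, h1, hX, hY⟩
    exact ⟨t, ⟨h0, h1⟩, F.ext (by rw [hX, F.X_lineMap]) (by rw [hY, F.Y_lineMap])⟩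

lemma mem_segment_of_Y_eq {p q z : Plane} (h : F.Y p = F.Y q) :
    z ∈ segment ℝ p q ↔ F.Y z = F.Y p ∧ F.X z ∈ uIcc (F.X p) (F.X q) := by
  rw [F.mem_segment_iff, ← segment_eq_uIcc, segment_eq_image_lineMap, h]
  simp only [sub_self, mul_zero, add_zero, mem_image, mem_Icc, AffineMap.lineMap_apply,
    vsub_eq_sub, vadd_eq_add, smul_eq_mul]
  constructor
  · rintro ⟨t, h0, h1, h2, h3⟩
    exact ⟨h3, t, ⟨h0, h1⟩, by rw [h2]; ring⟩
  · rintro ⟨h3, t, ⟨h0, h1⟩, h2⟩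
    exact ⟨t, h0, h1, by rw [← h2]; ring, h3⟩

lemma mem_segment_of_X_eq {p q z : Plane} (h : F.X p = F.X q) :
    z ∈ segment ℝ p q ↔ F.X z = F.X p ∧ F.Y z ∈ uIcc (F.Y p) (F.Y q) := by
  rw [F.mem_segment_iff, ← segment_eq_uIcc, segment_eq_image_lineMap, h]
  simp only [sub_self, mul_zero, add_zero, mem_image, mem_Icc, AffineMap.lineMap_apply,
    vsub_eq_sub, vadd_eq_add, smul_eq_mul]
  constructor
  · rintro ⟨t, h0, h1, h2, h3⟩
    exact ⟨h2, t, ⟨h0, h1⟩, by rw [h3]; ring⟩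
  · rintro ⟨h3, t, ⟨h0, h1⟩, h2⟩
    exact ⟨t, h0, h1, h3, by rw [← h2]; ring⟩

variable (F)

lemma isOpen_X_mem_Y_mem {s t : Set ℝ} (hs : IsOpen s) (ht : IsOpen t) :
    IsOpen {p : Plane | F.X p ∈ s ∧ F.Y p ∈ t} :=
  (hs.preimage F.continuous_X).inter (ht.preimage F.continuous_Y)

lemma convex_X_mem_Y_mem {s t : Set ℝ} (hs : Convex ℝ s) (ht : Convex ℝ t) :
    Convex ℝ {p : Plane | F.X p ∈ s ∧ F.Y p ∈ t} :=
  (hs.linear_preimage F.X).inter (ht.linear_preimage F.Y)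

/-- The point with given coordinates, as an affine combination; hence it depends continuously on
the coordinates. -/
lemma pt_eq (a b : ℝ) : F.pt a b = a • F.pt 1 0 + b • F.pt 0 1 :=
  F.ext (by simp) (by simp)

lemma continuous_pt : Continuous fun q : ℝ × ℝ => F.pt q.1 q.2 := by
  have h : (fun q : ℝ × ℝ => F.pt q.1 q.2) = fun q => q.1 • F.pt 1 0 + q.2 • F.pt 0 1 :=
    funext fun q => F.pt_eq q.1 q.2
  rw [h]
  fun_prop

end Frame

/-! ### Attraction across one rectangle -/

/-- An attraction path of the beacon `b` leads from `p` to `q`. -/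
def Reaches {n : ℕ} (v : Polygon Plane n) (P : Set Plane) (b p q : Plane) : Prop :=
  Relation.ReflTransGen (fun q q' => MovesStraight P b q q' ∨ SlidesAlongEdge v P b q q') p q

section Step

variable {n : ℕ} {v : Polygon Plane n} {P : Set Plane} (F : Frame) {a c d l u l' u' : ℝ}
  {b p q : Plane}

lemma Frame.mem_rect_of_mem_segment {z : Plane} (hp : a ≤ F.X p ∧ F.X p ≤ c)
    (hp' : l ≤ F.Y p ∧ F.Y p ≤ u) (hq : a ≤ F.X q ∧ F.X q ≤ c) (hq' : l ≤ F.Y q ∧ F.Y q ≤ u)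
    (hz : z ∈ segment ℝ p q) : (a ≤ F.X z ∧ F.X z ≤ c) ∧ l ≤ F.Y z ∧ F.Y z ≤ u :=
  (F.convex_X_mem_Y_mem (convex_Icc a c) (convex_Icc l u)).segment_subset
    (x := p) (y := q) ⟨hp, hp'⟩ ⟨hq, hq'⟩ hz

/-- A beacon beyond `X = c` and above the horizontal edge `Y = u` pulls along this edge up to
the line `X = c`. -/
lemma slidesAlongEdge_horizontal (hS : ∀ z ∈ P, a < F.X z → F.X z < c → F.Y z ≤ u)
    (he : ∃ e, ∀ z, a ≤ F.X z → F.X z ≤ c → F.Y z = u → z ∈ v.edgeSet ℝ e)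
    (hb : c < F.X b) (hb' : u < F.Y b) (ha : a ≤ F.X p) (hpq : F.X p < c)
    (hp : F.Y p = u) (hqX : F.X q = c) (hq : F.Y q = u) : SlidesAlongEdge v P b p q := by
  obtain ⟨e, he⟩ := he
  refine ⟨⟨e, he p ha hpq.le hp, he q (by linarith) hqX.le hq⟩, ?_, ?_⟩
  · intro z hz hzq
    obtain ⟨t, h0, h1, hX, hY⟩ := F.mem_segment_iff.1 hz
    have ht : t ≠ 1 := by
      rintro rfl
      exact hzq (F.ext (by rw [hX]; ring) (by rw [hY]; ring))
    have ht1 : t < 1 := lt_of_le_of_ne h1 ht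
    have hzY : F.Y z = u := by rw [hY, hp, hq]; ring
    have hzX : F.X z < c := by rw [hX, hqX]; nlinarith
    have hza : a ≤ F.X z := by rw [hX, hqX]; nlinarith
    have hd : 0 < F.X b - F.X z := by linarith
    filter_upwards [Ioo_mem_nhdsGT (div_pos (sub_pos.2 hzX) hd)] with s hs hmem
    have hs2 := (lt_div_iff₀ hd).1 hs.2
    have := hS _ hmem (by rw [F.X_lineMap]; nlinarith [hs.1, mul_pos hs.1 hd])
      (by rw [F.X_lineMap]; linarith)
    rw [F.Y_lineMap, hzY] at this
    nlinarith [hs.1]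
  · intro s hs t ht hst
    simp only
    rw [F.dist_lt_iff, F.X_lineMap, F.X_lineMap, F.Y_lineMap, F.Y_lineMap, hp, hq, hqX]
    have h1 : s * (c - F.X p) < t * (c - F.X p) := by nlinarith
    have h2 : t * (c - F.X p) ≤ c - F.X p := by nlinarith [ht.2]
    nlinarith

/-- A beacon beyond `X = c` and not above height `u'` pulls an object on the line `X = c` down
the wall over the opening of height `u'`. -/
lemma slidesAlongEdge_vertical (hS : ∀ z ∈ P, c < F.X z → F.X z < d → F.Y z ≤ u') (hcd : c < d)
    (he : ∃ e, ∀ z, F.X z = c → u' ≤ F.Y z → F.Y z ≤ u → z ∈ v.edgeSet ℝ e)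
    (hb : c < F.X b) (hb' : F.Y b ≤ u') (hpX : F.X p = c) (hpu : F.Y p ≤ u)
    (hp : u' < F.Y p) (hqX : F.X q = c) (hq : F.Y q = u') : SlidesAlongEdge v P b p q := by
  obtain ⟨e, he⟩ := he
  refine ⟨⟨e, he p hpX hp.le hpu, he q hqX hq.ge (by linarith)⟩, ?_, ?_⟩
  · intro z hz hzq
    obtain ⟨t, h0, h1, hX, hY⟩ := F.mem_segment_iff.1 hz
    have ht : t ≠ 1 := by
      rintro rfl
      exact hzq (F.ext (by rw [hX]; ring) (by rw [hY]; ring))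
    have ht1 : t < 1 := lt_of_le_of_ne h1 ht
    have hzX : F.X z = c := by rw [hX, hpX, hqX]; ring
    have hzY : u' < F.Y z := by rw [hY, hq]; nlinarith
    have hd : 0 < F.X b - c := by linarith
    have hd' : 0 < F.Y z - F.Y b := by linarith
    filter_upwards [Ioo_mem_nhdsGT (div_pos (sub_pos.2 hcd) hd),
      Ioo_mem_nhdsGT (div_pos (sub_pos.2 hzY) hd')] with s hs hs' hmem
    have hs2 := (lt_div_iff₀ hd).1 hs.2
    have hs3 := (lt_div_iff₀ hd').1 hs'.2
    have := hS _ hmem (by rw [F.X_lineMap, hzX]; nlinarith [mul_pos hs.1 hd])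
      (by rw [F.X_lineMap, hzX]; linarith)
    rw [F.Y_lineMap] at this
    linarith
  · intro s hs t ht hst
    simp only
    rw [F.dist_lt_iff, F.X_lineMap, F.X_lineMap, F.Y_lineMap, F.Y_lineMap, hpX, hqX, hq]
    have h1 : s * (F.Y p - u') < t * (F.Y p - u') := by nlinarith
    have h2 : t * (F.Y p - u') ≤ F.Y p - u' := by nlinarith [ht.2]
    nlinarith

/-- If the ray from `p` to the beacon leaves the rectangle `[a, c] × [l, u]` through its top,
then `p` is attracted to its upper corner on the line `X = c`. -/
lemma reaches_corner (hR : ∀ z, a ≤ F.X z → F.X z ≤ c → l ≤ F.Y z → F.Y z ≤ u → z ∈ P)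
    (hS : ∀ z ∈ P, a < F.X z → F.X z < c → F.Y z ≤ u)
    (he : ∃ e, ∀ z, a ≤ F.X z → F.X z ≤ c → F.Y z = u → z ∈ v.edgeSet ℝ e)
    (hb : c < F.X b) (ha : a ≤ F.X p) (hc : F.X p ≤ c) (hl : l ≤ F.Y p) (hu : F.Y p ≤ u)
    (h : (u - F.Y p) * (F.X b - F.X p) < (F.Y b - F.Y p) * (c - F.X p)) :
    u < F.Y b ∧ ∃ q, F.X q = c ∧ F.Y q = u ∧ Reaches v P b p q := by
  have hXb : 0 < F.X b - F.X p := by linarith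
  have h0 : 0 < (F.Y b - F.Y p) * (c - F.X p) :=
    lt_of_le_of_lt (mul_nonneg (by linarith) hXb.le) h
  have hc' : 0 < c - F.X p := by
    rcases (sub_nonneg.2 hc).eq_or_lt with h' | h'
    · rw [← h', mul_zero] at h0; exact absurd h0 (lt_irrefl 0)
    · exact h'
  have hYb : 0 < F.Y b - F.Y p := pos_of_mul_pos_left h0 hc'.le
  have hub : u < F.Y b := by nlinarith
  refine ⟨hub, F.pt c u, by simp, by simp, ?_⟩
  set s := (u - F.Y p) / (F.Y b - F.Y p) with hs
  have hs0 : 0 ≤ s := div_nonneg (by linarith) hYb.le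
  have hs1 : s ≤ 1 := (div_le_one hYb).2 (by linarith)
  have hsY : s * (F.Y b - F.Y p) = u - F.Y p := div_mul_cancel₀ _ hYb.ne'
  have hsX : s * (F.X b - F.X p) < c - F.X p := by
    refine lt_of_mul_lt_mul_right (a := F.Y b - F.Y p) ?_ hYb.le
    calc s * (F.X b - F.X p) * (F.Y b - F.Y p)
        = (s * (F.Y b - F.Y p)) * (F.X b - F.X p) := by ring
      _ < (c - F.X p) * (F.Y b - F.Y p) := by rw [hsY]; linarith
  set m : Plane := AffineMap.lineMap p b s with hm
  have hmX : F.X m = F.X p + s * (F.X b - F.X p) := F.X_lineMap p b s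
  have hmY : F.Y m = u := by rw [hm, F.Y_lineMap, hsY]; ring
  have hma : a ≤ F.X m := by rw [hmX]; nlinarith [mul_nonneg hs0 hXb.le]
  have hmc : F.X m < c := by rw [hmX]; linarith
  refine Relation.ReflTransGen.tail (Relation.ReflTransGen.single (Or.inl ⟨?_, ?_⟩))
    (Or.inr (slidesAlongEdge_horizontal F hS he hb hub hma hmc hmY (by simp) (by simp)))
  · rw [segment_eq_image_lineMap]
    exact ⟨s, ⟨hs0, hs1⟩, rfl⟩
  · intro z hz
    obtain ⟨h1, h2⟩ := F.mem_rect_of_mem_segment ⟨ha, hc⟩ ⟨hl, hu⟩ ⟨hma, hmc.le⟩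
      ⟨by linarith, hmY.le⟩ hz
    exact hR z h1.1 h1.2 h2.1 h2.2

/-- An object in the rectangle `[a, c] × [l, u]` of `P` is attracted by a beacon beyond `X = c`
to the line `X = c`. -/
lemma reaches_line (hR : ∀ z, a ≤ F.X z → F.X z ≤ c → l ≤ F.Y z → F.Y z ≤ u → z ∈ P)
    (hS : ∀ z ∈ P, a < F.X z → F.X z < c → l ≤ F.Y z ∧ F.Y z ≤ u)
    (heu : ∃ e, ∀ z, a ≤ F.X z → F.X z ≤ c → F.Y z = u → z ∈ v.edgeSet ℝ e)
    (hel : ∃ e, ∀ z, a ≤ F.X z → F.X z ≤ c → F.Y z = l → z ∈ v.edgeSet ℝ e)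
    (hb : c < F.X b) (ha : a ≤ F.X p) (hc : F.X p ≤ c) (hl : l ≤ F.Y p) (hu : F.Y p ≤ u) :
    ∃ q, F.X q = c ∧ l ≤ F.Y q ∧ F.Y q ≤ u ∧ Reaches v P b p q := by
  have hXb : 0 < F.X b - F.X p := by linarith
  have hlu : l ≤ u := hl.trans hu
  by_cases h1 : (u - F.Y p) * (F.X b - F.X p) < (F.Y b - F.Y p) * (c - F.X p)
  · obtain ⟨-, q, h2, h3, h4⟩ := reaches_corner F hR
      (fun z hz h h' => (hS z hz h h').2) heu hb ha hc hl hu h1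
    exact ⟨q, h2, by linarith, h3.le, h4⟩
  by_cases h2 : (F.Y p - l) * (F.X b - F.X p) < (F.Y p - F.Y b) * (c - F.X p)
  · obtain ⟨-, q, h2, h3, h4⟩ := reaches_corner F.negY (a := a) (c := c) (l := -u) (u := -l)
      (v := v) (P := P) (b := b) (p := p)
      (fun z h h' h2 h3 => hR z h h' (neg_le_neg_iff.1 h3) (neg_le_neg_iff.1 h2))
      (fun z hz h h' => neg_le_neg_iff.2 (hS z hz h h').1)
      (hel.imp fun e he z h h' h'' => he z h h' (neg_injective h'')) hb ha hc
      (neg_le_neg_iff.2 hu) (neg_le_neg_iff.2 hl) (by simpa [sub_eq_add_neg, add_comm] using h2)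
    have h3' : F.Y q = l := neg_injective h3
    exact ⟨q, h2, h3'.ge, by linarith, h4⟩
  push Not at h1 h2
  set s := (c - F.X p) / (F.X b - F.X p) with hs
  have hs0 : 0 ≤ s := div_nonneg (by linarith) hXb.le
  have hs1 : s ≤ 1 := (div_le_one hXb).2 (by linarith)
  have hsX : s * (F.X b - F.X p) = c - F.X p := div_mul_cancel₀ _ hXb.ne'
  have hY1 : s * (F.Y b - F.Y p) ≤ u - F.Y p := by
    refine le_of_mul_le_mul_right (a := F.X b - F.X p) ?_ hXb
    calc s * (F.Y b - F.Y p) * (F.X b - F.X p)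
        = (s * (F.X b - F.X p)) * (F.Y b - F.Y p) := by ring
      _ ≤ _ := by rw [hsX]; linarith
  have hY2 : s * (F.Y p - F.Y b) ≤ F.Y p - l := by
    refine le_of_mul_le_mul_right (a := F.X b - F.X p) ?_ hXb
    calc s * (F.Y p - F.Y b) * (F.X b - F.X p)
        = (s * (F.X b - F.X p)) * (F.Y p - F.Y b) := by ring
      _ ≤ _ := by rw [hsX]; linarith
  set m : Plane := AffineMap.lineMap p b s with hm
  have hmX : F.X m = c := by rw [hm, F.X_lineMap, hsX]; ring
  have hmY : F.Y m = F.Y p + s * (F.Y b - F.Y p) := F.Y_lineMap p b s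
  have hmu : F.Y m ≤ u := by rw [hmY]; linarith
  have hml : l ≤ F.Y m := by rw [hmY]; linarith
  refine ⟨m, hmX, hml, hmu, Relation.ReflTransGen.single (Or.inl ⟨?_, ?_⟩)⟩
  · rw [segment_eq_image_lineMap]
    exact ⟨s, ⟨hs0, hs1⟩, rfl⟩
  · intro z hz
    obtain ⟨h1, h2⟩ := F.mem_rect_of_mem_segment ⟨ha, hc⟩ ⟨hl, hu⟩ ⟨by linarith, hmX.le⟩
      ⟨hml, hmu⟩ hz
    exact hR z h1.1 h1.2 h2.1 h2.2

/-- Passage from the rectangle `[a, c] × [l, u]` of `P` to the next one, of height range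
`[l', u']`, for a beacon beyond the line `X = c`. The only obstacles are the walls on this line;
an object that meets one slides along it to the end of the wall, as `hbu` and `hbl` put the beacon
on the side of the opening. -/
lemma reaches_next (hR : ∀ z, a ≤ F.X z → F.X z ≤ c → l ≤ F.Y z → F.Y z ≤ u → z ∈ P)
    (hS : ∀ z ∈ P, a < F.X z → F.X z < c → l ≤ F.Y z ∧ F.Y z ≤ u)
    (hS' : ∀ z ∈ P, c < F.X z → F.X z < d → l' ≤ F.Y z ∧ F.Y z ≤ u') (hcd : c < d)
    (heu : ∃ e, ∀ z, a ≤ F.X z → F.X z ≤ c → F.Y z = u → z ∈ v.edgeSet ℝ e)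
    (hel : ∃ e, ∀ z, a ≤ F.X z → F.X z ≤ c → F.Y z = l → z ∈ v.edgeSet ℝ e)
    (hwu : u' < u → ∃ e, ∀ z, F.X z = c → u' ≤ F.Y z → F.Y z ≤ u → z ∈ v.edgeSet ℝ e)
    (hwl : l < l' → ∃ e, ∀ z, F.X z = c → l ≤ F.Y z → F.Y z ≤ l' → z ∈ v.edgeSet ℝ e)
    (hlu : l' ≤ u') (hb : c < F.X b) (hbu : u' < u → F.Y b ≤ u') (hbl : l < l' → l' ≤ F.Y b)
    (ha : a ≤ F.X p) (hc : F.X p ≤ c) (hl : l ≤ F.Y p) (hu : F.Y p ≤ u) :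
    ∃ q, F.X q = c ∧ l' ≤ F.Y q ∧ F.Y q ≤ u' ∧ Reaches v P b p q := by
  obtain ⟨q, hqX, hql, hqu, hq⟩ := reaches_line F hR hS heu hel hb ha hc hl hu
  by_cases h1 : u' < F.Y q
  · have h : u' < u := h1.trans_le hqu
    exact ⟨F.pt c u', by simp, by simpa, by simp, Relation.ReflTransGen.tail hq
      (Or.inr (slidesAlongEdge_vertical F (fun z hz h h' => (hS' z hz h h').2) hcd (hwu h)
        hb (hbu h) hqX hqu h1 (by simp) (by simp)))⟩
  by_cases h2 : F.Y q < l'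
  · have h : l < l' := hql.trans_lt h2
    refine ⟨F.pt c l', by simp, by simp, by simpa, Relation.ReflTransGen.tail hq (Or.inr ?_)⟩
    refine slidesAlongEdge_vertical F.negY (c := c) (d := d) (u' := -l') (u := -l)
      (fun z hz h h' => neg_le_neg_iff.2 (hS' z hz h h').1) hcd ?_ hb
      (neg_le_neg_iff.2 (hbl h)) hqX (neg_le_neg_iff.2 hql) (neg_lt_neg_iff.2 h2) (by simp)
      (by simp)
    exact (hwl h).imp fun e he z h h' h'' => he z h (neg_le_neg_iff.1 h'') (neg_le_neg_iff.1 h')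
  exact ⟨q, hqX, not_lt.1 h2, not_lt.1 h1, hq⟩

end Step

/-! ### Chains of rectangles -/

/-- In the frame `F`, the set `P` is the union of the `N` rectangles
`[x i, x (i + 1)] × [l i, u i]`, and the horizontal sides as well as the walls between consecutive
rectangles lie in edges of `v`. -/
structure IsRectChain {n : ℕ} (F : Frame) (v : Polygon Plane n) (P : Set Plane) (N : ℕ)
    (x l u : ℕ → ℝ) : Prop where
  x_lt : ∀ i < N, x i < x (i + 1)
  lt : ∀ i < N, l i < u i
  mem_iff : ∀ p, p ∈ P ↔ ∃ i < N, (x i ≤ F.X p ∧ F.X p ≤ x (i + 1)) ∧ l i ≤ F.Y p ∧ F.Y p ≤ u i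
  bot_edge : ∀ i < N, ∃ e, ∀ z, x i ≤ F.X z → F.X z ≤ x (i + 1) → F.Y z = l i → z ∈ v.edgeSet ℝ e
  top_edge : ∀ i < N, ∃ e, ∀ z, x i ≤ F.X z → F.X z ≤ x (i + 1) → F.Y z = u i → z ∈ v.edgeSet ℝ e
  bot_wall : ∀ i, i + 1 < N → l i ≠ l (i + 1) →
    ∃ e, ∀ z, F.X z = x (i + 1) → F.Y z ∈ uIcc (l i) (l (i + 1)) → z ∈ v.edgeSet ℝ e
  top_wall : ∀ i, i + 1 < N → u i ≠ u (i + 1) →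
    ∃ e, ∀ z, F.X z = x (i + 1) → F.Y z ∈ uIcc (u i) (u (i + 1)) → z ∈ v.edgeSet ℝ e

lemma le_of_step_lt {N : ℕ} {x : ℕ → ℝ} (h : ∀ i < N, x i < x (i + 1)) {i j : ℕ} (hij : i ≤ j)
    (hj : j ≤ N) : x i ≤ x j := by
  induction j, hij using Nat.le_induction with
  | base => exact le_rfl
  | succ k hk ih => exact (ih (by omega)).trans (h k (by omega)).le

lemma lt_of_step_lt {N : ℕ} {x : ℕ → ℝ} (h : ∀ i < N, x i < x (i + 1)) {i j : ℕ} (hij : i < j)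
    (hj : j ≤ N) : x i < x j :=
  (h i (by omega)).trans_le (le_of_step_lt h hij hj)

lemma eq_of_mem_slab {N : ℕ} {x : ℕ → ℝ} (h : ∀ i < N, x i < x (i + 1)) {i j : ℕ} (hi : i < N)
    (hj : j < N) {c : ℝ} (h1 : x i < c) (h2 : c < x (i + 1)) (h3 : x j ≤ c) (h4 : c ≤ x (j + 1)) :
    i = j := by
  rcases lt_trichotomy i j with hij | hij | hij
  · have := le_of_step_lt h (show i + 1 ≤ j by omega) hj.le
    linarith
  · exact hij
  · have := le_of_step_lt h (show j + 1 ≤ i by omega) hi.le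
    linarith

namespace IsRectChain

variable {n : ℕ} {F : Frame} {v : Polygon Plane n} {P : Set Plane} {N : ℕ} {x l u : ℕ → ℝ}

lemma negY (h : IsRectChain F v P N x l u) :
    IsRectChain F.negY v P N x (fun i => -u i) (fun i => -l i) where
  x_lt := h.x_lt
  lt i hi := neg_lt_neg (h.lt i hi)
  mem_iff p := by
    rw [h.mem_iff]
    simp only [Frame.negY_X, Frame.negY_Y, neg_le_neg_iff]
    simp only [and_comm]
  bot_edge i hi := (h.top_edge i hi).imp fun e he z h1 h2 h3 => he z h1 h2 (neg_injective h3)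
  top_edge i hi := (h.bot_edge i hi).imp fun e he z h1 h2 h3 => he z h1 h2 (neg_injective h3)
  bot_wall i hi hne := (h.top_wall i hi fun h' => hne (by rw [h'])).imp fun e he z h1 h2 =>
    he z h1 (by
      rw [mem_uIcc] at h2 ⊢
      simp only [Frame.negY_Y, neg_le_neg_iff] at h2
      tauto)
  top_wall i hi hne := (h.bot_wall i hi fun h' => hne (by rw [h'])).imp fun e he z h1 h2 =>
    he z h1 (by
      rw [mem_uIcc] at h2 ⊢
      simp only [Frame.negY_Y, neg_le_neg_iff] at h2
      tauto)

lemma mem_slab (h : IsRectChain F v P N x l u) {i : ℕ} (hi : i < N) {p : Plane} (hp : p ∈ P)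
    (h1 : x i < F.X p) (h2 : F.X p < x (i + 1)) : l i ≤ F.Y p ∧ F.Y p ≤ u i := by
  obtain ⟨j, hj, h3, h4⟩ := (h.mem_iff p).1 hp
  obtain rfl := eq_of_mem_slab h.x_lt hi hj h1 h2 h3.1 h3.2
  exact h4

section Beacon

variable {j : ℕ} {b : Plane}

lemma attracts_same (h : IsRectChain F v P N x l u) (hj : j < N)
    (hb : (x j ≤ F.X b ∧ F.X b ≤ x (j + 1)) ∧ l j ≤ F.Y b ∧ F.Y b ≤ u j) {p : Plane}
    (hp : (x j ≤ F.X p ∧ F.X p ≤ x (j + 1)) ∧ l j ≤ F.Y p ∧ F.Y p ≤ u j) : Attracts v P b p :=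
  Relation.ReflTransGen.single (Or.inl ⟨right_mem_segment ℝ p b, fun z hz =>
    (h.mem_iff z).2 ⟨j, hj, F.mem_rect_of_mem_segment hp.1 hp.2 hb.1 hb.2 hz⟩⟩)

/-- A beacon inside the slab of rectangle `j` attracts the rectangles from `s` to `j` if, wherever
the top descends or the bottom rises on the way to it, the beacon is not beyond the new height. -/
lemma attracts_left (h : IsRectChain F v P N x l u) (hj : j < N)
    (hbX : x j < F.X b ∧ F.X b < x (j + 1)) (hbY : l j ≤ F.Y b ∧ F.Y b ≤ u j) {s : ℕ}
    (hu : ∀ i, s ≤ i → i < j → u (i + 1) < u i → F.Y b ≤ u (i + 1))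
    (hl : ∀ i, s ≤ i → i < j → l i < l (i + 1) → l (i + 1) ≤ F.Y b) (k : ℕ) :
    ∀ i, i + k = j → s ≤ i → ∀ p,
      (x i ≤ F.X p ∧ F.X p ≤ x (i + 1)) ∧ l i ≤ F.Y p ∧ F.Y p ≤ u i → Attracts v P b p := by
  induction k with
  | zero =>
    rintro i rfl - p hp
    exact h.attracts_same hj ⟨⟨hbX.1.le, hbX.2.le⟩, hbY⟩ hp
  | succ k ih =>
    intro i hi hs p hp
    have hcj := le_of_step_lt h.x_lt (show i + 1 ≤ j by omega) hj.le
    obtain ⟨q, hq1, hq2, hq3, hpq⟩ := reaches_next F (v := v) (P := P) (b := b)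
      (a := x i) (c := x (i + 1)) (d := x (i + 2)) (l := l i) (u := u i) (l' := l (i + 1))
      (u' := u (i + 1))
      (fun z h1 h2 h3 h4 => (h.mem_iff z).2 ⟨i, by omega, ⟨h1, h2⟩, h3, h4⟩)
      (fun z hz h1 h2 => h.mem_slab (by omega) hz h1 h2)
      (fun z hz h1 h2 => h.mem_slab (by omega) hz h1 h2) (h.x_lt _ (by omega))
      (h.top_edge i (by omega)) (h.bot_edge i (by omega))
      (fun h' => (h.top_wall i (by omega) h'.ne').imp fun e he z h1 h2 h3 =>
        he z h1 (mem_uIcc.2 (Or.inr ⟨h2, h3⟩)))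
      (fun h' => (h.bot_wall i (by omega) h'.ne).imp fun e he z h1 h2 h3 =>
        he z h1 (mem_uIcc.2 (Or.inl ⟨h2, h3⟩)))
      (h.lt _ (by omega)).le (hcj.trans_lt hbX.1) (hu i hs (by omega)) (hl i hs (by omega))
      hp.1.1 hp.1.2 hp.2.1 hp.2.2
    exact hpq.trans (ih (i + 1) (by omega) (by omega) q
      ⟨⟨hq1.ge, hq1.le.trans (h.x_lt _ (by omega)).le⟩, hq2, hq3⟩)

/-- The mirror image of `attracts_left`. -/
lemma attracts_right (h : IsRectChain F v P N x l u) (hj : j < N)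
    (hbX : x j < F.X b ∧ F.X b < x (j + 1)) (hbY : l j ≤ F.Y b ∧ F.Y b ≤ u j) {t : ℕ} (ht : t < N)
    (hu : ∀ i, j ≤ i → i < t → u i < u (i + 1) → F.Y b ≤ u i)
    (hl : ∀ i, j ≤ i → i < t → l (i + 1) < l i → l i ≤ F.Y b) (k : ℕ) :
    ∀ i, j + k = i → i ≤ t → ∀ p,
      (x i ≤ F.X p ∧ F.X p ≤ x (i + 1)) ∧ l i ≤ F.Y p ∧ F.Y p ≤ u i → Attracts v P b p := by
  induction k with
  | zero =>
    rintro i rfl - p hp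
    exact h.attracts_same hj ⟨⟨hbX.1.le, hbX.2.le⟩, hbY⟩ hp
  | succ k ih =>
    intro i hi hs p hp
    obtain ⟨i, rfl⟩ : ∃ i', i = i' + 1 := ⟨j + k, by omega⟩
    have hcj := le_of_step_lt h.x_lt (show j + 1 ≤ i + 1 by omega) (by omega)
    obtain ⟨q, hq1, hq2, hq3, hpq⟩ := reaches_next F.negX (v := v) (P := P) (b := b) (p := p)
      (a := -x (i + 2)) (c := -x (i + 1)) (d := -x i) (l := l (i + 1)) (u := u (i + 1))
      (l' := l i) (u' := u i)
      (fun z h1 h2 h3 h4 => (h.mem_iff z).2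
        ⟨i + 1, by omega, ⟨neg_le_neg_iff.1 h2, neg_le_neg_iff.1 h1⟩, h3, h4⟩)
      (fun z hz h1 h2 => h.mem_slab (by omega) hz (neg_lt_neg_iff.1 h2) (neg_lt_neg_iff.1 h1))
      (fun z hz h1 h2 => h.mem_slab (by omega) hz (neg_lt_neg_iff.1 h2) (neg_lt_neg_iff.1 h1))
      (neg_lt_neg (h.x_lt _ (by omega)))
      ((h.top_edge (i + 1) (by omega)).imp fun e he z h1 h2 =>
        he z (neg_le_neg_iff.1 h2) (neg_le_neg_iff.1 h1))
      ((h.bot_edge (i + 1) (by omega)).imp fun e he z h1 h2 =>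
        he z (neg_le_neg_iff.1 h2) (neg_le_neg_iff.1 h1))
      (fun h' => (h.top_wall i (by omega) h'.ne).imp fun e he z h1 h2 h3 =>
        he z (neg_injective h1) (mem_uIcc.2 (Or.inl ⟨h2, h3⟩)))
      (fun h' => (h.bot_wall i (by omega) h'.ne').imp fun e he z h1 h2 h3 =>
        he z (neg_injective h1) (mem_uIcc.2 (Or.inr ⟨h2, h3⟩)))
      (h.lt _ (by omega)).le (neg_lt_neg (hbX.2.trans_le hcj)) (hu i (by omega) (by omega))
      (hl i (by omega) (by omega)) (neg_le_neg hp.1.2) (neg_le_neg hp.1.1) hp.2.1 hp.2.2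
    have hq1' : F.X q = x (i + 1) := neg_injective hq1
    exact hpq.trans (ih i (by omega) (by omega) q
      ⟨⟨by rw [hq1']; exact (h.x_lt _ (by omega)).le, hq1'.le⟩, hq2, hq3⟩)

end Beacon

/-- If the lower chain changes its height at most once between the rectangles `s` and `t`, then a
beacon on a lowest bottom side attracts all of these rectangles: its height is below every opening
in the upper chain, and no wall of the lower chain faces away from it. -/
lemma exists_beacon_of_bot (h : IsRectChain F v P N x l u) {s t : ℕ} (hst : s ≤ t) (ht : t < N)
    (hc : ∀ i ∈ Finset.Ico s t, ∀ i' ∈ Finset.Ico s t,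
      l i ≠ l (i + 1) → l i' ≠ l (i' + 1) → i = i') :
    ∃ b ∈ P, ∀ i, s ≤ i → i ≤ t → ∀ p,
      (x i ≤ F.X p ∧ F.X p ≤ x (i + 1)) ∧ l i ≤ F.Y p ∧ F.Y p ≤ u i → Attracts v P b p := by
  obtain ⟨j, hj, hmin⟩ := (Finset.Icc s t).exists_min_image l ⟨s, Finset.mem_Icc.2 ⟨le_rfl, hst⟩⟩
  rw [Finset.mem_Icc] at hj
  simp only [Finset.mem_Icc, Finset.mem_Ico] at hmin hc
  have hx := h.x_lt j (by omega)
  have hlu := h.lt j (by omega)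
  have const : ∀ a k, s ≤ a → a + k ≤ t →
      (∀ i, a ≤ i → i < a + k → l i = l (i + 1)) → l a = l (a + k) := by
    intro a k ha hk hh
    induction k with
    | zero => rfl
    | succ k ih =>
      rw [ih (by omega) fun i h1 h2 => hh i h1 (by omega)]
      exact hh (a + k) (by omega) (by omega)
  set b := F.pt ((x j + x (j + 1)) / 2) (l j) with hbdef
  have hb1 : x j < F.X b ∧ F.X b < x (j + 1) := by
    rw [hbdef, F.X_pt]; constructor <;> linarith
  have hb2 : F.Y b = l j := by rw [hbdef, F.Y_pt]
  have hb3 : l j ≤ F.Y b ∧ F.Y b ≤ u j := ⟨hb2.ge, by linarith⟩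
  refine ⟨b, (h.mem_iff b).2 ⟨j, by omega, ⟨hb1.1.le, hb1.2.le⟩, hb3⟩, ?_⟩
  intro i hsi hit p hp
  rcases le_total i j with hij | hij
  · refine h.attracts_left (by omega) hb1 hb3 (s := s) ?_ ?_ (j - i) i (by omega) hsi p hp
    · intro i' h1 h2 _
      have := hmin (i' + 1) (by omega)
      have := h.lt (i' + 1) (by omega)
      linarith
    · intro i' h1 h2 h3
      exfalso
      have h4 : l (i' + 1) = l (i' + 1 + (j - (i' + 1))) := by
        refine const _ _ (by omega) (by omega) fun a h5 h6 => ?_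
        by_contra h7
        have := hc i' (by omega) a (by omega) h3.ne h7
        omega
      rw [show i' + 1 + (j - (i' + 1)) = j by omega] at h4
      have := hmin i' (by omega)
      linarith
  · refine h.attracts_right (by omega) hb1 hb3 (t := t) ht ?_ ?_ (i - j) i (by omega) hit p hp
    · intro i' h1 h2 _
      have := hmin i' (by omega)
      have := h.lt i' (by omega)
      linarith
    · intro i' h1 h2 h3
      exfalso
      have h4 : l j = l (j + (i' - j)) := by
        refine const _ _ (by omega) (by omega) fun a h5 h6 => ?_
        by_contra h7
        have := hc i' (by omega) a (by omega) h3.ne' h7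
        omega
      rw [show j + (i' - j) = i' by omega] at h4
      have := hmin (i' + 1) (by omega)
      linarith

open Classical in
/-- The number of height changes of a step function at the transition from step `i` to step
`i + 1`. -/
noncomputable def changes (f : ℕ → ℝ) (i : ℕ) : ℕ := if f i = f (i + 1) then 0 else 1

lemma eq_of_sum_changes_le_one {f : ℕ → ℝ} {s : Finset ℕ} (h : ∑ i ∈ s, changes f i ≤ 1) :
    ∀ i ∈ s, ∀ i' ∈ s, f i ≠ f (i + 1) → f i' ≠ f (i' + 1) → i = i' := by
  intro i hi i' hi' h1 h2
  by_contra hne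
  have h3 : ∑ k ∈ {i, i'}, changes f k ≤ ∑ k ∈ s, changes f k :=
    Finset.sum_le_sum_of_subset (by
      intro k hk
      rcases Finset.mem_insert.1 hk with rfl | hk
      · exact hi
      · rwa [Finset.mem_singleton.1 hk])
  rw [Finset.sum_pair hne, changes, changes, if_neg h1, if_neg h2] at h3
  omega

lemma changes_neg (f : ℕ → ℝ) (i : ℕ) : changes (fun j => -f j) i = changes f i := by
  simp [changes]

/-- At most three height changes can be served by one beacon, as one of the two chains has at most
one of them. -/
lemma exists_beacon (h : IsRectChain F v P N x l u) {s t : ℕ} (hst : s ≤ t) (ht : t < N)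
    (hc : ∑ i ∈ Finset.Ico s t, (changes l i + changes u i) ≤ 3) :
    ∃ b ∈ P, ∀ i, s ≤ i → i ≤ t → ∀ p,
      (x i ≤ F.X p ∧ F.X p ≤ x (i + 1)) ∧ l i ≤ F.Y p ∧ F.Y p ≤ u i → Attracts v P b p := by
  rw [Finset.sum_add_distrib] at hc
  rcases (by omega : ∑ i ∈ Finset.Ico s t, changes l i ≤ 1 ∨
    ∑ i ∈ Finset.Ico s t, changes u i ≤ 1) with h1 | h1
  · exact h.exists_beacon_of_bot hst ht (eq_of_sum_changes_le_one h1)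
  · obtain ⟨b, hb, hb'⟩ := h.negY.exists_beacon_of_bot hst ht
      (eq_of_sum_changes_le_one (f := fun i => -u i) (by simpa only [changes_neg] using h1))
    refine ⟨b, hb, fun i h2 h3 p hp => hb' i h2 h3 p ⟨hp.1, ?_, ?_⟩⟩
    · exact neg_le_neg hp.2.2
    · exact neg_le_neg hp.2.1

/-- The chain is cut greedily: each piece is the longest one with at most three height changes, so
that each piece but the last one uses up at least four changes, including those at the cut. -/
lemma exists_finset_attracting (h : IsRectChain F v P N x l u) (k : ℕ) :
    ∀ s, s + k = N → 0 < k → ∃ S : Finset Plane,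
      4 * S.card ≤ ∑ i ∈ Finset.Ico s (N - 1), (changes l i + changes u i) + 4 ∧ (∀ b ∈ S, b ∈ P) ∧
      ∀ i, s ≤ i → i < N → ∀ p,
        (x i ≤ F.X p ∧ F.X p ≤ x (i + 1)) ∧ l i ≤ F.Y p ∧ F.Y p ≤ u i →
        ∃ b ∈ S, Attracts v P b p := by
  induction k using Nat.strong_induction_on with
  | _ k ih =>
    intro s hs hk
    set g := fun i => changes l i + changes u i with hg
    by_cases h3 : ∑ i ∈ Finset.Ico s (N - 1), g i ≤ 3
    · obtain ⟨b, hb, hb'⟩ := h.exists_beacon (show s ≤ N - 1 by omega) (by omega) h3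
      refine ⟨{b}, by simp, by simpa using hb, fun i h1 h2 p hp => ⟨b, by simp, ?_⟩⟩
      exact hb' i h1 (by omega) p hp
    · classical
      have hex : ∃ t, s ≤ t ∧ 4 ≤ ∑ i ∈ Finset.Ico s t, g i := ⟨N - 1, by omega, by omega⟩
      obtain ⟨h1, h2⟩ := Nat.find_spec hex
      have hmin : ∀ t < Nat.find hex, _ := fun t => Nat.find_min hex
      have htN : Nat.find hex ≤ N - 1 := Nat.find_min' hex ⟨by omega, by omega⟩
      set t := Nat.find hex
      have hst : s < t := by
        rcases h1.eq_or_lt with h' | h'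
        · rw [← h'] at h2; simp at h2
        · exact h'
      have hlow : ∑ i ∈ Finset.Ico s (t - 1), g i ≤ 3 := by
        have := hmin (t - 1) (by omega)
        push Not at this
        have := this (by omega)
        omega
      obtain ⟨b, hb, hb'⟩ := h.exists_beacon (show s ≤ t - 1 by omega) (by omega) hlow
      obtain ⟨S, hS1, hS2, hS3⟩ := ih (N - t) (by omega) t (by omega) (by omega)
      refine ⟨insert b S, ?_, ?_, ?_⟩
      · have h4 := Finset.card_insert_le b S
        have h5 : ∑ i ∈ Finset.Ico s t, g i + ∑ i ∈ Finset.Ico t (N - 1), g i =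
            ∑ i ∈ Finset.Ico s (N - 1), g i := Finset.sum_Ico_consecutive g h1 htN
        change 4 * S.card ≤ ∑ i ∈ Finset.Ico t (N - 1), g i + 4 at hS1
        change 4 * (insert b S).card ≤ ∑ i ∈ Finset.Ico s (N - 1), g i + 4
        omega
      · intro c hc
        rcases Finset.mem_insert.1 hc with rfl | hc
        · exact hb
        · exact hS2 c hc
      · intro i h6 h7 p hp
        by_cases hit : i < t
        · exact ⟨b, Finset.mem_insert_self _ _, hb' i h6 (by omega) p hp⟩
        · obtain ⟨c, hc, hc'⟩ := hS3 i (by omega) h7 p hp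
          exact ⟨c, Finset.mem_insert_of_mem hc, hc'⟩

/-- A chain of rectangles with few height changes is covered by few beacons; the number can be
prescribed, as further beacons do no harm. -/
lemma exists_covers (h : IsRectChain F v P N x l u) (hN : 0 < N) {r m : ℕ}
    (hr : ∑ i ∈ Finset.range (N - 1), (changes l i + changes u i) ≤ r) (hm : r / 4 + 1 ≤ m) :
    ∃ S : Finset Plane, S.card = m ∧ Covers v P S := by
  obtain ⟨S, hS1, hS2, hS3⟩ := h.exists_finset_attracting N 0 (by omega) hN
  rw [← Finset.range_eq_Ico] at hS1
  have hinf : P.Infinite := by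
    have h1 := h.lt 0 hN
    refine ((Icc_infinite h1).image (f := fun y => F.pt (x 0) y) ?_).mono ?_
    · intro y _ y' _ hyy
      simpa using congrArg F.Y hyy
    · rintro _ ⟨y, hy, rfl⟩
      exact (h.mem_iff _).2 ⟨0, hN, by simpa using (h.x_lt 0 hN).le, by simpa using hy⟩
  obtain ⟨T, hT1, hT2, hT3⟩ : ∃ T : Finset Plane, S ⊆ T ∧ (T : Set Plane) ⊆ P ∧ T.card = m := by
    have hle : S.card ≤ m := by omega
    clear hm
    induction m, hle using Nat.le_induction with
    | base => exact ⟨S, Finset.Subset.rfl, hS2, rfl⟩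
    | succ k hk ih =>
      obtain ⟨T, hT1, hT2, hT3⟩ := ih
      obtain ⟨a, ha, haT⟩ := hinf.exists_notMem_finset T
      classical
      refine ⟨insert a T, hT1.trans (Finset.subset_insert _ _), ?_, ?_⟩
      · rw [Finset.coe_insert]
        exact insert_subset ha hT2
      · rw [Finset.card_insert_of_notMem haT, hT3]
  refine ⟨T, hT3, fun b hb => hT2 hb, fun p hp => ?_⟩
  obtain ⟨i, hi, hpi⟩ := (h.mem_iff p).1 hp
  obtain ⟨b, hb, hb'⟩ := hS3 i (by omega) hi p hpi
  exact ⟨b, hT1 hb, hb'⟩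

end IsRectChain

/-! ### Edges of a rectilinear polygon -/

/-- A rectilinear polygon, as in `IsSimpleRectilinearPolygon`, whose edges are parallel to the axes
of the frame `F` and whose sections by vertical lines of `F` are connected. -/
structure IsAxisPolygon {n : ℕ} (F : Frame) (v : Polygon Plane n) (P : Set Plane) : Prop where
  simple : IsSimpleClosedPolygonalCurve v
  rectilinear : ∀ i : Fin n,
    (F.X (v i) = F.X (v (finRotate n i)) ∧
      F.Y (v (finRotate n i)) = F.Y (v (finRotate n (finRotate n i)))) ∨
    (F.Y (v i) = F.Y (v (finRotate n i)) ∧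
      F.X (v (finRotate n i)) = F.X (v (finRotate n (finRotate n i))))
  isCompact : IsCompact P
  closure_interior : closure (interior P) = P
  frontier_eq : frontier P = v.boundary ℝ
  sections : ∀ c : ℝ, IsPreconnected (P ∩ {p : Plane | F.X p = c})

/-- The `i`-th edge is parallel to the `Y`-axis. -/
def Vert {n : ℕ} (F : Frame) (v : Polygon Plane n) (i : Fin n) : Prop :=
  F.X (v i) = F.X (v (finRotate n i))

/-- The `i`-th edge is parallel to the `X`-axis. -/
def Horiz {n : ℕ} (F : Frame) (v : Polygon Plane n) (i : Fin n) : Prop :=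
  F.Y (v i) = F.Y (v (finRotate n i))

lemma IsSimpleRectilinearPolygon.isAxisPolygon {n : ℕ} {v : Polygon Plane n} {P : Set Plane}
    (h : IsSimpleRectilinearPolygon v P) {k : Fin 2} (hk : HasConnectedSections k P) :
    IsAxisPolygon (Frame.std k) v P where
  simple := h.simple
  rectilinear i := by
    have := h.rectilinear i
    fin_cases k
    · exact this
    · exact this.symm
  isCompact := h.isCompact
  closure_interior := h.closure_interior
  frontier_eq := h.frontier_eq
  sections := hk

/-- A connected set without frontier points of a closed set lies inside or outside of it. -/
lemma IsPreconnected.subset_of_forall_notMem_frontier {α : Type*} [TopologicalSpace α] {s P : Set α}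
    (hs : IsPreconnected s) (hP : IsClosed P) (h : ∀ z ∈ s, z ∉ frontier P)
    (hne : (s ∩ P).Nonempty) : s ⊆ P := by
  obtain ⟨z, hz, hzP⟩ := hne
  refine (hs.subset_left_of_subset_union isOpen_interior hP.isOpen_compl
    (disjoint_compl_right.mono_left interior_subset) ?_ ⟨z, hz, ?_⟩).trans interior_subset
  · intro y hy
    by_cases hyP : y ∈ P
    · left
      by_contra hyi
      exact h y hy ((mem_frontier_iff_notMem_interior hyP).2 hyi)
    · exact Or.inr hyP
  · by_contra hyi
    exact h z hz ((mem_frontier_iff_notMem_interior hzP).2 hyi)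

/-- An open set contains, with a point, a small axis-parallel box around it. -/
lemma Frame.exists_box (F : Frame) {O : Set Plane} (hO : IsOpen O) {q : Plane} (hq : q ∈ O) :
    ∃ ε > 0, ∀ s t : ℝ, |s| < ε → |t| < ε → F.pt (F.X q + s) (F.Y q + t) ∈ O := by
  have hc : Continuous fun w : ℝ × ℝ => F.pt (F.X q + w.1) (F.Y q + w.2) :=
    F.continuous_pt.comp (by fun_prop : Continuous fun w : ℝ × ℝ => (F.X q + w.1, F.Y q + w.2))
  have h0 : F.pt (F.X q + 0) (F.Y q + 0) = q := F.ext (by simp) (by simp)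
  have hmem : (fun w : ℝ × ℝ => F.pt (F.X q + w.1) (F.Y q + w.2)) ⁻¹' O ∈ 𝓝 ((0 : ℝ), (0 : ℝ)) :=
    hc.continuousAt.preimage_mem_nhds (hO.mem_nhds (by simpa only [h0] using hq))
  obtain ⟨ε, hε, hball⟩ := Metric.mem_nhds_iff.1 hmem
  refine ⟨ε, hε, fun s t hs ht => ?_⟩
  refine hball (show (s, t) ∈ _ from ?_)
  rw [Metric.mem_ball, Prod.dist_eq]
  simp [hs, ht]

namespace IsAxisPolygon

variable {n : ℕ} {F : Frame} {v : Polygon Plane n} {P : Set Plane}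

lemma negX (h : IsAxisPolygon F v P) : IsAxisPolygon F.negX v P where
  simple := h.simple
  rectilinear i := by simpa using h.rectilinear i
  isCompact := h.isCompact
  closure_interior := h.closure_interior
  frontier_eq := h.frontier_eq
  sections c := by
    have := h.sections (-c)
    simpa [neg_eq_iff_eq_neg] using this

lemma negY (h : IsAxisPolygon F v P) : IsAxisPolygon F.negY v P where
  simple := h.simple
  rectilinear i := by simpa using h.rectilinear i
  isCompact := h.isCompact
  closure_interior := h.closure_interior
  frontier_eq := h.frontier_eq
  sections := h.sections

lemma vert_or_horiz (h : IsAxisPolygon F v P) (i : Fin n) : Vert F v i ∨ Horiz F v i :=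
  (h.rectilinear i).imp And.left And.left

lemma not_vert_and_horiz (h : IsAxisPolygon F v P) {i : Fin n} (h1 : Vert F v i)
    (h2 : Horiz F v i) : False :=
  h.simple.nondegenerate i (F.ext h1 h2)

lemma horiz_next (h : IsAxisPolygon F v P) {i : Fin n} :
    Horiz F v (finRotate n i) ↔ Vert F v i := by
  constructor
  · intro h1
    rcases h.rectilinear i with h2 | h2
    · exact h2.1
    · exact (h.not_vert_and_horiz h2.2 h1).elim
  · intro h1
    rcases h.rectilinear i with h2 | h2
    · exact h2.2
    · exact (h.not_vert_and_horiz h1 h2.1).elim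

lemma vert_next (h : IsAxisPolygon F v P) {i : Fin n} :
    Vert F v (finRotate n i) ↔ Horiz F v i := by
  constructor
  · intro h1
    rcases h.rectilinear i with h2 | h2
    · exact (h.not_vert_and_horiz h1 h2.2).elim
    · exact h2.1
  · intro h1
    rcases h.rectilinear i with h2 | h2
    · exact (h.not_vert_and_horiz h2.1 h1).elim
    · exact h2.2

end IsAxisPolygon

section Edge

variable {n : ℕ} {F : Frame} {v : Polygon Plane n} {i : Fin n} {p : Plane}

lemma Horiz.mem_edge (h : Horiz F v i) : p ∈ v.edgeSet ℝ i ↔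
    F.Y p = F.Y (v i) ∧ F.X p ∈ uIcc (F.X (v i)) (F.X (v (finRotate n i))) := by
  rw [Polygon.edgeSet, affineSegment_eq_segment, F.mem_segment_of_Y_eq h]

lemma Vert.mem_edge (h : Vert F v i) : p ∈ v.edgeSet ℝ i ↔
    F.X p = F.X (v i) ∧ F.Y p ∈ uIcc (F.Y (v i)) (F.Y (v (finRotate n i))) := by
  rw [Polygon.edgeSet, affineSegment_eq_segment, F.mem_segment_of_X_eq h]

lemma left_mem_edge (v : Polygon Plane n) (i : Fin n) : v i ∈ v.edgeSet ℝ i :=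
  left_mem_affineSegment ℝ _ _

lemma right_mem_edge (v : Polygon Plane n) (i : Fin n) : v (finRotate n i) ∈ v.edgeSet ℝ i :=
  right_mem_affineSegment ℝ _ _

end Edge

namespace IsAxisPolygon

variable {n : ℕ} {F : Frame} {v : Polygon Plane n} {P : Set Plane}

lemma next_or_next (h : IsAxisPolygon F v P) {i j : Fin n} (hij : i ≠ j) {q : Plane}
    (hi : q ∈ v.edgeSet ℝ i) (hj : q ∈ v.edgeSet ℝ j) :
    (j = finRotate n i ∧ q = v j) ∨ (i = finRotate n j ∧ q = v i) := by
  by_cases h1 : j = finRotate n i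
  · subst h1
    exact Or.inl ⟨rfl, (h.simple.adjacent i).subset ⟨hi, hj⟩⟩
  by_cases h2 : i = finRotate n j
  · subst h2
    exact Or.inr ⟨rfl, (h.simple.adjacent j).subset ⟨hj, hi⟩⟩
  exact (Set.disjoint_left.1 (h.simple.nonadjacent i j hij.symm h1 h2) hi hj).elim

lemma horiz_unique (h : IsAxisPolygon F v P) {i j : Fin n} (h1 : Horiz F v i) (h2 : Horiz F v j)
    {q : Plane} (hi : q ∈ v.edgeSet ℝ i) (hj : q ∈ v.edgeSet ℝ j) : i = j := by
  by_contra hij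
  rcases h.next_or_next hij hi hj with ⟨rfl, -⟩ | ⟨rfl, -⟩
  · exact h.not_vert_and_horiz (h.horiz_next.1 h2) h1
  · exact h.not_vert_and_horiz (h.horiz_next.1 h1) h2

lemma vert_unique (h : IsAxisPolygon F v P) {i j : Fin n} (h1 : Vert F v i) (h2 : Vert F v j)
    {q : Plane} (hi : q ∈ v.edgeSet ℝ i) (hj : q ∈ v.edgeSet ℝ j) : i = j := by
  by_contra hij
  rcases h.next_or_next hij hi hj with ⟨rfl, -⟩ | ⟨rfl, -⟩
  · exact h.not_vert_and_horiz h1 (h.vert_next.1 h2)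
  · exact h.not_vert_and_horiz h2 (h.vert_next.1 h1)

/-- A point common to a horizontal and a vertical edge is an end of the horizontal one. -/
lemma eq_end_of_mem (h : IsAxisPolygon F v P) {i j : Fin n} (h1 : Horiz F v i) (h2 : Vert F v j)
    {q : Plane} (hi : q ∈ v.edgeSet ℝ i) (hj : q ∈ v.edgeSet ℝ j) :
    q = v i ∨ q = v (finRotate n i) := by
  have hij : i ≠ j := by
    rintro rfl
    exact h.not_vert_and_horiz h2 h1
  rcases h.next_or_next hij hi hj with ⟨rfl, h3⟩ | ⟨rfl, h3⟩
  · exact Or.inr h3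
  · exact Or.inl h3

lemma isClosed (h : IsAxisPolygon F v P) : IsClosed P := h.isCompact.isClosed

lemma mem_frontier_iff (h : IsAxisPolygon F v P) {p : Plane} :
    p ∈ frontier P ↔ ∃ i, p ∈ v.edgeSet ℝ i := by
  rw [h.frontier_eq, Polygon.boundary, mem_iUnion]

lemma mem_of_mem_edge (h : IsAxisPolygon F v P) {p : Plane} {i : Fin n}
    (hp : p ∈ v.edgeSet ℝ i) : p ∈ P :=
  h.isClosed.frontier_subset (h.mem_frontier_iff.2 ⟨i, hp⟩)

lemma not_mem_interior_of_mem_edge (h : IsAxisPolygon F v P) {p : Plane} {i : Fin n}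
    (hp : p ∈ v.edgeSet ℝ i) : p ∉ interior P :=
  (mem_frontier_iff_notMem_interior (h.mem_of_mem_edge hp)).1 (h.mem_frontier_iff.2 ⟨i, hp⟩)

/-! ### The polygon over a slab without vertices -/

section Slab

variable {a b : ℝ}

/-- Between consecutive abscissae of vertices, a boundary point lies on a horizontal edge that
crosses the whole slab. -/
lemma exists_edge_through (h : IsAxisPolygon F v P) (hno : ∀ i, a < F.X (v i) → b ≤ F.X (v i))
    {p : Plane} (hp : p ∈ frontier P) (h1 : a < F.X p) (h2 : F.X p < b) :
    ∃ e, Horiz F v e ∧ ∀ z, a ≤ F.X z → F.X z ≤ b → F.Y z = F.Y p → z ∈ v.edgeSet ℝ e := by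
  obtain ⟨e, he⟩ := h.mem_frontier_iff.1 hp
  have hout : ∀ i, F.X (v i) ≤ a ∨ b ≤ F.X (v i) := fun i => (le_or_gt _ _).imp_right (hno i)
  rcases h.vert_or_horiz e with hv | hh
  · have := (hv.mem_edge.1 he).1
    rcases hout e with h3 | h3 <;> linarith
  · obtain ⟨hY, hX⟩ := hh.mem_edge.1 he
    refine ⟨e, hh, fun z hz1 hz2 hz => hh.mem_edge.2 ⟨hz.trans hY, ?_⟩⟩
    rw [mem_uIcc] at hX ⊢
    rcases hout e with h3 | h3 <;> rcases hout (finRotate n e) with h4 | h4 <;>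
      rcases hX with h5 | h5 <;> first | (left; constructor <;> linarith) |
        (right; constructor <;> linarith)

lemma mem_of_Y_eq (h : IsAxisPolygon F v P) (hno : ∀ i, a < F.X (v i) → b ≤ F.X (v i))
    {p q : Plane} (hp : p ∈ P) (h1 : a < F.X p) (h2 : F.X p < b) (h3 : a < F.X q)
    (h4 : F.X q < b) (hY : F.Y q = F.Y p) : q ∈ P := by
  have hseg : ∀ z ∈ segment ℝ p q, (a < F.X z ∧ F.X z < b) ∧ F.Y z = F.Y p := by
    intro z hz
    exact (F.convex_X_mem_Y_mem (convex_Ioo a b) (convex_singleton (F.Y p))).segment_subset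
      (x := p) (y := q) ⟨⟨h1, h2⟩, rfl⟩ ⟨⟨h3, h4⟩, hY⟩ hz
  by_cases hf : ∃ z ∈ segment ℝ p q, z ∈ frontier P
  · obtain ⟨z, hz, hzf⟩ := hf
    obtain ⟨h5, h6⟩ := hseg z hz
    obtain ⟨e, -, he⟩ := h.exists_edge_through hno hzf h5.1 h5.2
    exact h.mem_of_mem_edge (he q h3.le h4.le (hY.trans h6.symm))
  · push Not at hf
    exact (convex_segment p q).isPreconnected.subset_of_forall_notMem_frontier h.isClosed hf
      ⟨p, left_mem_segment ℝ p q, hp⟩ (right_mem_segment ℝ p q)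

lemma exists_interior_slab (h : IsAxisPolygon F v P) {p : Plane} (hp : p ∈ P)
    (h1 : a < F.X p) (h2 : F.X p < b) : ∃ q ∈ interior P, a < F.X q ∧ F.X q < b := by
  have hO : IsOpen {z : Plane | F.X z ∈ Ioo a b} := isOpen_Ioo.preimage F.continuous_X
  rw [← h.closure_interior, mem_closure_iff] at hp
  obtain ⟨q, hq1, hq2⟩ := hp _ hO ⟨h1, h2⟩
  exact ⟨q, hq2, hq1⟩

/-- Over a slab between consecutive abscissae of vertices, the polygon is a rectangle, whose
horizontal sides lie in edges. -/
lemma exists_rect (h : IsAxisPolygon F v P) (hno : ∀ i, a < F.X (v i) → b ≤ F.X (v i))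
    {p₀ : Plane} (hp₀ : p₀ ∈ P) (h1 : a < F.X p₀) (h2 : F.X p₀ < b) :
    ∃ l u, l < u ∧
      (∀ p, a < F.X p → F.X p < b → (p ∈ P ↔ l ≤ F.Y p ∧ F.Y p ≤ u)) ∧
      (∀ p, a < F.X p → F.X p < b → (p ∈ frontier P ↔ F.Y p = l ∨ F.Y p = u)) ∧
      (∃ e, Horiz F v e ∧ ∀ z, a ≤ F.X z → F.X z ≤ b → F.Y z = l → z ∈ v.edgeSet ℝ e) ∧
      (∃ e, Horiz F v e ∧ ∀ z, a ≤ F.X z → F.X z ≤ b → F.Y z = u → z ∈ v.edgeSet ℝ e) := by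
  set c := F.X p₀ with hc
  set S : Set Plane := P ∩ {p | F.X p = c} with hS
  have hScompact : IsCompact S :=
    h.isCompact.inter_right (isClosed_singleton.preimage F.continuous_X)
  have hSconn : IsConnected S := ⟨⟨p₀, hp₀, rfl⟩, h.sections c⟩
  obtain ⟨l, u, hlu⟩ : ∃ l u, F.Y '' S = Icc l u := ⟨_, _, eq_Icc_of_connected_compact
    (hSconn.image _ F.continuous_Y.continuousOn) (hScompact.image F.continuous_Y)⟩
  have hmem : ∀ p, a < F.X p → F.X p < b → (p ∈ P ↔ l ≤ F.Y p ∧ F.Y p ≤ u) := by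
    intro p hp1 hp2
    have h3 : F.Y p ∈ F.Y '' S ↔ l ≤ F.Y p ∧ F.Y p ≤ u := by rw [hlu]; rfl
    rw [← h3]
    constructor
    · intro hp
      exact ⟨F.pt c (F.Y p), ⟨h.mem_of_Y_eq hno hp hp1 hp2 (by simpa) (by simpa) (by simp),
        by simp⟩, by simp⟩
    · rintro ⟨q, ⟨hq, hqc⟩, hqY⟩
      exact h.mem_of_Y_eq hno hq (by rw [show F.X q = c from hqc]; exact h1)
        (by rw [show F.X q = c from hqc]; exact h2) hp1 hp2 hqY.symm
  have hlt : l < u := by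
    obtain ⟨q, hq, hq1, hq2⟩ := h.exists_interior_slab hp₀ h1 h2
    obtain ⟨ε, hε, hbox⟩ := F.exists_box isOpen_interior hq
    have hε' : |ε / 2| < ε := by rw [abs_of_pos (by linarith)]; linarith
    have h3 := (hmem q hq1 hq2).1 (interior_subset hq)
    have h4 := (hmem _ (by simpa using hq1) (by simpa using hq2)).1
      (interior_subset (hbox 0 (ε / 2) (by simpa) hε'))
    simp only [Frame.Y_pt] at h4
    linarith [h3.1, h4.2]
  have hfr : ∀ p, a < F.X p → F.X p < b → (p ∈ frontier P ↔ F.Y p = l ∨ F.Y p = u) := by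
    intro p hp1 hp2
    constructor
    · intro hp
      obtain ⟨h3, h4⟩ := (hmem p hp1 hp2).1 (h.isClosed.frontier_subset hp)
      by_contra hne
      push Not at hne
      refine (mem_frontier_iff_notMem_interior (h.isClosed.frontier_subset hp)).1 hp ?_
      refine mem_interior.2 ⟨_, ?_, F.isOpen_X_mem_Y_mem (isOpen_Ioo (a := a) (b := b))
        (isOpen_Ioo (a := l) (b := u)), ⟨hp1, hp2⟩, lt_of_le_of_ne h3 hne.1.symm,
        lt_of_le_of_ne h4 hne.2⟩
      rintro z ⟨hz1, hz2⟩
      exact (hmem z hz1.1 hz1.2).2 ⟨hz2.1.le, hz2.2.le⟩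
    · intro hp
      have hpP : p ∈ P := (hmem p hp1 hp2).2 (by rcases hp with hp | hp <;> rw [hp] <;> simp [hlt.le])
      refine (mem_frontier_iff_notMem_interior hpP).2 fun hint => ?_
      obtain ⟨ε, hε, hbox⟩ := F.exists_box isOpen_interior hint
      have hε' : |ε / 2| < ε := by rw [abs_of_pos (by linarith)]; linarith
      have h4 := (hmem _ (by simpa using hp1) (by simpa using hp2)).1
        (interior_subset (hbox 0 (ε / 2) (by simpa) hε'))
      have h5 := (hmem _ (by simpa using hp1) (by simpa using hp2)).1
        (interior_subset (hbox 0 (-(ε / 2)) (by simpa) (by rwa [abs_neg])))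
      simp only [Frame.Y_pt] at h4 h5
      rcases hp with hp | hp <;> linarith [h4.1, h4.2, h5.1, h5.2]
  have hedge : ∀ y, (y = l ∨ y = u) → ∃ e, Horiz F v e ∧
      ∀ z, a ≤ F.X z → F.X z ≤ b → F.Y z = y → z ∈ v.edgeSet ℝ e := by
    intro y hy
    have := h.exists_edge_through hno (p := F.pt c y)
      ((hfr _ (by simpa) (by simpa)).2 (by simpa)) (by simpa) (by simpa)
    simpa using this
  exact ⟨l, u, hlt, hmem, hfr, hedge l (Or.inl rfl), hedge u (Or.inr rfl)⟩

end Slab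

end IsAxisPolygon

/-! ### Decomposition into slabs -/

/-- The abscissae of the vertices are `x 0 < ⋯ < x N`, and over the slab between `x i` and
`x (i + 1)` the polygon is a rectangle of height range `[l i, u i]`. -/
structure IsSlabDecomp {n : ℕ} (F : Frame) (v : Polygon Plane n) (P : Set Plane) (N : ℕ)
    (x l u : ℕ → ℝ) : Prop where
  poly : IsAxisPolygon F v P
  pos : 0 < N
  x_lt : ∀ i < N, x i < x (i + 1)
  vertex_x : ∀ j, ∃ i ≤ N, F.X (v j) = x i
  exists_vertex : ∀ i ≤ N, ∃ j, F.X (v j) = x i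
  lt : ∀ i < N, l i < u i
  mem_slab : ∀ i < N, ∀ p, x i < F.X p → F.X p < x (i + 1) → (p ∈ P ↔ l i ≤ F.Y p ∧ F.Y p ≤ u i)
  frontier_slab : ∀ i < N, ∀ p, x i < F.X p → F.X p < x (i + 1) →
    (p ∈ frontier P ↔ F.Y p = l i ∨ F.Y p = u i)
  bot : ∀ i < N, ∃ e, Horiz F v e ∧
    ∀ z, x i ≤ F.X z → F.X z ≤ x (i + 1) → F.Y z = l i → z ∈ v.edgeSet ℝ e
  top : ∀ i < N, ∃ e, Horiz F v e ∧
    ∀ z, x i ≤ F.X z → F.X z ≤ x (i + 1) → F.Y z = u i → z ∈ v.edgeSet ℝ e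

lemma exists_increasing_enumeration (D : Finset ℝ) (hD : D.Nonempty) : ∃ (N : ℕ) (x : ℕ → ℝ),
    (∀ i < N, x i < x (i + 1)) ∧ ∀ c, c ∈ D ↔ ∃ i ≤ N, c = x i := by
  obtain ⟨N, hN⟩ : ∃ N, D.card = N + 1 := ⟨D.card - 1, by have := hD.card_pos; omega⟩
  refine ⟨N, fun i => if hi : i < N + 1 then D.orderEmbOfFin hN ⟨i, hi⟩ else 0, ?_, ?_⟩
  · intro i hi
    simp only [show i < N + 1 by omega, show i + 1 < N + 1 by omega, dif_pos]
    exact (D.orderEmbOfFin hN).strictMono (by simp)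
  · intro c
    have h1 : c ∈ D ↔ c ∈ range (D.orderEmbOfFin hN) := by
      rw [Finset.range_orderEmbOfFin, Finset.mem_coe]
    rw [h1]
    constructor
    · rintro ⟨⟨i, hi⟩, rfl⟩
      exact ⟨i, by omega, by simp [hi]⟩
    · rintro ⟨i, hi, rfl⟩
      exact ⟨⟨i, by omega⟩, by simp [show i < N + 1 by omega]⟩

lemma exists_slab {N : ℕ} {x : ℕ → ℝ} {c : ℝ} (h0 : x 0 ≤ c) (hN : c ≤ x N) (hpos : 0 < N) :
    ∃ i < N, x i ≤ c ∧ c ≤ x (i + 1) := by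
  induction N with
  | zero => omega
  | succ N ih =>
    by_cases h1 : x N ≤ c
    · exact ⟨N, by omega, h1, hN⟩
    · rcases Nat.eq_zero_or_pos N with rfl | hN'
      · exact absurd h0 h1
      · obtain ⟨i, hi, h2⟩ := ih (not_le.1 h1).le hN'
        exact ⟨i, by omega, h2⟩

namespace IsAxisPolygon

variable {n : ℕ} {F : Frame} {v : Polygon Plane n} {P : Set Plane}

lemma two_le (h : IsAxisPolygon F v P) : 2 ≤ n := by
  have := h.simple.three_le
  omega

/-- A property of vertices that is passed on to the next vertex holds for all or none. -/
lemma forall_of_next (h : IsAxisPolygon F v P) {p : Fin n → Prop}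
    (hp : ∀ j, p j → p (finRotate n j)) {i : Fin n} (hi : p i) (j : Fin n) : p j := by
  have hmove : ∀ j, finRotate n j ≠ j := fun j hj => h.simple.nondegenerate j (by rw [hj])
  have hcyc : (finRotate n).IsCycle := isCycle_finRotate_of_le h.two_le
  obtain ⟨k, hk⟩ := hcyc.exists_pow_eq (hmove i) (hmove j)
  rw [← hk]
  clear hk
  induction k with
  | zero => exact hi
  | succ k ih =>
    rw [pow_succ', Equiv.Perm.mul_apply]
    exact hp _ ih

lemma X_of_mem_edge {m : ℝ} (hm : ∀ j, m ≤ F.X (v j)) {i : Fin n} {p : Plane}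
    (hp : p ∈ v.edgeSet ℝ i) : m ≤ F.X p := by
  rw [Polygon.edgeSet, affineSegment_eq_segment] at hp
  exact (((convex_Ici m).linear_preimage F.X).segment_subset (hm _) (hm _)) hp

lemma le_X_of_mem (h : IsAxisPolygon F v P) {m : ℝ} (hm : ∀ j, m ≤ F.X (v j)) {p : Plane}
    (hp : p ∈ P) : m ≤ F.X p := by
  by_contra hlt
  have hconv : Convex ℝ {z : Plane | F.X z < m} := (convex_Iio m).linear_preimage F.X
  have hsub : {z : Plane | F.X z < m} ⊆ P := by
    refine hconv.isPreconnected.subset_of_forall_notMem_frontier h.isClosed ?_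
      ⟨p, not_le.1 hlt, hp⟩
    intro z hz hzf
    obtain ⟨i, hi⟩ := h.mem_frontier_iff.1 hzf
    exact absurd (X_of_mem_edge hm hi) (not_le.2 hz)
  obtain ⟨C, hC⟩ := h.isCompact.isBounded.exists_norm_le
  set t := -(|C| + |m| + 1) with ht
  have h1 : F.X (F.pt t 0) < m := by
    rw [F.X_pt]
    have := neg_abs_le m
    have := abs_nonneg C
    linarith
  have h2 := hC _ (hsub h1)
  have h3 := F.norm_sq (F.pt t 0)
  rw [F.X_pt, F.Y_pt] at h3
  have h4 := norm_nonneg (F.pt t 0)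
  have h5 := le_abs_self C
  have h6 := abs_nonneg m
  nlinarith

lemma X_le_of_mem (h : IsAxisPolygon F v P) {m : ℝ} (hm : ∀ j, F.X (v j) ≤ m) {p : Plane}
    (hp : p ∈ P) : F.X p ≤ m :=
  neg_le_neg_iff.1 (h.negX.le_X_of_mem (m := -m) (fun j => neg_le_neg (hm j)) hp)

/-- The boundary curve passes over every slab between two vertices. -/
lemma exists_mem_slab (h : IsAxisPolygon F v P) {a b : ℝ} (hab : a < b)
    (hno : ∀ j, a < F.X (v j) → b ≤ F.X (v j)) (ha : ∃ j, F.X (v j) ≤ a)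
    (hb : ∃ j, b ≤ F.X (v j)) : ∃ p ∈ P, a < F.X p ∧ F.X p < b := by
  obtain ⟨j, hj1, hj2⟩ : ∃ j, F.X (v j) ≤ a ∧ a < F.X (v (finRotate n j)) := by
    by_contra hcon
    push Not at hcon
    obtain ⟨i, hi⟩ := ha
    obtain ⟨k, hk⟩ := hb
    have := h.forall_of_next (p := fun j => F.X (v j) ≤ a) hcon hi k
    exact absurd (hk.trans this) (not_le.2 hab)
  have hj3 := hno _ hj2
  rcases h.vert_or_horiz j with hv | hh
  · have : F.X (v j) = F.X (v (finRotate n j)) := hv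
    linarith
  · refine ⟨F.pt ((a + b) / 2) (F.Y (v j)), h.mem_of_mem_edge (i := j) ?_, ?_, ?_⟩
    · rw [hh.mem_edge, F.X_pt, F.Y_pt, mem_uIcc]
      exact ⟨rfl, Or.inl ⟨by linarith, by linarith⟩⟩
    · rw [F.X_pt]; linarith
    · rw [F.X_pt]; linarith

lemma exists_slabDecomp (h : IsAxisPolygon F v P) : ∃ N x l u, IsSlabDecomp F v P N x l u := by
  classical
  have hn : 0 < n := by have := h.two_le; omega
  set D : Finset ℝ := Finset.univ.image fun j => F.X (v j) with hD
  obtain ⟨N, x, hx, hDx⟩ := exists_increasing_enumeration D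
    ⟨_, Finset.mem_image_of_mem _ (Finset.mem_univ (⟨0, hn⟩ : Fin n))⟩
  have hvx : ∀ j, ∃ i ≤ N, F.X (v j) = x i := fun j =>
    (hDx _).1 (Finset.mem_image_of_mem _ (Finset.mem_univ j))
  have hxv : ∀ i ≤ N, ∃ j, F.X (v j) = x i := by
    intro i hi
    obtain ⟨j, -, hj⟩ := Finset.mem_image.1 ((hDx _).2 ⟨i, hi, rfl⟩)
    exact ⟨j, hj⟩
  have hno : ∀ i < N, ∀ j, x i < F.X (v j) → x (i + 1) ≤ F.X (v j) := by
    intro i hi j hj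
    obtain ⟨k, hk, hk'⟩ := hvx j
    rw [hk'] at hj ⊢
    rcases Nat.lt_or_ge i k with h1 | h1
    · exact le_of_step_lt hx h1 hk
    · exact absurd hj (not_lt.2 (le_of_step_lt hx h1 hi.le))
  have hpos : 0 < N := by
    rcases Nat.eq_zero_or_pos N with rfl | hN
    · exfalso
      have hall : ∀ j, Vert F v j := by
        intro j
        obtain ⟨i, hi, h1⟩ := hvx j
        obtain ⟨i', hi', h2⟩ := hvx (finRotate n j)
        obtain rfl : i = 0 := by omega
        obtain rfl : i' = 0 := by omega
        exact h1.trans h2.symm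
      exact h.not_vert_and_horiz (hall _) (h.horiz_next.2 (hall ⟨0, hn⟩))
    · exact hN
  have hrect : ∀ i, ∃ l u, i < N → l < u ∧
      (∀ p, x i < F.X p → F.X p < x (i + 1) → (p ∈ P ↔ l ≤ F.Y p ∧ F.Y p ≤ u)) ∧
      (∀ p, x i < F.X p → F.X p < x (i + 1) → (p ∈ frontier P ↔ F.Y p = l ∨ F.Y p = u)) ∧
      (∃ e, Horiz F v e ∧ ∀ z, x i ≤ F.X z → F.X z ≤ x (i + 1) → F.Y z = l →
        z ∈ v.edgeSet ℝ e) ∧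
      (∃ e, Horiz F v e ∧ ∀ z, x i ≤ F.X z → F.X z ≤ x (i + 1) → F.Y z = u →
        z ∈ v.edgeSet ℝ e) := by
    intro i
    by_cases hi : i < N
    · obtain ⟨p, hp, h1, h2⟩ := h.exists_mem_slab (hx i hi) (hno i hi)
        ((hxv i hi.le).imp fun j hj => hj.le) ((hxv (i + 1) hi).imp fun j hj => hj.ge)
      obtain ⟨l, u, hlu⟩ := h.exists_rect (hno i hi) hp h1 h2
      exact ⟨l, u, fun _ => hlu⟩
    · exact ⟨0, 0, fun h' => absurd h' hi⟩
  choose l u hlu using hrect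
  exact ⟨N, x, l, u, h, hpos, hx, hvx, hxv, fun i hi => (hlu i hi).1, fun i hi => (hlu i hi).2.1,
    fun i hi => (hlu i hi).2.2.1, fun i hi => (hlu i hi).2.2.2.1, fun i hi => (hlu i hi).2.2.2.2⟩

end IsAxisPolygon

namespace IsSlabDecomp

variable {n : ℕ} {F : Frame} {v : Polygon Plane n} {P : Set Plane} {N : ℕ} {x l u : ℕ → ℝ}

lemma negY (h : IsSlabDecomp F v P N x l u) :
    IsSlabDecomp F.negY v P N x (fun i => -u i) (fun i => -l i) where
  poly := h.poly.negY
  pos := h.pos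
  x_lt := h.x_lt
  vertex_x := h.vertex_x
  exists_vertex := h.exists_vertex
  lt i hi := neg_lt_neg (h.lt i hi)
  mem_slab i hi p h1 h2 := by
    rw [h.mem_slab i hi p h1 h2, and_comm]
    simp
  frontier_slab i hi p h1 h2 := by
    rw [h.frontier_slab i hi p h1 h2, or_comm]
    simp
  bot i hi := (h.top i hi).imp fun e he =>
    ⟨neg_inj.2 he.1, fun z h1 h2 h3 => he.2 z h1 h2 (neg_injective h3)⟩
  top i hi := (h.bot i hi).imp fun e he =>
    ⟨neg_inj.2 he.1, fun z h1 h2 h3 => he.2 z h1 h2 (neg_injective h3)⟩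

lemma negX (h : IsSlabDecomp F v P N x l u) :
    IsSlabDecomp F.negX v P N (fun i => -x (N - i)) (fun i => l (N - 1 - i))
      (fun i => u (N - 1 - i)) where
  poly := h.poly.negX
  pos := h.pos
  x_lt i hi := by
    have := h.x_lt (N - (i + 1)) (by omega)
    rw [show N - (i + 1) + 1 = N - i by omega] at this
    exact neg_lt_neg this
  vertex_x j := by
    obtain ⟨i, hi, h1⟩ := h.vertex_x j
    exact ⟨N - i, by omega, by simp [h1, show N - (N - i) = i by omega]⟩
  exists_vertex i hi := (h.exists_vertex (N - i) (by omega)).imp fun j hj => by simp [hj]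
  lt i hi := h.lt _ (by omega)
  mem_slab i hi p h1 h2 := by
    have := h.mem_slab (N - 1 - i) (by omega) p
    rw [show N - 1 - i + 1 = N - i by omega] at this
    exact this (by rw [show N - 1 - i = N - (i + 1) by omega]; exact neg_lt_neg_iff.1 h2)
      (neg_lt_neg_iff.1 h1)
  frontier_slab i hi p h1 h2 := by
    have := h.frontier_slab (N - 1 - i) (by omega) p
    rw [show N - 1 - i + 1 = N - i by omega] at this
    exact this (by rw [show N - 1 - i = N - (i + 1) by omega]; exact neg_lt_neg_iff.1 h2)
      (neg_lt_neg_iff.1 h1)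
  bot i hi := by
    have := h.bot (N - 1 - i) (by omega)
    rw [show N - 1 - i + 1 = N - i by omega] at this
    exact this.imp fun e he => ⟨he.1, fun z h1 h2 h3 => he.2 z
      (by rw [show N - 1 - i = N - (i + 1) by omega]; exact neg_le_neg_iff.1 h2)
      (neg_le_neg_iff.1 h1) h3⟩
  top i hi := by
    have := h.top (N - 1 - i) (by omega)
    rw [show N - 1 - i + 1 = N - i by omega] at this
    exact this.imp fun e he => ⟨he.1, fun z h1 h2 h3 => he.2 z
      (by rw [show N - 1 - i = N - (i + 1) by omega]; exact neg_le_neg_iff.1 h2)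
      (neg_le_neg_iff.1 h1) h3⟩

/-- The closed rectangles belong to the polygon. -/
lemma mem_of_mem_rect (h : IsSlabDecomp F v P N x l u) {i : ℕ} (hi : i < N) {p : Plane}
    (h1 : x i ≤ F.X p) (h2 : F.X p ≤ x (i + 1)) (h3 : l i ≤ F.Y p) (h4 : F.Y p ≤ u i) : p ∈ P := by
  have hx := h.x_lt i hi
  set m := F.pt ((x i + x (i + 1)) / 2) (F.Y p) with hm
  have hmX : F.X m = (x i + x (i + 1)) / 2 := F.X_pt _ _
  have hmY : F.Y m = F.Y p := F.Y_pt _ _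
  have hcont : Continuous fun t : ℝ => (AffineMap.lineMap p m t : Plane) :=
    AffineMap.lineMap_continuous
  have hlim : Tendsto (fun t : ℝ => (AffineMap.lineMap p m t : Plane)) (𝓝[>] 0) (𝓝 p) := by
    have := hcont.tendsto 0
    rw [AffineMap.lineMap_apply_zero] at this
    exact this.mono_left nhdsWithin_le_nhds
  refine h.poly.isClosed.mem_of_tendsto hlim ?_
  filter_upwards [Ioo_mem_nhdsGT (zero_lt_one : (0 : ℝ) < 1)] with t ht
  refine (h.mem_slab i hi _ ?_ ?_).2 ⟨?_, ?_⟩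
  · rw [F.X_lineMap, hmX]; nlinarith [ht.1, ht.2]
  · rw [F.X_lineMap, hmX]; nlinarith [ht.1, ht.2]
  · rw [F.Y_lineMap, hmY]; linarith
  · rw [F.Y_lineMap, hmY]; linarith

/-- The polygon is the union of the closed rectangles, as it is the closure of its interior. -/
lemma mem_iff (h : IsSlabDecomp F v P N x l u) (p : Plane) : p ∈ P ↔
    ∃ i < N, (x i ≤ F.X p ∧ F.X p ≤ x (i + 1)) ∧ l i ≤ F.Y p ∧ F.Y p ≤ u i := by
  constructor
  swap
  · rintro ⟨i, hi, h1, h2⟩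
    exact h.mem_of_mem_rect hi h1.1 h1.2 h2.1 h2.2
  intro hp
  set R : Set Plane := ⋃ i ∈ Iio N, {p | F.X p ∈ Icc (x i) (x (i + 1)) ∧ F.Y p ∈ Icc (l i) (u i)}
    with hR
  have hRclosed : IsClosed R := (finite_Iio N).isClosed_biUnion fun i _ =>
    (isClosed_Icc.preimage F.continuous_X).inter (isClosed_Icc.preimage F.continuous_Y)
  have hRmem : ∀ z, z ∈ R ↔
      ∃ i < N, (x i ≤ F.X z ∧ F.X z ≤ x (i + 1)) ∧ l i ≤ F.Y z ∧ F.Y z ≤ u i := by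
    intro z
    simp only [hR, mem_iUnion, mem_Iio, exists_prop, mem_ofPred_eq, mem_Icc]
  rw [← hRmem]
  by_contra hpR
  rw [← h.poly.closure_interior, mem_closure_iff] at hp
  obtain ⟨q, hq⟩ := hp _ hRclosed.isOpen_compl hpR
  obtain ⟨ε, hε, hbox⟩ := F.exists_box (hRclosed.isOpen_compl.inter isOpen_interior) hq
  obtain ⟨c, hc, hcx⟩ : ∃ c ∈ Ioo (F.X q) (F.X q + ε), c ∉ ((Finset.range (N + 1)).image x) :=
    (Ioo_infinite (by linarith)).exists_notMem_finset _
  have hz := hbox (c - F.X q) 0 (by rw [abs_of_pos] <;> linarith [hc.1, hc.2]) (by simpa)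
  rw [add_sub_cancel, add_zero] at hz
  have hzP := interior_subset hz.2
  refine hz.1 ((hRmem _).2 ?_)
  have h0 : x 0 ≤ c := by
    have := h.poly.le_X_of_mem (m := x 0) (fun j => ?_) hzP
    · simpa using this
    · obtain ⟨i, hi, h1⟩ := h.vertex_x j
      rw [h1]
      exact le_of_step_lt h.x_lt (Nat.zero_le _) hi
  have hN : c ≤ x N := by
    have := h.poly.X_le_of_mem (m := x N) (fun j => ?_) hzP
    · simpa using this
    · obtain ⟨i, hi, h1⟩ := h.vertex_x j
      rw [h1]
      exact le_of_step_lt h.x_lt hi le_rfl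
  obtain ⟨i, hi, h1, h2⟩ := exists_slab h0 hN h.pos
  have hne : ∀ j ≤ N, x j ≠ c := fun j hj hjc =>
    hcx (Finset.mem_image.2 ⟨j, Finset.mem_range.2 (by omega), hjc⟩)
  refine ⟨i, hi, by simpa using ⟨h1, h2⟩, ?_⟩
  exact (h.mem_slab i hi _ (by simpa using lt_of_le_of_ne h1 (hne i hi.le))
    (by simpa using lt_of_le_of_ne h2 (hne (i + 1) hi).symm)).1 hzP

end IsSlabDecomp

/-! ### Walls between consecutive rectangles -/

/-- Below `b`, there is a number above those of finitely many numbers that are less than `b`. -/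
lemma exists_between_above_finite {n : ℕ} (f : Fin n → ℝ) {a b : ℝ} (hab : a < b) :
    ∃ y, a < y ∧ y < b ∧ ∀ j, f j < b → f j < y := by
  have h1 : ∀ j, ∀ᶠ y in 𝓝[<] b, f j < b → f j < y := by
    intro j
    by_cases hj : f j < b
    · filter_upwards [Ioo_mem_nhdsLT hj] with y hy _ using hy.1
    · exact Eventually.of_forall fun y hy => absurd hy hj
  obtain ⟨y, hy1, hy2⟩ := ((eventually_all.2 h1).and (Ioo_mem_nhdsLT hab)).exists
  exact ⟨y, hy2.1, hy2.2, hy1⟩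

namespace IsSlabDecomp

variable {n : ℕ} {F : Frame} {v : Polygon Plane n} {P : Set Plane} {N : ℕ} {x l u : ℕ → ℝ}

/-- A point of `P` between two rectangles, at a height outside of one of them, is a frontier
point. -/
lemma mem_frontier_of_wall (h : IsSlabDecomp F v P N x l u) {i : ℕ} (hi : i + 1 < N) {p : Plane}
    (hX : F.X p = x (i + 1)) (hp : p ∈ P)
    (hY : ¬(l i ≤ F.Y p ∧ F.Y p ≤ u i) ∨ ¬(l (i + 1) ≤ F.Y p ∧ F.Y p ≤ u (i + 1))) :
    p ∈ frontier P := by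
  refine (mem_frontier_iff_notMem_interior hp).2 fun hint => ?_
  obtain ⟨ε, hε, hbox⟩ := F.exists_box isOpen_interior hint
  have hx0 := h.x_lt i (by omega)
  have hx1 := h.x_lt (i + 1) hi
  rcases hY with hY | hY
  · obtain ⟨c, hc1, hc2⟩ := exists_between (show max (x i) (x (i + 1) - ε) < x (i + 1) by
      rw [max_lt_iff]; exact ⟨hx0, by linarith⟩)
    rw [max_lt_iff] at hc1
    have h1 := interior_subset (hbox (c - x (i + 1)) 0 (by rw [abs_of_neg] <;> linarith) (by simpa))
    rw [hX, add_sub_cancel, add_zero] at h1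
    have := (h.mem_slab i (by omega) _ (by simpa using hc1.1) (by simpa using hc2)).1 h1
    rw [F.Y_pt] at this
    exact hY this
  · obtain ⟨c, hc1, hc2⟩ := exists_between (show x (i + 1) < min (x (i + 1 + 1)) (x (i + 1) + ε) by
      rw [lt_min_iff]; exact ⟨hx1, by linarith⟩)
    rw [lt_min_iff] at hc2
    have h1 := interior_subset (hbox (c - x (i + 1)) 0 (by rw [abs_of_pos] <;> linarith) (by simpa))
    rw [hX, add_sub_cancel, add_zero] at h1
    have := (h.mem_slab (i + 1) hi _ (by simpa using hc1) (by simpa using hc2.1)).1 h1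
    rw [F.Y_pt] at this
    exact hY this

/-- A frontier point that is not at the height of a vertex lies on a vertical edge. -/
lemma exists_vert_of_mem_frontier (h : IsSlabDecomp F v P N x l u) {p : Plane}
    (hp : p ∈ frontier P) (hY : ∀ j, F.Y (v j) ≠ F.Y p) :
    ∃ e, Vert F v e ∧ p ∈ v.edgeSet ℝ e := by
  obtain ⟨e, he⟩ := h.poly.mem_frontier_iff.1 hp
  rcases h.poly.vert_or_horiz e with hv | hh
  · exact ⟨e, hv, he⟩
  · exact absurd (hh.mem_edge.1 he).1.symm (hY e)

lemma eq_of_mem_line {i j : ℕ} (hx : ∀ i < N, x i < x (i + 1)) (hi : i + 1 < N) (hj : j < N)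
    (h1 : x j ≤ x (i + 1)) (h2 : x (i + 1) ≤ x (j + 1)) : j = i ∨ j = i + 1 := by
  by_contra hne
  rcases lt_or_ge j i with hji | hji
  · have := lt_of_step_lt hx (show j + 1 < i + 1 by omega) (by omega)
    linarith
  · have := lt_of_step_lt hx (show i + 1 < j by omega) (by omega)
    linarith

/-- The section at `x (i + 1)` being connected, consecutive height ranges meet. -/
lemma le_of_sections (h : IsSlabDecomp F v P N x l u) {i : ℕ} (hi : i + 1 < N) :
    l (i + 1) ≤ u i := by
  by_contra hlt
  rw [not_le] at hlt
  have hx0 := h.x_lt i (by omega)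
  have hx1 := h.x_lt (i + 1) hi
  have hlu0 := h.lt i (by omega)
  have hlu1 := h.lt (i + 1) hi
  have hconn : OrdConnected (F.Y '' (P ∩ {p | F.X p = x (i + 1)})) :=
    ((h.poly.sections (x (i + 1))).image _ F.continuous_Y.continuousOn).ordConnected
  have hmem : ∀ j, j = i ∨ j = i + 1 → ∀ y, l j ≤ y → y ≤ u j →
      y ∈ F.Y '' (P ∩ {p | F.X p = x (i + 1)}) := by
    intro j hj y h1 h2
    refine ⟨F.pt (x (i + 1)) y, ⟨?_, F.X_pt _ _⟩, F.Y_pt _ _⟩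
    rcases hj with rfl | rfl
    · exact h.mem_of_mem_rect (i := j) (by omega) (by simpa using hx0.le) (by simp) (by simpa)
        (by simpa)
    · exact h.mem_of_mem_rect (i := i + 1) hi (by simp) (by simpa using hx1.le) (by simpa)
        (by simpa)
  obtain ⟨p, ⟨hp, hpX⟩, hpY⟩ := hconn.out (hmem i (Or.inl rfl) (u i) hlu0.le le_rfl)
    (hmem (i + 1) (Or.inr rfl) (l (i + 1)) le_rfl hlu1.le)
    (⟨by linarith, by linarith⟩ : (u i + l (i + 1)) / 2 ∈ Icc (u i) (l (i + 1)))
  have hpX' : F.X p = x (i + 1) := hpX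
  obtain ⟨j, hj, h1, h2⟩ := (h.mem_iff p).1 hp
  rw [hpX'] at h1
  rw [hpY] at h2
  rcases eq_of_mem_line h.x_lt hi hj h1.1 h1.2 with rfl | rfl
  · linarith [h2.2]
  · linarith [h2.1]

/-- Consecutive rectangles share more than a corner: otherwise a horizontal edge would pass through
this corner and meet a vertical edge there. -/
lemma lt_of_sections (h : IsSlabDecomp F v P N x l u) {i : ℕ} (hi : i + 1 < N) :
    l (i + 1) < u i := by
  refine lt_of_le_of_ne (h.le_of_sections hi) fun heq => ?_
  have hx0 := h.x_lt i (by omega)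
  have hx1 := h.x_lt (i + 1) hi
  have hlu0 := h.lt i (by omega)
  set q := F.pt (x (i + 1)) (u i) with hq
  have hqX : F.X q = x (i + 1) := F.X_pt _ _
  have hqY : F.Y q = u i := F.Y_pt _ _
  obtain ⟨e, heH, he⟩ := h.top i (by omega)
  obtain ⟨e', heH', he'⟩ := h.bot (i + 1) hi
  have hqe : q ∈ v.edgeSet ℝ e := he q (by linarith) hqX.le hqY
  have hqe' : q ∈ v.edgeSet ℝ e' := he' q hqX.ge (by linarith) (by rw [hqY, heq])
  obtain rfl := h.poly.horiz_unique heH heH' hqe hqe'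
  obtain ⟨y, hy1, hy2, hyv⟩ := exists_between_above_finite (fun j => F.Y (v j)) hlu0
  set z := F.pt (x (i + 1)) y with hz
  have hzX : F.X z = x (i + 1) := F.X_pt _ _
  have hzY : F.Y z = y := F.Y_pt _ _
  have hzf : z ∈ frontier P := h.mem_frontier_of_wall hi hzX
    (h.mem_of_mem_rect (i := i) (by omega) (by linarith) hzX.le (by linarith) (by linarith))
    (Or.inr fun h' => by linarith [h'.1])
  obtain ⟨f, hfV, hzf⟩ := h.exists_vert_of_mem_frontier hzf fun j hj => by
    rw [hzY] at hj
    have := hyv j (by linarith)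
    linarith
  have hqf : q ∈ v.edgeSet ℝ f := by
    rw [hfV.mem_edge] at hzf ⊢
    refine ⟨by rw [hqX, ← hzX, hzf.1], ?_⟩
    have h1 := hzf.2
    rw [mem_uIcc] at h1 ⊢
    rw [hzY] at h1
    rw [hqY]
    rcases h1 with h1 | h1
    · left
      refine ⟨by linarith, ?_⟩
      by_contra hcon
      linarith [hyv _ (not_le.1 hcon), h1.2]
    · right
      refine ⟨by linarith, ?_⟩
      by_contra hcon
      linarith [hyv _ (not_le.1 hcon), h1.2]
  have hleft := he (F.pt (x i) (u i)) (by simp) (by simpa using hx0.le) (by simp)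
  have hright := he' (F.pt (x (i + 1 + 1)) (u i)) (by simpa using hx1.le) (by simp) (by simp [heq])
  have h1 := (heH.mem_edge.1 hleft).2
  have h2 := (heH.mem_edge.1 hright).2
  rw [mem_uIcc, F.X_pt] at h1 h2
  rcases h.poly.eq_end_of_mem heH hfV hqe hqf with h3 | h3 <;> rw [← h3, hqX] at h1 h2 <;>
    rcases h1 with h1 | h1 <;> rcases h2 with h2 | h2 <;> linarith [h1.1, h1.2, h2.1, h2.2]

lemma overlap (h : IsSlabDecomp F v P N x l u) {i : ℕ} (hi : i + 1 < N) :
    l i < u (i + 1) ∧ l (i + 1) < u i :=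
  ⟨neg_lt_neg_iff.1 (h.negY.lt_of_sections hi), h.lt_of_sections hi⟩

/-- Points between consecutive rectangles, at a height inside both, are interior. -/
lemma mem_interior_of_overlap (h : IsSlabDecomp F v P N x l u) {i : ℕ} (hi : i + 1 < N)
    {p : Plane} (hX : F.X p = x (i + 1)) (h1 : l i < F.Y p) (h2 : F.Y p < u i)
    (h3 : l (i + 1) < F.Y p) (h4 : F.Y p < u (i + 1)) : p ∈ interior P := by
  have hx0 := h.x_lt i (by omega)
  have hx1 := h.x_lt (i + 1) hi
  refine mem_interior.2 ⟨_, ?_, F.isOpen_X_mem_Y_mem (isOpen_Ioo (a := x i) (b := x (i + 1 + 1)))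
    (isOpen_Ioo (a := max (l i) (l (i + 1))) (b := min (u i) (u (i + 1)))),
    ⟨by linarith, by linarith⟩, max_lt h1 h3, lt_min h2 h4⟩
  rintro z ⟨⟨hz1, hz2⟩, hz3, hz4⟩
  rw [max_lt_iff] at hz3
  rw [lt_min_iff] at hz4
  rcases le_total (F.X z) (x (i + 1)) with h5 | h5
  · exact h.mem_of_mem_rect (i := i) (by omega) hz1.le h5 hz3.1.le hz4.1.le
  · exact h.mem_of_mem_rect (i := i + 1) hi h5 hz2.le hz3.2.le hz4.2.le

/-- A horizontal edge that reaches over a slab is at the height of the bottom or the top side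
there. -/
lemma height_of_horiz (h : IsSlabDecomp F v P N x l u) {g : Fin n} (hg : Horiz F v g) {i : ℕ}
    (hi : i < N) (h1 : x i ∈ uIcc (F.X (v g)) (F.X (v (finRotate n g))))
    (h2 : x (i + 1) ∈ uIcc (F.X (v g)) (F.X (v (finRotate n g)))) :
    F.Y (v g) = l i ∨ F.Y (v g) = u i := by
  have hx := h.x_lt i hi
  have h3 := h.frontier_slab i hi (F.pt ((x i + x (i + 1)) / 2) (F.Y (v g)))
    (by rw [F.X_pt]; linarith) (by rw [F.X_pt]; linarith)
  rw [F.Y_pt] at h3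
  refine h3.1 (h.poly.mem_frontier_iff.2 ⟨g, hg.mem_edge.2 ⟨F.Y_pt _ _, ?_⟩⟩)
  rw [F.X_pt]
  exact uIcc_subset_uIcc h1 h2 (mem_uIcc.2 (Or.inl ⟨by linarith, by linarith⟩))

/-- A vertex with a horizontal edge to its right is at the bottom or top height of the next slab,
and one with a horizontal edge to its left at that of the previous slab. -/
lemma height_of_joined (h : IsSlabDecomp F v P N x l u) {g j k : Fin n} (hg : Horiz F v g)
    (hjk : (j = g ∧ k = finRotate n g) ∨ (k = g ∧ j = finRotate n g)) {i : ℕ} (hi : i ≤ N)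
    (hj : F.X (v j) = x i) :
    (i < N ∧ F.X (v j) < F.X (v k) ∧ (F.Y (v j) = l i ∨ F.Y (v j) = u i)) ∨
    (∃ i', i = i' + 1 ∧ F.X (v k) < F.X (v j) ∧ (F.Y (v j) = l i' ∨ F.Y (v j) = u i')) := by
  have hne : F.X (v j) ≠ F.X (v k) := by
    intro h1
    refine h.poly.not_vert_and_horiz (i := g) ?_ hg
    rcases hjk with ⟨rfl, rfl⟩ | ⟨rfl, rfl⟩
    · exact h1
    · exact h1.symm
  have hY : F.Y (v g) = F.Y (v j) := by
    rcases hjk with ⟨rfl, rfl⟩ | ⟨rfl, rfl⟩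
    · rfl
    · exact hg
  have hIcc : uIcc (F.X (v g)) (F.X (v (finRotate n g))) = uIcc (F.X (v j)) (F.X (v k)) := by
    rcases hjk with ⟨rfl, rfl⟩ | ⟨rfl, rfl⟩
    · rfl
    · exact uIcc_comm _ _
  obtain ⟨m, hm, hkm⟩ := h.vertex_x k
  rcases lt_or_gt_of_ne hne with hlt | hlt
  · left
    have him : i < m := by
      by_contra hcon
      have := le_of_step_lt h.x_lt (not_lt.1 hcon) hi
      linarith
    have h1 := le_of_step_lt h.x_lt (show i + 1 ≤ m from him) hm
    have h2 := h.x_lt i (by omega)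
    refine ⟨by omega, hlt, ?_⟩
    rw [← hY]
    refine h.height_of_horiz hg (by omega) ?_ ?_ <;> rw [hIcc, hj, hkm, mem_uIcc] <;> left <;>
      constructor <;> linarith
  · right
    have him : m < i := by
      by_contra hcon
      have := le_of_step_lt h.x_lt (not_lt.1 hcon) hm
      linarith
    obtain ⟨i, rfl⟩ : ∃ i', i = i' + 1 := ⟨i - 1, by omega⟩
    have h1 := le_of_step_lt h.x_lt (show m ≤ i by omega) (by omega)
    have h2 := h.x_lt i (by omega)
    refine ⟨i, rfl, hlt, ?_⟩
    rw [← hY]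
    refine h.height_of_horiz hg (by omega) ?_ ?_ <;> rw [hIcc, hj, hkm, mem_uIcc] <;> right <;>
      constructor <;> linarith

/-- Every vertex is the end of a horizontal edge. -/
lemma exists_horiz_joined (h : IsSlabDecomp F v P N x l u) (j : Fin n) : ∃ g k, Horiz F v g ∧
    ((j = g ∧ k = finRotate n g) ∨ (k = g ∧ j = finRotate n g)) := by
  obtain ⟨i, rfl⟩ := (finRotate n).surjective j
  rcases h.poly.vert_or_horiz i with hv | hh
  · exact ⟨_, _, h.poly.horiz_next.2 hv, Or.inl ⟨rfl, rfl⟩⟩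
  · exact ⟨_, _, hh, Or.inr ⟨rfl, rfl⟩⟩

/-- A vertex between two rectangles is at the height of one of their sides. -/
lemma height_of_vertex (h : IsSlabDecomp F v P N x l u) {i : ℕ} (hi : i + 1 < N) {j : Fin n}
    (hj : F.X (v j) = x (i + 1)) : F.Y (v j) = l i ∨ F.Y (v j) = u i ∨ F.Y (v j) = l (i + 1) ∨
      F.Y (v j) = u (i + 1) := by
  obtain ⟨g, k, hg, hjk⟩ := h.exists_horiz_joined j
  rcases h.height_of_joined hg hjk hi.le hj with ⟨-, -, h1⟩ | ⟨i', h0, -, h1⟩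
  · tauto
  · obtain rfl : i = i' := by omega
    tauto

/-- The wall between the bottom sides of consecutive rectangles lies in a vertical edge: no vertex
can be strictly inside it. -/
lemma exists_bot_wall (h : IsSlabDecomp F v P N x l u) {i : ℕ} (hi : i + 1 < N)
    (hne : l i ≠ l (i + 1)) : ∃ e, Vert F v e ∧ F.X (v e) = x (i + 1) ∧
      ∀ z, F.X z = x (i + 1) → F.Y z ∈ uIcc (l i) (l (i + 1)) → z ∈ v.edgeSet ℝ e := by
  have hx0 := h.x_lt i (by omega)
  have hx1 := h.x_lt (i + 1) hi
  have hlu0 := h.lt i (by omega)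
  have hlu1 := h.lt (i + 1) hi
  obtain ⟨ho1, ho2⟩ := h.overlap hi
  set m := min (l i) (l (i + 1)) with hm
  set M := max (l i) (l (i + 1)) with hM
  have hmM : m < M := min_lt_max.2 hne
  obtain ⟨y, hy1, hy2, hyv⟩ := exists_between_above_finite (fun j => F.Y (v j)) hmM
  have hMu0 : M < u i := max_lt hlu0 ho2
  have hMu1 : M < u (i + 1) := max_lt ho1 hlu1
  set z := F.pt (x (i + 1)) y with hz
  have hzX : F.X z = x (i + 1) := F.X_pt _ _
  have hzY : F.Y z = y := F.Y_pt _ _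
  have hzf : z ∈ frontier P := by
    rcases lt_or_gt_of_ne hne with hlt | hlt
    · rw [min_eq_left hlt.le] at hm
      rw [max_eq_right hlt.le] at hM
      exact h.mem_frontier_of_wall hi hzX (h.mem_of_mem_rect (i := i) (by omega) (by linarith)
        hzX.le (by linarith) (by linarith)) (Or.inr fun h' => by linarith [h'.1])
    · rw [min_eq_right hlt.le] at hm
      rw [max_eq_left hlt.le] at hM
      exact h.mem_frontier_of_wall hi hzX (h.mem_of_mem_rect (i := i + 1) hi hzX.ge (by linarith)
        (by linarith) (by linarith)) (Or.inl fun h' => by linarith [h'.1])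
  have hyv' : ∀ j, F.Y (v j) < y ∨ M ≤ F.Y (v j) := fun j => by
    by_cases hj : F.Y (v j) < M
    · exact Or.inl (hyv j hj)
    · exact Or.inr (not_lt.1 hj)
  obtain ⟨e, heV, hze⟩ := h.exists_vert_of_mem_frontier hzf fun j hj => by
    rw [hzY] at hj
    rcases hyv' j with h1 | h1 <;> linarith
  have hm' : m = l i ∨ m = l (i + 1) := min_choice _ _
  have hml : m ≤ l i := min_le_left _ _
  have hml' : m ≤ l (i + 1) := min_le_right _ _
  have hMl : l i ≤ M := le_max_left _ _
  have hMl' : l (i + 1) ≤ M := le_max_right _ _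
  rw [heV.mem_edge, hzX, hzY, mem_uIcc] at hze
  have hlow : ∀ j, F.X (v j) = x (i + 1) → F.Y (v j) ≤ y → F.Y (v j) ≤ m := by
    intro j hj hjy
    have hlm : (l i = m ∧ l (i + 1) = M) ∨ (l i = M ∧ l (i + 1) = m) := by
      rcases le_total (l i) (l (i + 1)) with h1 | h1
      · exact Or.inl ⟨(min_eq_left h1).symm, (max_eq_right h1).symm⟩
      · exact Or.inr ⟨(max_eq_left h1).symm, (min_eq_right h1).symm⟩
    rcases h.height_of_vertex hi hj with h1 | h1 | h1 | h1 <;>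
      rcases hlm with ⟨h2, h3⟩ | ⟨h2, h3⟩ <;> linarith
  have hX2 : F.X (v (finRotate n e)) = x (i + 1) := by rw [hze.1]; exact heV.symm
  refine ⟨e, heV, hze.1.symm, fun w hwX hwY => heV.mem_edge.2 ⟨by rw [hwX, hze.1], ?_⟩⟩
  have hw : m ≤ F.Y w ∧ F.Y w ≤ M := hwY
  rw [mem_uIcc]
  rcases hze.2 with h1 | h1
  · left
    have h2 := hlow e hze.1.symm h1.1
    have h3 := (hyv' (finRotate n e)).resolve_left (not_lt.2 h1.2)
    exact ⟨by linarith, by linarith⟩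
  · right
    have h2 := hlow _ hX2 h1.1
    have h3 := (hyv' e).resolve_left (not_lt.2 h1.2)
    exact ⟨by linarith, by linarith⟩

lemma exists_top_wall (h : IsSlabDecomp F v P N x l u) {i : ℕ} (hi : i + 1 < N)
    (hne : u i ≠ u (i + 1)) : ∃ e, Vert F v e ∧ F.X (v e) = x (i + 1) ∧
      ∀ z, F.X z = x (i + 1) → F.Y z ∈ uIcc (u i) (u (i + 1)) → z ∈ v.edgeSet ℝ e := by
  obtain ⟨e, h1, h2, h3⟩ := h.negY.exists_bot_wall hi fun h' => hne (neg_injective h')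
  refine ⟨e, h1, h2, fun z hz1 hz2 => h3 z hz1 ?_⟩
  rw [mem_uIcc] at hz2 ⊢
  simp only [Frame.negY_Y, neg_le_neg_iff]
  tauto

lemma isRectChain (h : IsSlabDecomp F v P N x l u) : IsRectChain F v P N x l u where
  x_lt := h.x_lt
  lt := h.lt
  mem_iff := h.mem_iff
  bot_edge i hi := (h.bot i hi).imp fun _ he => he.2
  top_edge i hi := (h.top i hi).imp fun _ he => he.2
  bot_wall _ hi hne := (h.exists_bot_wall hi hne).imp fun _ he => he.2.2
  top_wall _ hi hne := (h.exists_top_wall hi hne).imp fun _ he => he.2.2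

end IsSlabDecomp

/-! ### Counting reflex vertices -/

/-- At a corner on the left side of a rectangle of `P`, the quadrant of direction `D` to the right
is outside `P` if and only if it points away from the rectangle. -/
lemma Frame.corner_iff (F : Frame) {P : Set Plane} {a b l u : ℝ} (hab : a < b) (hlu : l < u)
    (hP : ∀ p, a < F.X p → F.X p < b → (p ∈ P ↔ l ≤ F.Y p ∧ F.Y p ≤ u)) {A D : Plane}
    (hA : F.X A = a) (hD : 0 < F.X D) (hDY : F.Y D ≠ 0) (hAY : F.Y A = l ∨ F.Y A = u) :
    (∀ᶠ ε : ℝ in 𝓝[>] 0, A + ε • D ∉ P) ↔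
      (F.Y A = l ∧ F.Y D < 0) ∨ (F.Y A = u ∧ 0 < F.Y D) := by
  have hkey : ∀ᶠ ε : ℝ in 𝓝[>] 0, 0 < ε ∧ ε * |F.Y D| < u - l ∧
      (A + ε • D ∈ P ↔ l ≤ F.Y A + ε * F.Y D ∧ F.Y A + ε * F.Y D ≤ u) := by
    have hY := abs_pos.2 hDY
    filter_upwards [Ioo_mem_nhdsGT (div_pos (sub_pos.2 hab) hD),
      Ioo_mem_nhdsGT (div_pos (sub_pos.2 hlu) hY)] with ε h1 h2
    have h3 := (lt_div_iff₀ hD).1 h1.2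
    have h4 := (lt_div_iff₀ hY).1 h2.2
    refine ⟨h1.1, h4, ?_⟩
    have h5 := mul_pos h1.1 hD
    rw [hP _ (by simp [hA, h5]) (by simp [hA]; linarith)]
    simp
  constructor
  · intro h
    by_contra hcon
    obtain ⟨ε, h1, h2, h3, h4⟩ := (h.and hkey).exists
    refine h1 (h4.2 ?_)
    push Not at hcon
    rcases hAY with hAY | hAY <;> rw [hAY]
    · have h5 := hcon.1 hAY
      rw [abs_of_nonneg h5] at h3
      exact ⟨by nlinarith, by linarith⟩
    · have h5 := hcon.2 hAY
      rw [abs_of_nonpos h5] at h3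
      exact ⟨by linarith, by nlinarith⟩
  · intro h
    filter_upwards [hkey] with ε ⟨h2, h3, h4⟩ hmem
    have h5 := h4.1 hmem
    rcases h with ⟨h6, h7⟩ | ⟨h6, h7⟩ <;> rw [h6] at h5 <;> nlinarith [h5.1, h5.2]

namespace IsSlabDecomp

variable {n : ℕ} {F : Frame} {v : Polygon Plane n} {P : Set Plane} {N : ℕ} {x l u : ℕ → ℝ}
  {g : Fin n}

lemma reflex_right_iff (h : IsSlabDecomp F v P N x l u) {j : Fin n} {i : ℕ} (hi : i < N)
    (hj : F.X (v j) = x i)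
    (hX : 0 < F.X (v (finRotate n j) - v j + (v ((finRotate n).symm j) - v j)))
    (hY : F.Y (v (finRotate n j) - v j + (v ((finRotate n).symm j) - v j)) ≠ 0)
    (hlu : F.Y (v j) = l i ∨ F.Y (v j) = u i) :
    IsReflexVertex v P j ↔
      (F.Y (v j) = l i ∧ F.Y (v (finRotate n j) - v j + (v ((finRotate n).symm j) - v j)) < 0) ∨
      (F.Y (v j) = u i ∧ 0 < F.Y (v (finRotate n j) - v j + (v ((finRotate n).symm j) - v j))) :=
  F.corner_iff (h.x_lt i hi) (h.lt i hi) (h.mem_slab i hi) hj hX hY hlu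

lemma reflex_left_iff (h : IsSlabDecomp F v P N x l u) {j : Fin n} {i : ℕ} (hi : i < N)
    (hj : F.X (v j) = x (i + 1))
    (hX : F.X (v (finRotate n j) - v j + (v ((finRotate n).symm j) - v j)) < 0)
    (hY : F.Y (v (finRotate n j) - v j + (v ((finRotate n).symm j) - v j)) ≠ 0)
    (hlu : F.Y (v j) = l i ∨ F.Y (v j) = u i) :
    IsReflexVertex v P j ↔
      (F.Y (v j) = l i ∧ F.Y (v (finRotate n j) - v j + (v ((finRotate n).symm j) - v j)) < 0) ∨
      (F.Y (v j) = u i ∧ 0 < F.Y (v (finRotate n j) - v j + (v ((finRotate n).symm j) - v j))) :=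
  F.negX.corner_iff (neg_lt_neg (h.x_lt i hi)) (h.lt i hi)
    (fun p h1 h2 => h.mem_slab i hi p (neg_lt_neg_iff.1 h2) (neg_lt_neg_iff.1 h1))
    (neg_inj.2 hj) (neg_pos.2 hX) hY hlu

/-- The direction of the quadrant at the first end of the vertical edge after `g`. -/
lemma quadrant_fst (h : IsSlabDecomp F v P N x l u) (hg : Horiz F v g) {j k : Fin n}
    (hj : j = finRotate n g) (hk : k = finRotate n j) :
    F.X (v (finRotate n j) - v j + (v ((finRotate n).symm j) - v j)) = F.X (v g) - F.X (v j) ∧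
    F.Y (v (finRotate n j) - v j + (v ((finRotate n).symm j) - v j)) = F.Y (v k) - F.Y (v j) := by
  subst hj hk
  have h1 : F.X (v (finRotate n g)) = _ := h.poly.vert_next.2 hg
  have h2 : F.Y (v g) = _ := hg
  rw [Equiv.symm_apply_apply, map_add, map_sub, map_sub, map_add, map_sub, map_sub, ← h1, h2]
  constructor <;> ring

/-- The direction of the quadrant at the second end of a vertical edge. -/
lemma quadrant_snd (h : IsSlabDecomp F v P N x l u) {f : Fin n} (hf : Vert F v f) {j : Fin n}
    (hj : j = finRotate n f) :
    F.X (v (finRotate n j) - v j + (v ((finRotate n).symm j) - v j)) =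
      F.X (v (finRotate n j)) - F.X (v j) ∧
    F.Y (v (finRotate n j) - v j + (v ((finRotate n).symm j) - v j)) = F.Y (v f) - F.Y (v j) := by
  subst hj
  have h1 : F.Y (v (finRotate n f)) = _ := h.poly.horiz_next.2 hf
  have h2 : F.X (v f) = _ := hf
  rw [Equiv.symm_apply_apply, map_add, map_sub, map_sub, map_add, map_sub, map_sub, ← h1, h2]
  constructor <;> ring

/-- A vertical edge with both neighbouring edges to its right is the left side of the polygon, and
its ends are convex vertices. -/
lemma cap_right (h : IsSlabDecomp F v P N x l u) (hg : Horiz F v g) {f k : Fin n}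
    (hf : f = finRotate n g) (hk : k = finRotate n f) {i : ℕ} (hi : i < N)
    (hX : F.X (v f) = x i) (hA : F.X (v f) < F.X (v g))
    (hB : F.X (v k) < F.X (v (finRotate n k)))
    (hAY : F.Y (v f) = l i ∨ F.Y (v f) = u i) (hBY : F.Y (v k) = l i ∨ F.Y (v k) = u i) :
    i = 0 ∧ F.pt (x i) (l i) ∈ v.edgeSet ℝ f ∧ ¬IsReflexVertex v P f ∧ ¬IsReflexVertex v P k := by
  have hfV : Vert F v f := hf ▸ h.poly.vert_next.2 hg
  have hXk : F.X (v f) = F.X (v k) := hk ▸ hfV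
  have hne : F.Y (v f) ≠ F.Y (v k) := fun h1 =>
    h.poly.not_vert_and_horiz hfV (show Horiz F v f from h1.trans (by rw [hk]))
  have hlu := h.lt i hi
  obtain ⟨q1, q2⟩ := h.quadrant_fst hg hf hk
  obtain ⟨q3, q4⟩ := h.quadrant_snd hfV hk
  have hmem : ∀ y, l i ≤ y → y ≤ u i → F.pt (x i) y ∈ v.edgeSet ℝ f := by
    intro y h1 h2
    rw [hfV.mem_edge, F.X_pt, F.Y_pt, ← hk, mem_uIcc]
    refine ⟨hX.symm, ?_⟩
    rcases hAY with hAY | hAY <;> rcases hBY with hBY | hBY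
    · exact absurd (hAY.trans hBY.symm) hne
    · exact Or.inl ⟨hAY.le.trans h1, h2.trans hBY.ge⟩
    · exact Or.inr ⟨hBY.le.trans h1, h2.trans hAY.ge⟩
    · exact absurd (hAY.trans hBY.symm) hne
  refine ⟨?_, hmem _ le_rfl hlu.le, ?_, ?_⟩
  · by_contra hi0
    obtain ⟨i, rfl⟩ : ∃ i', i = i' + 1 := ⟨i - 1, by omega⟩
    obtain ⟨h1, h2⟩ := h.overlap hi
    have hlu' := h.lt i (by omega)
    obtain ⟨y, hy1, hy2⟩ := exists_between (show max (l i) (l (i + 1)) < min (u i) (u (i + 1)) from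
      max_lt (lt_min hlu' h1) (lt_min h2 hlu))
    rw [max_lt_iff] at hy1
    rw [lt_min_iff] at hy2
    refine h.poly.not_mem_interior_of_mem_edge (hmem y hy1.2.le hy2.2.le) ?_
    exact h.mem_interior_of_overlap hi (F.X_pt _ _) (by simpa using hy1.1) (by simpa using hy2.1)
      (by simpa using hy1.2) (by simpa using hy2.2)
  · rw [h.reflex_right_iff hi hX (by rw [q1]; linarith)
      (by rw [q2]; exact sub_ne_zero.2 hne.symm) hAY, q2]
    rintro (⟨h1, h2⟩ | ⟨h1, h2⟩) <;> rcases hBY with h3 | h3 <;> linarith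
  · rw [h.reflex_right_iff hi (hXk ▸ hX) (by rw [q3]; linarith)
      (by rw [q4]; exact sub_ne_zero.2 hne) hBY, q4]
    rintro (⟨h1, h2⟩ | ⟨h1, h2⟩) <;> rcases hAY with h3 | h3 <;> linarith

/-- A vertical edge with one neighbouring edge to either side is a wall of the bottom or of the
top chain, and has exactly one reflex end. -/
lemma step_xor (h : IsSlabDecomp F v P N x l u) (hg : Horiz F v g) {f k : Fin n}
    (hf : f = finRotate n g) (hk : k = finRotate n f) {i : ℕ} (hi : i + 1 < N)
    (hX : F.X (v f) = x (i + 1)) (hA : F.X (v g) < F.X (v f))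
    (hB : F.X (v k) < F.X (v (finRotate n k)))
    (hAY : F.Y (v f) = l i ∨ F.Y (v f) = u i)
    (hBY : F.Y (v k) = l (i + 1) ∨ F.Y (v k) = u (i + 1)) :
    Xor (IsReflexVertex v P f) (IsReflexVertex v P k) := by
  have hfV : Vert F v f := hf ▸ h.poly.vert_next.2 hg
  have hXk : F.X (v f) = F.X (v k) := hk ▸ hfV
  have hne : F.Y (v f) ≠ F.Y (v k) := fun h1 =>
    h.poly.not_vert_and_horiz hfV (show Horiz F v f from h1.trans (by rw [hk]))
  have hlu := h.lt i (by omega)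
  have hlu' := h.lt (i + 1) hi
  obtain ⟨ho1, ho2⟩ := h.overlap hi
  obtain ⟨q1, q2⟩ := h.quadrant_fst hg hf hk
  obtain ⟨q3, q4⟩ := h.quadrant_snd hfV hk
  have hcross : ∀ y, y ∈ uIcc (F.Y (v f)) (F.Y (v k)) → l i < y → y < u i → l (i + 1) < y →
      y < u (i + 1) → False := by
    intro y hy h1 h2 h3 h4
    refine h.poly.not_mem_interior_of_mem_edge (i := f) (p := F.pt (x (i + 1)) y)
      (hfV.mem_edge.2 ⟨by rw [F.X_pt, hX], by rwa [F.Y_pt, ← hk]⟩)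
      (h.mem_interior_of_overlap hi (F.X_pt _ _) ?_ ?_ ?_ ?_) <;> rwa [F.Y_pt]
  obtain ⟨y, hy1, hy2⟩ := exists_between (show max (l i) (l (i + 1)) < min (u i) (u (i + 1)) from
    max_lt (lt_min hlu ho1) (lt_min ho2 hlu'))
  rw [max_lt_iff] at hy1
  rw [lt_min_iff] at hy2
  rw [h.reflex_left_iff (by omega) hX (by rw [q1]; linarith)
      (by rw [q2]; exact sub_ne_zero.2 hne.symm) hAY,
    h.reflex_right_iff hi (hXk ▸ hX) (by rw [q3]; linarith)
      (by rw [q4]; exact sub_ne_zero.2 hne) hBY, q2, q4]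
  rcases hAY with hAY | hAY <;> rcases hBY with hBY | hBY <;> rw [hAY, hBY] at hne hcross ⊢
  · rcases lt_or_gt_of_ne hne with h1 | h1
    · refine Or.inr ⟨Or.inl ⟨rfl, by linarith⟩, ?_⟩
      rintro (⟨-, h2⟩ | ⟨h2, -⟩) <;> linarith
    · refine Or.inl ⟨Or.inl ⟨rfl, by linarith⟩, ?_⟩
      rintro (⟨-, h2⟩ | ⟨h2, -⟩) <;> linarith
  · exact (hcross y (mem_uIcc.2 (Or.inl ⟨hy1.1.le, hy2.2.le⟩)) hy1.1 hy2.1 hy1.2 hy2.2).elim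
  · exact (hcross y (mem_uIcc.2 (Or.inr ⟨hy1.2.le, hy2.1.le⟩)) hy1.1 hy2.1 hy1.2 hy2.2).elim
  · rcases lt_or_gt_of_ne hne with h1 | h1
    · refine Or.inl ⟨Or.inr ⟨rfl, by linarith⟩, ?_⟩
      rintro (⟨h2, -⟩ | ⟨-, h2⟩) <;> linarith
    · refine Or.inr ⟨Or.inr ⟨rfl, by linarith⟩, ?_⟩
      rintro (⟨h2, -⟩ | ⟨-, h2⟩) <;> linarith

/-- A vertical edge is the left or the right side of the polygon, without reflex ends, or a wall
with exactly one reflex end. -/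
lemma vert_cases (h : IsSlabDecomp F v P N x l u) {f : Fin n} (hfV : Vert F v f) :
    (F.X (v f) = x 0 ∧ F.pt (x 0) (l 0) ∈ v.edgeSet ℝ f ∧
      ¬IsReflexVertex v P f ∧ ¬IsReflexVertex v P (finRotate n f)) ∨
    (F.X (v f) = x N ∧ ¬IsReflexVertex v P f ∧ ¬IsReflexVertex v P (finRotate n f)) ∨
    ((∃ i, i + 1 < N ∧ F.X (v f) = x (i + 1)) ∧
      Xor (IsReflexVertex v P f) (IsReflexVertex v P (finRotate n f))) := by
  obtain ⟨g, hf⟩ := (finRotate n).surjective f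
  have hg : Horiz F v g := by rw [← hf] at hfV; exact h.poly.vert_next.1 hfV
  have hkH : Horiz F v (finRotate n f) := h.poly.horiz_next.2 hfV
  obtain ⟨i, hi, hX⟩ := h.vertex_x f
  have hXk : F.X (v (finRotate n f)) = x i := by rw [← hX]; exact hfV.symm
  have hN : N - (N - i) = i := by omega
  rcases h.height_of_joined hg (Or.inr ⟨rfl, hf.symm⟩) hi hX with ⟨hi1, hA, hAY⟩ | ⟨i', h0, hA, hAY⟩
    <;> rcases h.height_of_joined hkH (Or.inl ⟨rfl, rfl⟩) hi hXk with
      ⟨hi2, hB, hBY⟩ | ⟨i'', h1, hB, hBY⟩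
  · left
    obtain ⟨rfl, h2, h3⟩ := h.cap_right hg hf.symm rfl hi1 hX hA hB hAY hBY
    exact ⟨hX, h2, h3⟩
  · right; right
    subst h1
    refine ⟨⟨i'', hi1, hX⟩, ?_⟩
    refine h.negX.step_xor (g := g) hg hf.symm rfl (i := N - 2 - i'') (by omega) ?_
      (neg_lt_neg hA) (neg_lt_neg hB) ?_ ?_
    · simp only [Frame.negX_X, hX]
      rw [show N - (N - 2 - i'' + 1) = i'' + 1 by omega]
    · rw [show N - 1 - (N - 2 - i'') = i'' + 1 by omega]
      exact hAY
    · rw [show N - 1 - (N - 2 - i'' + 1) = i'' by omega]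
      exact hBY
  · right; right
    subst h0
    exact ⟨⟨i', hi2, hX⟩, h.step_xor hg hf.symm rfl hi2 hX hA hB hAY hBY⟩
  · right; left
    obtain rfl : i' = i'' := by omega
    subst h0
    obtain ⟨h2, -, h3⟩ := h.negX.cap_right (g := g) hg hf.symm rfl (i := N - 1 - i') (by omega)
      (by simp only [Frame.negX_X, hX]; rw [show N - (N - 1 - i') = i' + 1 by omega])
      (neg_lt_neg hA) (neg_lt_neg hB)
      (by rw [show N - 1 - (N - 1 - i') = i' by omega]; exact hAY)
      (by rw [show N - 1 - (N - 1 - i') = i' by omega]; exact hBY)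
    refine ⟨?_, h3⟩
    rw [hX, show i' + 1 = N by omega]

lemma x_zero_lt (h : IsSlabDecomp F v P N x l u) : x 0 < x N := lt_of_step_lt h.x_lt h.pos le_rfl

lemma exists_vert_at (h : IsSlabDecomp F v P N x l u) {i : ℕ} (hi : i ≤ N) :
    ∃ f, Vert F v f ∧ F.X (v f) = x i := by
  obtain ⟨j, hj⟩ := h.exists_vertex i hi
  rcases h.poly.vert_or_horiz j with hv | hh
  · exact ⟨j, hv, hj⟩
  · obtain ⟨f, rfl⟩ := (finRotate n).surjective j
    have hv := h.poly.horiz_next.1 hh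
    exact ⟨f, hv, hj ▸ hv⟩

lemma vert_left_unique (h : IsSlabDecomp F v P N x l u) {f f' : Fin n} (hf : Vert F v f)
    (hf' : Vert F v f') (hX : F.X (v f) = x 0) (hX' : F.X (v f') = x 0) : f = f' := by
  have key : ∀ e, Vert F v e → F.X (v e) = x 0 → F.pt (x 0) (l 0) ∈ v.edgeSet ℝ e := by
    intro e he hXe
    rcases h.vert_cases he with h1 | h1 | h1
    · exact h1.2.1
    · have := h.x_zero_lt
      linarith [h1.1]
    · obtain ⟨i, hi, h2⟩ := h1.1
      have := lt_of_step_lt h.x_lt (Nat.succ_pos i) hi.le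
      linarith
  exact h.poly.vert_unique hf hf' (key f hf hX) (key f' hf' hX')

open Classical in
lemma card_vert_left (h : IsSlabDecomp F v P N x l u) :
    (Finset.univ.filter fun f => Vert F v f ∧ F.X (v f) = x 0).card = 1 := by
  obtain ⟨f, hf, hX⟩ := h.exists_vert_at (Nat.zero_le N)
  refine Finset.card_eq_one.2 ⟨f, Finset.ext fun f' => ?_⟩
  simp only [Finset.mem_filter, Finset.mem_univ, true_and, Finset.mem_singleton]
  constructor
  · exact fun h' => h.vert_left_unique h'.1 hf h'.2 hX
  · rintro rfl
    exact ⟨hf, hX⟩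

open Classical in
lemma card_vert_right (h : IsSlabDecomp F v P N x l u) :
    (Finset.univ.filter fun f => Vert F v f ∧ F.X (v f) = x N).card = 1 := by
  rw [← h.negX.card_vert_left]
  congr 1
  ext f
  simp [Vert]

open Classical in
lemma sum_eq_sum_vert (h : IsSlabDecomp F v P N x l u) (φ : Fin n → ℕ) :
    ∑ j, φ j = ∑ f with Vert F v f, (φ f + φ (finRotate n f)) := by
  rw [Finset.sum_add_distrib, ← Finset.sum_filter_add_sum_filter_not Finset.univ (Vert F v) φ]
  congr 1
  symm
  refine Finset.sum_equiv (finRotate n) (fun f => ?_) fun _ _ => rfl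
  simp only [Finset.mem_filter, Finset.mem_univ, true_and]
  rw [← h.poly.horiz_next]
  constructor
  · exact fun h1 h2 => h.poly.not_vert_and_horiz h2 h1
  · exact fun h1 => (h.poly.vert_or_horiz _).resolve_left h1

open Classical in
/-- The walls, that is, the vertical edges other than the leftmost and the rightmost one. -/
noncomputable def walls (F : Frame) (v : Polygon Plane n) (N : ℕ) (x : ℕ → ℝ) : Finset (Fin n) :=
  {f | Vert F v f ∧ ∃ i, i + 1 < N ∧ F.X (v f) = x (i + 1)}

lemma mem_walls {f : Fin n} :
    f ∈ walls F v N x ↔ Vert F v f ∧ ∃ i, i + 1 < N ∧ F.X (v f) = x (i + 1) := by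
  simp [walls]

/-- Each wall has exactly one reflex end, and no other vertex is reflex. -/
lemma numReflex_eq_card_walls (h : IsSlabDecomp F v P N x l u) :
    numReflex v P = (walls F v N x).card := by
  classical
  rw [numReflex, Set.ncard_eq_toFinset_card', Set.toFinset_ofPred, Finset.card_filter,
    h.sum_eq_sum_vert, Finset.card_eq_sum_ones, ← Finset.sum_filter_add_sum_filter_not
      (Finset.univ.filter (Vert F v)) (fun f => f ∈ walls F v N x)]
  have h1 : (Finset.univ.filter (Vert F v)).filter (fun f => f ∈ walls F v N x) =
      walls F v N x := by
    ext f
    simp only [Finset.mem_filter, Finset.mem_univ, true_and, mem_walls]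
    tauto
  rw [h1, Finset.sum_eq_zero (s := Finset.filter _ (Finset.filter _ _)), add_zero]
  · refine Finset.sum_congr rfl fun f hf => ?_
    obtain ⟨hfV, i, hi, hX⟩ := mem_walls.1 hf
    rcases h.vert_cases hfV with h2 | h2 | h2
    · have := lt_of_step_lt h.x_lt (Nat.succ_pos i) hi.le
      linarith [h2.1]
    · have := lt_of_step_lt h.x_lt hi le_rfl
      linarith [h2.1]
    · rcases h2.2 with ⟨h3, h4⟩ | ⟨h3, h4⟩
      · rw [if_pos h3, if_neg h4]
      · rw [if_neg h4, if_pos h3]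
  · intro f hf
    simp only [Finset.mem_filter, Finset.mem_univ, true_and, mem_walls] at hf
    rcases h.vert_cases hf.1 with h2 | h2 | h2
    · rw [if_neg h2.2.2.1, if_neg h2.2.2.2, add_zero]
    · rw [if_neg h2.2.1, if_neg h2.2.2, add_zero]
    · exact absurd ⟨hf.1, h2.1⟩ hf.2

lemma card_eq (h : IsSlabDecomp F v P N x l u) : n = 2 * (walls F v N x).card + 4 := by
  classical
  have h1 := h.sum_eq_sum_vert fun _ => 1
  rw [Finset.sum_const, Finset.sum_const, Finset.card_univ, Fintype.card_fin] at h1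
  have h2 : (Finset.univ.filter (Vert F v)) = walls F v N x ∪
      ((Finset.univ.filter fun f => Vert F v f ∧ F.X (v f) = x 0) ∪
        (Finset.univ.filter fun f => Vert F v f ∧ F.X (v f) = x N)) := by
    ext f
    simp only [Finset.mem_filter, Finset.mem_univ, true_and, mem_walls, Finset.mem_union]
    constructor
    · intro hf
      rcases h.vert_cases hf with h3 | h3 | h3
      · exact Or.inr (Or.inl ⟨hf, h3.1⟩)
      · exact Or.inr (Or.inr ⟨hf, h3.1⟩)
      · exact Or.inl ⟨hf, h3.1⟩
    · tauto
  rw [h2, Finset.card_union_of_disjoint, Finset.card_union_of_disjoint, h.card_vert_left,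
    h.card_vert_right] at h1
  · simp only [smul_eq_mul] at h1
    omega
  · rw [Finset.disjoint_filter]
    rintro f - ⟨-, h3⟩ ⟨-, h4⟩
    have := h.x_zero_lt
    linarith
  · rw [Finset.disjoint_left]
    intro f hf hf'
    obtain ⟨hfV, i, hi, hX⟩ := mem_walls.1 hf
    simp only [Finset.mem_filter, Finset.mem_univ, true_and, Finset.mem_union] at hf'
    have := lt_of_step_lt h.x_lt (Nat.succ_pos i) hi.le
    have := lt_of_step_lt h.x_lt hi le_rfl
    rcases hf' with h3 | h3 <;> linarith [h3.2]

/-- Every height change of the two chains is a wall. -/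
lemma sum_changes_le (h : IsSlabDecomp F v P N x l u) :
    ∑ i ∈ Finset.range (N - 1), (IsRectChain.changes l i + IsRectChain.changes u i) ≤
      (walls F v N x).card := by
  classical
  have hfib : ∀ i ∈ Finset.range (N - 1), IsRectChain.changes l i + IsRectChain.changes u i ≤
      ((walls F v N x).filter fun f => F.X (v f) = x (i + 1)).card := by
    intro i hi
    have hi' : i + 1 < N := by
      have := Finset.mem_range.1 hi
      omega
    have hmem : ∀ f, Vert F v f → F.X (v f) = x (i + 1) →
        f ∈ (walls F v N x).filter fun f => F.X (v f) = x (i + 1) := fun f hf hX =>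
      Finset.mem_filter.2 ⟨mem_walls.2 ⟨hf, i, hi', hX⟩, hX⟩
    have hlu := h.lt i (by omega)
    have hlu' := h.lt (i + 1) hi'
    obtain ⟨ho1, ho2⟩ := h.overlap hi'
    unfold IsRectChain.changes
    by_cases h1 : l i = l (i + 1) <;> by_cases h2 : u i = u (i + 1)
    · rw [if_pos h1, if_pos h2]; omega
    · obtain ⟨f, hf, hX, -⟩ := h.exists_top_wall hi' h2
      rw [if_pos h1, if_neg h2]
      exact Finset.card_pos.2 ⟨f, hmem f hf hX⟩
    · obtain ⟨f, hf, hX, -⟩ := h.exists_bot_wall hi' h1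
      rw [if_neg h1, if_pos h2]
      exact Finset.card_pos.2 ⟨f, hmem f hf hX⟩
    · obtain ⟨f, hf, hX, hfw⟩ := h.exists_bot_wall hi' h1
      obtain ⟨f', hf', hX', hfw'⟩ := h.exists_top_wall hi' h2
      rw [if_neg h1, if_neg h2]
      refine Finset.one_lt_card.2 ⟨f, hmem f hf hX, f', hmem f' hf' hX', ?_⟩
      -- An edge containing both walls would pass through the interior.
      rintro rfl
      have h3 := (hf.mem_edge.1 (hfw (F.pt (x (i + 1)) (l i)) (by simp) (by simp))).2
      have h4 := (hf.mem_edge.1 (hfw' (F.pt (x (i + 1)) (u i)) (by simp) (by simp))).2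
      have h5 := (hf.mem_edge.1 (hfw (F.pt (x (i + 1)) (l (i + 1))) (by simp) (by simp))).2
      have h6 := (hf.mem_edge.1 (hfw' (F.pt (x (i + 1)) (u (i + 1))) (by simp) (by simp))).2
      obtain ⟨y, hy1, hy2⟩ := exists_between
        (show max (l i) (l (i + 1)) < min (u i) (u (i + 1)) from
          max_lt (lt_min hlu ho1) (lt_min ho2 hlu'))
      rw [max_lt_iff] at hy1
      rw [lt_min_iff] at hy2
      rw [F.Y_pt] at h3 h4
      refine h.poly.not_mem_interior_of_mem_edge (i := f) (p := F.pt (x (i + 1)) y)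
        (hf.mem_edge.2 ⟨by rw [F.X_pt, hX], ?_⟩)
        (h.mem_interior_of_overlap hi' (F.X_pt _ _) ?_ ?_ ?_ ?_) <;> rw [F.Y_pt]
      · exact uIcc_subset_uIcc h3 h4 (mem_uIcc.2 (Or.inl ⟨hy1.1.le, hy2.1.le⟩))
      · exact hy1.1
      · exact hy2.1
      · exact hy1.2
      · exact hy2.2
  refine (Finset.sum_le_sum hfib).trans ?_
  rw [← Finset.card_biUnion]
  · refine Finset.card_le_card (Finset.biUnion_subset.2 fun i _ => Finset.filter_subset _ _)
  · intro i hi j hj hij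
    have hi' := Finset.mem_range.1 (Finset.mem_coe.1 hi)
    have hj' := Finset.mem_range.1 (Finset.mem_coe.1 hj)
    change Disjoint _ _
    rw [Finset.disjoint_filter]
    intro f _ h1 h2
    rcases lt_or_gt_of_ne hij with h3 | h3
    · have := lt_of_step_lt h.x_lt (show i + 1 < j + 1 by omega) (by omega)
      linarith
    · have := lt_of_step_lt h.x_lt (show j + 1 < i + 1 by omega) (by omega)
      linarith

end IsSlabDecomp

/-- A monotone rectilinear polygon with `r` reflex vertices has `2 * r + 4` vertices. -/
lemma IsAxisPolygon.card_eq {n : ℕ} {F : Frame} {v : Polygon Plane n} {P : Set Plane}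
    (h : IsAxisPolygon F v P) : n = 2 * numReflex v P + 4 := by
  obtain ⟨N, x, l, u, hd⟩ := h.exists_slabDecomp
  rw [hd.numReflex_eq_card_walls]
  exact hd.card_eq

lemma IsAxisPolygon.exists_covers {n : ℕ} {F : Frame} {v : Polygon Plane n} {P : Set Plane}
    (h : IsAxisPolygon F v P) {m : ℕ} (hm : numReflex v P / 4 + 1 ≤ m) :
    ∃ S : Finset Plane, S.card = m ∧ Covers v P S := by
  obtain ⟨N, x, l, u, hd⟩ := h.exists_slabDecomp
  refine hd.isRectChain.exists_covers hd.pos hd.sum_changes_le ?_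
  rwa [← hd.numReflex_eq_card_walls]

lemma IsSimpleRectilinearPolygon.exists_frame {n : ℕ} {v : Polygon Plane n} {P : Set Plane}
    (h : IsSimpleRectilinearPolygon v P) (hP : IsMonotonePolygon P) :
    ∃ F, IsAxisPolygon F v P :=
  hP.elim (fun hk => ⟨_, h.isAxisPolygon hk⟩) fun hk => ⟨_, h.isAxisPolygon hk⟩

/-! ### Walls that an attracted object cannot pass -/

/-- If `P` lies above height `h` just beyond the line `X = c`, then an object that starts below
this height and before this line is not attracted by a beacon below this height and beyond the
line: it can only approach the beacon, so it never gets above height `h`. -/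
lemma not_attracts_of_wall {n : ℕ} {v : Polygon Plane n} {P : Set Plane} (F : Frame) {c d h : ℝ}
    (hE : ∀ i, Vert F v i ∨ Horiz F v i) (hEP : ∀ i, v.edgeSet ℝ i ⊆ P) (hcd : c < d)
    (hP : ∀ z ∈ P, c < F.X z → F.X z < d → h ≤ F.Y z) {b p : Plane} (hbX : c < F.X b)
    (hbY : F.Y b < h) (hpX : F.X p ≤ c) (hpY : F.Y p < h) : ¬Attracts v P b p := by
  have cross : ∀ q q' : Plane, segment ℝ q q' ⊆ P → F.X q ≤ c → F.Y q < h → F.Y q' < h →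
      F.X q' ≤ c := by
    intro q q' hseg hq hqY hqY'
    by_contra hlt
    rw [not_le] at hlt
    obtain ⟨m, hm1, hm2⟩ := exists_between (lt_min hcd hlt)
    rw [lt_min_iff] at hm2
    have hpos : 0 < F.X q' - F.X q := by linarith
    set t := (m - F.X q) / (F.X q' - F.X q) with ht
    have ht0 : 0 ≤ t := div_nonneg (by linarith) hpos.le
    have ht1 : t ≤ 1 := (div_le_one hpos).2 (by linarith)
    have htX : t * (F.X q' - F.X q) = m - F.X q := div_mul_cancel₀ _ hpos.ne'
    have hz := hP (AffineMap.lineMap q q' t) (hseg (by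
      rw [segment_eq_image_lineMap]; exact ⟨t, ⟨ht0, ht1⟩, rfl⟩))
      (by rw [F.X_lineMap, htX]; linarith) (by rw [F.X_lineMap, htX]; linarith)
    rw [F.Y_lineMap] at hz
    nlinarith
  have key : ∀ q, Relation.ReflTransGen
      (fun q q' => MovesStraight P b q q' ∨ SlidesAlongEdge v P b q q') p q →
      F.X q ≤ c ∧ F.Y q < h := by
    intro q hq
    induction hq with
    | refl => exact ⟨hpX, hpY⟩
    | @tail q q' _ hstep ih =>
      obtain ⟨hqX, hqY⟩ := ih
      rcases hstep with ⟨hmem, hseg⟩ | ⟨⟨i, hi, hi'⟩, -, hanti⟩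
      · have hY : F.Y q' < h :=
          ((convex_Iio h).linear_preimage F.Y).segment_subset hqY hbY hmem
        exact ⟨cross q q' hseg hqX hqY hY, hY⟩
      · have hseg : segment ℝ q q' ⊆ P := by
          have hconv : Convex ℝ (v.edgeSet ℝ i) := by
            rw [Polygon.edgeSet, affineSegment_eq_segment]
            exact convex_segment _ _
          exact (hconv.segment_subset hi hi').trans (hEP i)
        have hY : F.Y q' < h := by
          rcases hE i with hv | hh
          · have hX : F.X q = F.X q' := (hv.mem_edge.1 hi).1.trans (hv.mem_edge.1 hi').1.symm
            by_contra hge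
            rw [not_lt] at hge
            have h01 : ∀ t ∈ Ico (0 : ℝ) 1, (F.Y q' - F.Y b) ^ 2 <
                (F.Y q + t * (F.Y q' - F.Y q) - F.Y b) ^ 2 := by
              intro t ht
              have := hanti ⟨ht.1, ht.2.le⟩ (right_mem_Icc.2 zero_le_one) ht.2
              simp only [AffineMap.lineMap_apply_one] at this
              rw [F.dist_lt_iff, F.X_lineMap, F.Y_lineMap, hX, sub_self, mul_zero, add_zero] at this
              linarith
            rcases le_or_gt (F.Y b) (F.Y q) with h1 | h1
            · have := h01 0 ⟨le_rfl, one_pos⟩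
              nlinarith
            · have hpos : 0 < F.Y q' - F.Y q := by linarith
              have := h01 ((F.Y b - F.Y q) / (F.Y q' - F.Y q))
                ⟨div_nonneg (by linarith) hpos.le, (div_lt_one hpos).2 (by linarith)⟩
              rw [div_mul_cancel₀ _ hpos.ne'] at this
              nlinarith
          · rw [(hh.mem_edge.1 hi').1, ← (hh.mem_edge.1 hi).1]
            exact hqY
        exact ⟨cross q q' hseg hqX hqY hY, hY⟩
  intro hatt
  have := key b hatt
  linarith [this.1]

/-! ### A polygon with alternating low and high corridors -/

namespace Corridors

/-- The height of the bottom over the slab `[i, i + 1]`: the slabs `i ≡ 3 (mod 4)` are high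
corridors. -/
def lo (i : ℕ) : ℕ := if i % 4 = 3 then 2 else 0

/-- The height of the top over the slab `[i, i + 1]`: the slabs `i ≡ 1 (mod 4)` are low
corridors. -/
def hi (i : ℕ) : ℕ := if i % 4 = 1 then 1 else 3

/-- The index of the last vertex of the bottom chain. -/
def last (r : ℕ) : ℕ := 2 * ((r + 1) / 4 + r / 4) + 1

/-- The abscissa of the `j`-th vertex: the bottom chain from left to right, then the top chain
from right to left, both cut off at `r + 1`. -/
def vx (r j : ℕ) : ℕ :=
  if j ≤ last r then
    min (if j % 4 = 0 then j else if j % 4 = 1 then j + 2 else j + 1) (r + 1)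
  else
    min (if (2 * r + 3 - j) % 4 = 0 then 2 * r + 3 - j - 2
      else if (2 * r + 3 - j) % 4 = 1 then 2 * r + 3 - j else 2 * r + 3 - j - 1) (r + 1)

/-- The ordinate of the `j`-th vertex. -/
def vy (r j : ℕ) : ℕ :=
  if j ≤ last r then if j % 4 ≤ 1 then 0 else 2
  else if (2 * r + 3 - j) % 4 ≤ 1 then 3 else 1

/-- The successor of a vertex index. -/
def next (r j : ℕ) : ℕ := if j = 2 * r + 3 then 0 else j + 1

/-- `[x₁, x₂] × [y₁, y₂]` is the `j`-th edge: there are four kinds of edges in the bottom chain,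
four in the top chain, and the right and the left side. -/
def EdgeBox (r j x₁ x₂ y₁ y₂ : ℕ) : Prop :=
  (j < last r ∧ j % 4 = 0 ∧ j ≤ r ∧ x₁ = j ∧ x₂ = min (j + 3) (r + 1) ∧ y₁ = 0 ∧ y₂ = 0) ∨
  (j < last r ∧ j % 4 = 1 ∧ j + 2 ≤ r ∧ x₁ = j + 2 ∧ x₂ = j + 2 ∧ y₁ = 0 ∧ y₂ = 2) ∨
  (j < last r ∧ j % 4 = 2 ∧ j + 1 ≤ r ∧ x₁ = j + 1 ∧ x₂ = j + 2 ∧ y₁ = 2 ∧ y₂ = 2) ∨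
  (j < last r ∧ j % 4 = 3 ∧ j + 1 ≤ r ∧ x₁ = j + 1 ∧ x₂ = j + 1 ∧ y₁ = 0 ∧ y₂ = 2) ∨
  (j = last r ∧ x₁ = r + 1 ∧ x₂ = r + 1 ∧ y₁ = lo r ∧ y₂ = hi r) ∨
  (last r < j ∧ j ≤ 2 * r + 2 ∧ (2 * r + 2 - j) % 4 = 0 ∧ 2 * r + 2 - j ≤ r + 2 ∧
    x₁ = 2 * r + 2 - j - 2 ∧ x₂ = min (2 * r + 2 - j + 1) (r + 1) ∧ y₁ = 3 ∧ y₂ = 3) ∨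
  (last r < j ∧ j ≤ 2 * r + 2 ∧ (2 * r + 2 - j) % 4 = 1 ∧ 2 * r + 2 - j ≤ r ∧
    x₁ = 2 * r + 2 - j ∧ x₂ = 2 * r + 2 - j ∧ y₁ = 1 ∧ y₂ = 3) ∨
  (last r < j ∧ j ≤ 2 * r + 2 ∧ (2 * r + 2 - j) % 4 = 2 ∧ 2 * r + 2 - j ≤ r + 1 ∧
    x₁ = 2 * r + 2 - j - 1 ∧ x₂ = 2 * r + 2 - j ∧ y₁ = 1 ∧ y₂ = 1) ∨
  (last r < j ∧ j ≤ 2 * r + 2 ∧ (2 * r + 2 - j) % 4 = 3 ∧ 2 * r + 2 - j ≤ r + 1 ∧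
    x₁ = 2 * r + 2 - j - 1 ∧ x₂ = 2 * r + 2 - j - 1 ∧ y₁ = 1 ∧ y₂ = 3) ∨
  (j = 2 * r + 3 ∧ x₁ = 0 ∧ x₂ = 0 ∧ y₁ = 0 ∧ y₂ = 3)

lemma edgeBox (r j : ℕ) (hj : j < 2 * r + 4) :
    EdgeBox r j (min (vx r j) (vx r (next r j))) (max (vx r j) (vx r (next r j)))
      (min (vy r j) (vy r (next r j))) (max (vy r j) (vy r (next r j))) := by
  rcases lt_trichotomy j (last r) with h1 | h1 | h1
  · have h2 : next r j = j + 1 := if_neg (by unfold last at h1; omega)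
    rw [h2]
    simp only [vx, vy, if_pos h1.le, if_pos (show j + 1 ≤ last r from h1)]
    unfold EdgeBox
    have h3 := h1
    unfold last at h3
    have h4 : j % 4 = 0 ∨ j % 4 = 1 ∨ j % 4 = 2 ∨ j % 4 = 3 := by omega
    rcases h4 with h4 | h4 | h4 | h4
    · left; simp [h4, show (j + 1) % 4 = 1 by omega]; omega
    · right; left; simp [h4, show (j + 1) % 4 = 2 by omega]; omega
    · right; right; left; simp [h4, show (j + 1) % 4 = 3 by omega]; omega
    · right; right; right; left; simp [h4, show (j + 1) % 4 = 0 by omega]; omega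
  · have h2 : next r j = j + 1 := if_neg (by unfold last at h1; omega)
    rw [h2]
    simp only [vx, vy, if_pos h1.le, if_neg (show ¬(j + 1 ≤ last r) by omega)]
    unfold EdgeBox
    right; right; right; right; left
    have h3 := h1
    unfold last at h3
    refine ⟨h1, ?_, ?_, ?_, ?_⟩
    · split_ifs <;> omega
    · split_ifs <;> omega
    · unfold lo; split_ifs <;> omega
    · unfold hi; split_ifs <;> omega
  · by_cases h5 : j = 2 * r + 3
    · have h2 : next r j = 0 := if_pos h5
      rw [h2]
      simp only [vx, vy, if_neg (show ¬(j ≤ last r) by omega), if_pos (Nat.zero_le (last r))]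
      subst h5
      unfold EdgeBox
      simp
    · have h2 : next r j = j + 1 := if_neg h5
      rw [h2]
      simp only [vx, vy, if_neg (show ¬(j ≤ last r) by omega),
        if_neg (show ¬(j + 1 ≤ last r) by omega)]
      obtain ⟨k, hk⟩ : ∃ k, k = 2 * r + 2 - j := ⟨_, rfl⟩
      rw [show 2 * r + 3 - (j + 1) = k by omega, show 2 * r + 3 - j = k + 1 by omega]
      unfold EdgeBox
      rw [← hk]
      have h3 := h1
      unfold last at h3
      have h4 : k % 4 = 0 ∨ k % 4 = 1 ∨ k % 4 = 2 ∨ k % 4 = 3 := by omega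
      rcases h4 with h4 | h4 | h4 | h4
      · right; right; right; right; right; left
        simp [h4, show (k + 1) % 4 = 1 by omega]; omega
      · right; right; right; right; right; right; left
        simp [h4, show (k + 1) % 4 = 2 by omega]; omega
      · right; right; right; right; right; right; right; left
        simp [h4, show (k + 1) % 4 = 3 by omega]; omega
      · right; right; right; right; right; right; right; right; left
        simp [h4, show (k + 1) % 4 = 0 by omega]; omega

/-- Edges that meet are equal or adjacent. -/
lemma EdgeBox.eq_or_next {r i j x₁ x₂ y₁ y₂ x₁' x₂' y₁' y₂' : ℕ} (h : EdgeBox r i x₁ x₂ y₁ y₂)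
    (h' : EdgeBox r j x₁' x₂' y₁' y₂') (h1 : x₁ ≤ x₂') (h2 : x₁' ≤ x₂) (h3 : y₁ ≤ y₂')
    (h4 : y₁' ≤ y₂) : i = j ∨ j = next r i ∨ i = next r j := by
  have e1 : lo r = 0 ∨ lo r = 2 ∧ r % 4 = 3 := by unfold lo; split_ifs <;> simp [*]
  have e2 : hi r = 3 ∨ hi r = 1 ∧ r % 4 = 1 := by unfold hi; split_ifs <;> simp [*]
  unfold EdgeBox at h h'
  unfold next
  unfold last at h h'
  rcases h with h | h | h | h | h | h | h | h | h | h <;>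
  rcases h' with h' | h' | h' | h' | h' | h' | h' | h' | h' | h' <;> split_ifs <;> omega

end Corridors

namespace Corridors

lemma lo_eq_two {i : ℕ} (h : i % 4 = 3) : lo i = 2 := if_pos h
lemma lo_eq_zero {i : ℕ} (h : i % 4 ≠ 3) : lo i = 0 := if_neg h
lemma hi_eq_one {i : ℕ} (h : i % 4 = 1) : hi i = 1 := if_pos h
lemma hi_eq_three {i : ℕ} (h : i % 4 ≠ 1) : hi i = 3 := if_neg h

lemma lo_lt_hi (i : ℕ) : lo i < hi i := by
  unfold lo hi; split_ifs <;> omega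

lemma hi_le (i : ℕ) : hi i ≤ 3 := by
  unfold hi; split_ifs <;> omega

lemma lo_lt_hi_succ (i : ℕ) : lo i < hi (i + 1) := by
  unfold lo hi; split_ifs <;> omega

lemma lo_succ_lt_hi (i : ℕ) : lo (i + 1) < hi i := by
  unfold lo hi; split_ifs <;> omega

/-- Horizontal and vertical edges alternate. -/
lemma EdgeBox.parity {r j x₁ x₂ y₁ y₂ : ℕ} (h : EdgeBox r j x₁ x₂ y₁ y₂) :
    (j % 2 = 0 ∧ x₁ < x₂ ∧ y₁ = y₂) ∨ (j % 2 = 1 ∧ x₁ = x₂ ∧ y₁ < y₂) := by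
  have := lo_lt_hi r
  unfold EdgeBox at h
  unfold last at h
  rcases h with h | h | h | h | h | h | h | h | h | h <;> omega

variable (F : Frame) (r : ℕ)

/-- The polygon with vertices `(vx r j, vy r j)`. -/
noncomputable def poly : Polygon Plane (2 * r + 4) := ⟨fun j => F.pt (vx r j) (vy r j)⟩

/-- The region bounded by `poly F r`: the union of the rectangles
`[i, i + 1] × [lo i, hi i]` for `i ≤ r`. -/
def region : Set Plane :=
  {p | ∃ i ≤ r, ((i : ℝ) ≤ F.X p ∧ F.X p ≤ i + 1) ∧ (lo i : ℝ) ≤ F.Y p ∧ F.Y p ≤ hi i}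

/-- The condition for a point of the region to lie on its boundary: it is not strictly inside
the height range of a slab through it, or on the left or right side. -/
def Extreme (p : Plane) : Prop :=
  (∃ i ≤ r, ((i : ℝ) ≤ F.X p ∧ F.X p ≤ i + 1) ∧ (F.Y p ≤ lo i ∨ (hi i : ℝ) ≤ F.Y p)) ∨
    F.X p ≤ 0 ∨ (r : ℝ) + 1 ≤ F.X p

variable {F r}

lemma val_finRotate (j : Fin (2 * r + 4)) :
    ((finRotate (2 * r + 4) j : Fin (2 * r + 4)) : ℕ) = next r j := by
  have := coe_finRotate (n := 2 * r + 3) j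
  rw [next]
  simp only [Fin.ext_iff, Fin.val_last] at this
  exact this

lemma X_poly (j : Fin (2 * r + 4)) : F.X (poly F r j) = vx r j := F.X_pt _ _
lemma Y_poly (j : Fin (2 * r + 4)) : F.Y (poly F r j) = vy r j := F.Y_pt _ _

/-- The edges are the boxes described by `EdgeBox`. -/
lemma exists_edgeBox (j : Fin (2 * r + 4)) : ∃ x₁ x₂ y₁ y₂, EdgeBox r j x₁ x₂ y₁ y₂ ∧
    ((x₁ : ℝ) = min (F.X (poly F r j)) (F.X (poly F r (finRotate _ j))) ∧
      (x₂ : ℝ) = max (F.X (poly F r j)) (F.X (poly F r (finRotate _ j))) ∧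
      (y₁ : ℝ) = min (F.Y (poly F r j)) (F.Y (poly F r (finRotate _ j))) ∧
      (y₂ : ℝ) = max (F.Y (poly F r j)) (F.Y (poly F r (finRotate _ j)))) :=
  ⟨_, _, _, _, edgeBox r j j.2, by simp only [X_poly, Y_poly, val_finRotate]; push_cast; simp⟩

lemma vert_or_horiz (j : Fin (2 * r + 4)) :
    ((j : ℕ) % 2 = 0 ∧ Horiz F (poly F r) j) ∨ ((j : ℕ) % 2 = 1 ∧ Vert F (poly F r) j) := by
  obtain ⟨x₁, x₂, y₁, y₂, hbox, h1, h2, h3, h4⟩ := exists_edgeBox (F := F) j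
  rcases hbox.parity with ⟨h5, h6, h7⟩ | ⟨h5, h6, h7⟩
  · exact Or.inl ⟨h5, inf_eq_sup.1 (by rw [← h3, ← h4, h7])⟩
  · exact Or.inr ⟨h5, inf_eq_sup.1 (by rw [← h1, ← h2, h6])⟩

lemma exists_mem_edge_iff (j : Fin (2 * r + 4)) : ∃ x₁ x₂ y₁ y₂ : ℕ, EdgeBox r j x₁ x₂ y₁ y₂ ∧
    ∀ p, p ∈ (poly F r).edgeSet ℝ j ↔
      ((x₁ : ℝ) ≤ F.X p ∧ F.X p ≤ x₂) ∧ (y₁ : ℝ) ≤ F.Y p ∧ F.Y p ≤ y₂ := by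
  obtain ⟨x₁, x₂, y₁, y₂, hbox, h1, h2, h3, h4⟩ := exists_edgeBox (F := F) j
  refine ⟨x₁, x₂, y₁, y₂, hbox, fun p => ?_⟩
  rw [h1, h2, h3, h4]
  rcases vert_or_horiz (F := F) j with ⟨-, hh⟩ | ⟨-, hv⟩
  · have hY : F.Y (poly F r j) = F.Y (poly F r (finRotate _ j)) := hh
    rw [hh.mem_edge, ← hY, min_self, max_self, and_comm, uIcc, mem_Icc, le_antisymm_iff,
      and_comm (a := F.Y p ≤ _)]
  · have hX : F.X (poly F r j) = F.X (poly F r (finRotate _ j)) := hv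
    rw [hv.mem_edge, ← hX, min_self, max_self, uIcc, mem_Icc, le_antisymm_iff,
      and_comm (a := F.X p ≤ _)]

lemma simple : IsSimpleClosedPolygonalCurve (poly F r) where
  three_le := by omega
  nondegenerate j hj := by
    obtain ⟨x₁, x₂, y₁, y₂, hbox, h1, h2, h3, h4⟩ := exists_edgeBox (F := F) j
    rw [← hj, min_self] at h1 h3
    rw [← hj, max_self] at h2 h4
    have hx : x₁ = x₂ := by exact_mod_cast h1.trans h2.symm
    have hy : y₁ = y₂ := by exact_mod_cast h3.trans h4.symm
    rcases hbox.parity with h | h <;> omega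
  adjacent j := by
    refine Subset.antisymm ?_ ?_
    · rintro p ⟨hp, hp'⟩
      have hpar : (next r j) % 2 = ((j : ℕ) + 1) % 2 := by
        unfold next
        split_ifs <;> omega
      rw [← val_finRotate] at hpar
      rcases vert_or_horiz (F := F) j with ⟨h1, hh⟩ | ⟨h1, hv⟩ <;>
        rcases vert_or_horiz (F := F) (finRotate _ j) with ⟨h2, hh'⟩ | ⟨h2, hv'⟩
      · omega
      · exact F.ext (hv'.mem_edge.1 hp').1 ((hh.mem_edge.1 hp).1.trans hh)
      · exact F.ext ((hv.mem_edge.1 hp).1.trans hv) (hh'.mem_edge.1 hp').1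
      · omega
    · rintro _ rfl
      exact ⟨right_mem_edge _ _, left_mem_edge _ _⟩
  nonadjacent i j hji hj hi := by
    rw [Set.disjoint_left]
    intro p hp hp'
    obtain ⟨x₁, x₂, y₁, y₂, hbox, hmem⟩ := exists_mem_edge_iff (F := F) i
    obtain ⟨x₁', x₂', y₁', y₂', hbox', hmem'⟩ := exists_mem_edge_iff (F := F) j
    obtain ⟨⟨h1, h2⟩, h3, h4⟩ := (hmem p).1 hp
    obtain ⟨⟨h1', h2'⟩, h3', h4'⟩ := (hmem' p).1 hp'
    rcases hbox.eq_or_next hbox' (by exact_mod_cast h1.trans h2')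
      (by exact_mod_cast h1'.trans h2) (by exact_mod_cast h3.trans h4')
      (by exact_mod_cast h3'.trans h4) with h | h | h
    · exact hji (Fin.ext h.symm)
    · exact hj (Fin.ext (h.trans (val_finRotate i).symm))
    · exact hi (Fin.ext (h.trans (val_finRotate j).symm))

lemma rectilinear (i : Fin (2 * r + 4)) :
    (Vert F (poly F r) i ∧ Horiz F (poly F r) (finRotate _ i)) ∨
      (Horiz F (poly F r) i ∧ Vert F (poly F r) (finRotate _ i)) := by
  have hpar : (next r i) % 2 = ((i : ℕ) + 1) % 2 := by
    unfold next
    split_ifs <;> omega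
  rw [← val_finRotate] at hpar
  rcases vert_or_horiz (F := F) i with ⟨h1, h2⟩ | ⟨h1, h2⟩ <;>
    rcases vert_or_horiz (F := F) (finRotate _ i) with ⟨h3, h4⟩ | ⟨h3, h4⟩
  · omega
  · exact Or.inr ⟨h2, h4⟩
  · exact Or.inl ⟨h2, h4⟩
  · omega

/-! ### The boundary of the region -/

lemma exists_nat_slab {m M : ℕ} (hmM : m < M) {c : ℝ} (h1 : (m : ℝ) ≤ c) (h2 : c ≤ M) :
    ∃ i, m ≤ i ∧ i < M ∧ (i : ℝ) ≤ c ∧ c ≤ i + 1 := by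
  obtain ⟨i, hi, h3, h4⟩ := exists_slab (N := M - m) (x := fun i => ((m + i : ℕ) : ℝ)) (c := c)
    (by simpa using h1) (by rw [show m + (M - m) = M by omega]; exact h2) (by omega)
  exact ⟨m + i, by omega, by omega, h3, by rw [← add_assoc] at h4; exact_mod_cast h4⟩

lemma mem_region_and_extreme_of_mem_edge {j : Fin (2 * r + 4)} {p : Plane}
    (hp : p ∈ (poly F r).edgeSet ℝ j) : p ∈ region F r ∧ Extreme F r p := by
  obtain ⟨x₁, x₂, y₁, y₂, hbox, hmem⟩ := exists_mem_edge_iff (F := F) j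
  obtain ⟨⟨h1, h2⟩, h3, h4⟩ := (hmem p).1 hp
  rcases hbox with h | h | h | h | h | h | h | h | h | h
  · obtain ⟨-, h0, hr, rfl, rfl, rfl, rfl⟩ := h
    obtain ⟨i, hi1, hi2, hi3⟩ := exists_nat_slab (by omega) h1 h2
    have hl : lo i = 0 := lo_eq_zero (by omega)
    have hh : ((0 : ℕ) : ℝ) ≤ hi i := by exact_mod_cast Nat.zero_le _
    exact ⟨⟨i, by omega, hi3, by rwa [hl], h4.trans hh⟩,
      Or.inl ⟨i, by omega, hi3, Or.inl (by rwa [hl])⟩⟩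
  · obtain ⟨-, h0, hr, rfl, rfl, rfl, rfl⟩ := h
    have hl : lo (j + 1) = 0 := lo_eq_zero (by omega)
    have hh : hi (j + 1) = 3 := hi_eq_three (by omega)
    have hl' : lo (j + 2) = 2 := lo_eq_two (by omega)
    push_cast at h1 h2 h3 h4
    refine ⟨⟨j + 1, by omega, ?_, ?_⟩, Or.inl ⟨j + 2, by omega, ?_, Or.inl ?_⟩⟩
    · push_cast; constructor <;> linarith
    · rw [hl, hh]; push_cast; constructor <;> linarith
    · push_cast; constructor <;> linarith
    · rw [hl']; exact_mod_cast h4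
  · obtain ⟨-, h0, hr, rfl, rfl, rfl, rfl⟩ := h
    have hl : lo (j + 1) = 2 := lo_eq_two (by omega)
    have hh : hi (j + 1) = 3 := hi_eq_three (by omega)
    push_cast at h1 h2 h3 h4
    refine ⟨⟨j + 1, by omega, ?_, ?_⟩, Or.inl ⟨j + 1, by omega, ?_, Or.inl ?_⟩⟩
    · push_cast; constructor <;> linarith
    · rw [hl, hh]; push_cast; constructor <;> linarith
    · push_cast; constructor <;> linarith
    · rw [hl]; exact_mod_cast h4
  · obtain ⟨-, h0, hr, rfl, rfl, rfl, rfl⟩ := h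
    have hl : lo (j + 1) = 0 := lo_eq_zero (by omega)
    have hh : hi (j + 1) = 3 := hi_eq_three (by omega)
    have hl' : lo j = 2 := lo_eq_two (by omega)
    push_cast at h1 h2 h3 h4
    refine ⟨⟨j + 1, by omega, ?_, ?_⟩, Or.inl ⟨j, by omega, ?_, Or.inl ?_⟩⟩
    · push_cast; constructor <;> linarith
    · rw [hl, hh]; push_cast; constructor <;> linarith
    · constructor <;> linarith
    · rw [hl']; exact_mod_cast h4
  · obtain ⟨-, rfl, rfl, rfl, rfl⟩ := h
    push_cast at h1 h2
    exact ⟨⟨r, le_rfl, ⟨by linarith, h2⟩, h3, h4⟩, Or.inr (Or.inr h1)⟩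
  · obtain ⟨-, -, h0, hr, rfl, rfl, rfl, rfl⟩ := h
    obtain ⟨i, hi1, hi2, hi3⟩ := exists_nat_slab (by omega) h1 h2
    have hh : hi i = 3 := hi_eq_three (by omega)
    have hl : (lo i : ℝ) ≤ (3 : ℕ) := by exact_mod_cast (lo_lt_hi i).le.trans (hi_le i)
    exact ⟨⟨i, by omega, hi3, hl.trans h3, by rwa [hh]⟩,
      Or.inl ⟨i, by omega, hi3, Or.inr (by rwa [hh])⟩⟩
  · obtain ⟨-, -, h0, hr, rfl, rfl, rfl, rfl⟩ := h
    set k := 2 * r + 2 - (j : ℕ) with hk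
    obtain ⟨k', hk'⟩ : ∃ k', k = k' + 1 := ⟨k - 1, by omega⟩
    clear_value k
    subst hk'
    have hl : lo k' = 0 := lo_eq_zero (by omega)
    have hh : hi k' = 3 := hi_eq_three (by omega)
    have hh' : hi (k' + 1) = 1 := hi_eq_one (by omega)
    push_cast at h1 h2 h3 h4
    refine ⟨⟨k', by omega, ?_, ?_⟩, Or.inl ⟨k' + 1, by omega, ?_, Or.inr ?_⟩⟩
    · constructor <;> linarith
    · rw [hl, hh]; push_cast; constructor <;> linarith
    · push_cast; constructor <;> linarith
    · rw [hh']; exact_mod_cast h3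
  · obtain ⟨-, -, h0, hr, rfl, rfl, rfl, rfl⟩ := h
    set k := 2 * r + 2 - (j : ℕ) with hk
    obtain ⟨k', hk'⟩ : ∃ k', k = k' + 1 := ⟨k - 1, by omega⟩
    clear_value k
    subst hk'
    have hl : lo k' = 0 := lo_eq_zero (by omega)
    have hh : hi k' = 1 := hi_eq_one (by omega)
    rw [Nat.add_sub_cancel] at h1
    push_cast at h1 h2 h3 h4
    refine ⟨⟨k', by omega, ?_, ?_⟩, Or.inl ⟨k', by omega, ?_, Or.inr ?_⟩⟩
    · constructor <;> linarith
    · rw [hl, hh]; push_cast; constructor <;> linarith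
    · constructor <;> linarith
    · rw [hh]; exact_mod_cast h3
  · obtain ⟨-, -, h0, hr, rfl, rfl, rfl, rfl⟩ := h
    set k := 2 * r + 2 - (j : ℕ) with hk
    obtain ⟨k', hk'⟩ : ∃ k', k = k' + 2 := ⟨k - 2, by omega⟩
    clear_value k
    subst hk'
    have hl : lo (k' + 1) = 0 := lo_eq_zero (by omega)
    have hh : hi (k' + 1) = 3 := hi_eq_three (by omega)
    have hh' : hi k' = 1 := hi_eq_one (by omega)
    rw [show k' + 2 - 1 = k' + 1 by omega] at h1 h2
    push_cast at h1 h2 h3 h4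
    refine ⟨⟨k' + 1, by omega, ?_, ?_⟩, Or.inl ⟨k', by omega, ?_, Or.inr ?_⟩⟩
    · push_cast; constructor <;> linarith
    · rw [hl, hh]; push_cast; constructor <;> linarith
    · constructor <;> linarith
    · rw [hh']; exact_mod_cast h3
  · obtain ⟨-, rfl, rfl, rfl, rfl⟩ := h
    have hl : lo 0 = 0 := lo_eq_zero (by omega)
    have hh : hi 0 = 3 := hi_eq_three (by omega)
    push_cast at h1 h2
    refine ⟨⟨0, Nat.zero_le _, ?_, by rw [hl, hh]; exact ⟨h3, h4⟩⟩, Or.inr (Or.inl h2)⟩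
    push_cast; constructor <;> linarith

end Corridors

namespace Corridors

variable {F : Frame} {r : ℕ}

lemma exists_edge_of_box {j x₁ x₂ y₁ y₂ : ℕ} (hj : j < 2 * r + 4)
    (hbox : ∀ a b c d, EdgeBox r j a b c d → a = x₁ ∧ b = x₂ ∧ c = y₁ ∧ d = y₂) {p : Plane}
    (hX : (x₁ : ℝ) ≤ F.X p ∧ F.X p ≤ x₂) (hY : (y₁ : ℝ) ≤ F.Y p ∧ F.Y p ≤ y₂) :
    ∃ e, p ∈ (poly F r).edgeSet ℝ e := by
  obtain ⟨a, b, c, d, h1, h2⟩ := exists_mem_edge_iff (F := F) (⟨j, hj⟩ : Fin (2 * r + 4))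
  obtain ⟨rfl, rfl, rfl, rfl⟩ := hbox a b c d h1
  exact ⟨_, (h2 p).2 ⟨hX, hY⟩⟩

lemma exists_edge_bot {i : ℕ} (hi : i ≤ r) {p : Plane} (hX : (i : ℝ) ≤ F.X p ∧ F.X p ≤ i + 1)
    (hY : F.Y p = lo i) : ∃ e, p ∈ (poly F r).edgeSet ℝ e := by
  by_cases h3 : i % 4 = 3
  · refine exists_edge_of_box (j := i - 1) (x₁ := i) (x₂ := i + 1) (y₁ := 2) (y₂ := 2) (by omega)
      ?_ (by exact_mod_cast hX) ?_
    · intro a b c d h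
      unfold EdgeBox last at h
      omega
    · rw [hY, lo_eq_two h3]
      exact ⟨le_rfl, le_rfl⟩
  · obtain ⟨a, ha⟩ : ∃ a, a = i / 4 := ⟨_, rfl⟩
    refine exists_edge_of_box (j := 4 * a) (x₁ := 4 * a) (x₂ := min (4 * a + 3) (r + 1)) (y₁ := 0)
      (y₂ := 0) (by omega) ?_ ⟨?_, ?_⟩ ?_
    · intro a b c d h
      unfold EdgeBox last at h
      omega
    · refine le_trans ?_ hX.1
      exact_mod_cast (show 4 * a ≤ i by omega)
    · refine hX.2.trans ?_
      exact_mod_cast (show i + 1 ≤ min (4 * a + 3) (r + 1) by omega)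
    · rw [hY, lo_eq_zero h3]
      exact ⟨le_rfl, le_rfl⟩

lemma exists_edge_top {i : ℕ} (hi : i ≤ r) {p : Plane} (hX : (i : ℝ) ≤ F.X p ∧ F.X p ≤ i + 1)
    (hY : F.Y p = Corridors.hi i) : ∃ e, p ∈ (poly F r).edgeSet ℝ e := by
  by_cases h3 : i % 4 = 1
  · refine exists_edge_of_box (j := 2 * r + 1 - i) (x₁ := i) (x₂ := i + 1) (y₁ := 1) (y₂ := 1)
      (by omega) ?_ (by exact_mod_cast hX) ?_
    · intro a b c d h
      unfold EdgeBox last at h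
      omega
    · rw [hY, hi_eq_one h3]
      exact ⟨le_rfl, le_rfl⟩
  · obtain ⟨a, ha⟩ : ∃ a, a = (i + 2) / 4 := ⟨_, rfl⟩
    refine exists_edge_of_box (j := 2 * r + 2 - 4 * a) (x₁ := 4 * a - 2)
      (x₂ := min (4 * a + 1) (r + 1)) (y₁ := 3) (y₂ := 3) (by omega) ?_ ⟨?_, ?_⟩ ?_
    · intro a b c d h
      unfold EdgeBox last at h
      omega
    · refine le_trans ?_ hX.1
      exact_mod_cast (show 4 * a - 2 ≤ i by omega)
    · refine hX.2.trans ?_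
      exact_mod_cast (show i + 1 ≤ min (4 * a + 1) (r + 1) by omega)
    · rw [hY, hi_eq_three h3]
      exact ⟨le_rfl, le_rfl⟩

lemma exists_edge_of_extreme {p : Plane} (hp : p ∈ region F r) (hext : Extreme F r p) :
    ∃ e, p ∈ (poly F r).edgeSet ℝ e := by
  obtain ⟨i, hir, hX, hY⟩ := hp
  rcases hext with ⟨m, hm, hX', hY'⟩ | h0 | h0
  · have h1 : i ≤ m + 1 := by exact_mod_cast hX.1.trans hX'.2
    have h2 : m ≤ i + 1 := by exact_mod_cast hX'.1.trans hX.2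
    rcases (by omega : m = i ∨ m = i + 1 ∨ i = m + 1) with rfl | rfl | rfl
    · rcases hY' with hY' | hY'
      · exact exists_edge_bot hm hX (le_antisymm hY' hY.1)
      · exact exists_edge_top hm hX (le_antisymm hY.2 hY')
    · rcases hY' with hY' | hY'
      · by_cases h3 : (i + 1) % 4 = 3
        · refine exists_edge_of_box (j := i - 1) (x₁ := i + 1) (x₂ := i + 1) (y₁ := 0) (y₂ := 2)
            (by omega) ?_ ⟨hX'.1, by exact_mod_cast hX.2⟩ ⟨?_, ?_⟩
          · intro a b c d h
            unfold EdgeBox last at h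
            omega
          · exact le_trans (by exact_mod_cast Nat.zero_le _) hY.1
          · rwa [lo_eq_two h3] at hY'
        · refine exists_edge_bot hir hX (le_antisymm (hY'.trans ?_) hY.1)
          rw [lo_eq_zero h3]
          exact_mod_cast Nat.zero_le _
      · by_cases h3 : (i + 1) % 4 = 1
        · refine exists_edge_of_box (j := 2 * r + 1 - i) (x₁ := i + 1) (x₂ := i + 1) (y₁ := 1)
            (y₂ := 3) (by omega) ?_ ⟨hX'.1, by exact_mod_cast hX.2⟩ ⟨?_, ?_⟩
          · intro a b c d h
            unfold EdgeBox last at h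
            omega
          · rwa [hi_eq_one h3] at hY'
          · exact hY.2.trans (by exact_mod_cast hi_le i)
        · refine exists_edge_top hir hX (le_antisymm hY.2 (le_trans ?_ hY'))
          rw [hi_eq_three h3]
          exact_mod_cast hi_le i
    · rcases hY' with hY' | hY'
      · by_cases h3 : m % 4 = 3
        · refine exists_edge_of_box (j := m) (x₁ := m + 1) (x₂ := m + 1) (y₁ := 0) (y₂ := 2)
            (by omega) ?_ ⟨hX.1, by exact_mod_cast hX'.2⟩ ⟨?_, ?_⟩
          · intro a b c d h
            unfold EdgeBox last at h
            omega
          · exact le_trans (by exact_mod_cast Nat.zero_le _) hY.1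
          · rwa [lo_eq_two h3] at hY'
        · refine exists_edge_bot hir hX (le_antisymm (hY'.trans ?_) hY.1)
          rw [lo_eq_zero h3]
          exact_mod_cast Nat.zero_le _
      · by_cases h3 : m % 4 = 1
        · have hlast : last r < 2 * r - m := by
            unfold last
            have : r % 4 = 0 ∨ r % 4 = 1 ∨ r % 4 = 2 ∨ r % 4 = 3 := by omega
            rcases this with h | h | h | h <;> omega
          refine exists_edge_of_box (j := 2 * r - m) (x₁ := m + 1) (x₂ := m + 1) (y₁ := 1)
            (y₂ := 3) (by omega) ?_ ⟨hX.1, by exact_mod_cast hX'.2⟩ ⟨?_, ?_⟩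
          · intro a b c d h
            unfold EdgeBox at h
            omega
          · rwa [hi_eq_one h3] at hY'
          · exact hY.2.trans (by exact_mod_cast hi_le _)
        · refine exists_edge_top hir hX (le_antisymm hY.2 (le_trans ?_ hY'))
          rw [hi_eq_three h3]
          exact_mod_cast hi_le _
  · have hi0 : i = 0 := by
      have : (i : ℝ) ≤ (0 : ℕ) := by rw [Nat.cast_zero]; exact hX.1.trans h0
      exact Nat.le_zero.1 (by exact_mod_cast this)
    subst hi0
    refine exists_edge_of_box (j := 2 * r + 3) (x₁ := 0) (x₂ := 0) (y₁ := 0) (y₂ := 3)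
      (by omega) ?_ ⟨hX.1, by rwa [Nat.cast_zero]⟩ hY
    intro a b c d h
    unfold EdgeBox last at h
    omega
  · have hi0 : i = r := by
      have : (r : ℝ) + 1 ≤ i + 1 := h0.trans hX.2
      have : r + 1 ≤ i + 1 := by exact_mod_cast this
      omega
    subst hi0
    refine exists_edge_of_box (j := last i) (x₁ := i + 1) (x₂ := i + 1) (y₁ := lo i)
      (y₂ := Corridors.hi i) (by unfold last; omega) ?_ ⟨by exact_mod_cast h0, by exact_mod_cast hX.2⟩ hY
    intro a b c d h
    unfold EdgeBox at h
    have : last i < 2 * i + 3 := by unfold last; omega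
    omega

/-! ### The topology of the region -/

lemma isCompact_region : IsCompact (region F r) := by
  have h : region F r = ⋃ i ∈ Iic r, (fun q : ℝ × ℝ => F.pt q.1 q.2) ''
      (Icc (i : ℝ) (i + 1) ×ˢ Icc (lo i : ℝ) (Corridors.hi i)) := by
    ext p
    simp only [mem_iUnion, exists_prop]
    constructor
    · rintro ⟨i, hi, hX, hY⟩
      exact ⟨i, hi, (F.X p, F.Y p), ⟨hX, hY⟩, F.ext (F.X_pt _ _) (F.Y_pt _ _)⟩
    · rintro ⟨i, hi, q, ⟨hX, hY⟩, rfl⟩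
      exact ⟨i, hi, by simpa using hX, by simpa using hY⟩
  rw [h]
  exact (finite_Iic r).isCompact_biUnion fun i _ =>
    (isCompact_Icc.prod isCompact_Icc).image F.continuous_pt

lemma X_mem_of_mem {p : Plane} (hp : p ∈ region F r) : 0 ≤ F.X p ∧ F.X p ≤ r + 1 := by
  obtain ⟨i, hi, hX, -⟩ := hp
  have h1 : (i : ℝ) ≤ r := by exact_mod_cast hi
  have h2 : (0 : ℝ) ≤ i := Nat.cast_nonneg i
  constructor <;> linarith

/-- Strictly between two integers, the section of the region is a single height range. -/
lemma mem_of_mem_slab {p : Plane} (hp : p ∈ region F r) {i : ℕ} (h1 : (i : ℝ) < F.X p)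
    (h2 : F.X p < i + 1) : (lo i : ℝ) ≤ F.Y p ∧ F.Y p ≤ Corridors.hi i := by
  obtain ⟨m, hm, hX, hY⟩ := hp
  have h3 : i < m + 1 := by exact_mod_cast h1.trans_le hX.2
  have h4 : m < i + 1 := by exact_mod_cast hX.1.trans_lt h2
  obtain rfl : m = i := by omega
  exact hY

lemma not_mem_interior {p : Plane} (hext : Extreme F r p) : p ∉ interior (region F r) := by
  intro hint
  obtain ⟨ε, hε, hbox⟩ := F.exists_box isOpen_interior hint
  have hε' : |ε / 2| < ε := by rw [abs_of_pos (by linarith)]; linarith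
  have hε'' : |-(ε / 2)| < ε := by rwa [abs_neg]
  have h0 : |(0 : ℝ)| < ε := by simpa
  rcases hext with ⟨i, hi, hX, hY⟩ | hX | hX
  · obtain ⟨c, hc1, hc2⟩ := exists_between
      (show max (i : ℝ) (F.X p - ε) < min ((i : ℝ) + 1) (F.X p + ε) by
        apply max_lt <;> apply lt_min <;> linarith)
    rw [max_lt_iff] at hc1
    rw [lt_min_iff] at hc2
    have hs : |c - F.X p| < ε := by rw [abs_lt]; constructor <;> linarith
    rcases hY with hY | hY
    · have h1 := mem_of_mem_slab (interior_subset (hbox _ _ hs hε'')) (i := i)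
        (by rw [F.X_pt]; linarith) (by rw [F.X_pt]; linarith)
      rw [F.Y_pt] at h1
      linarith
    · have h1 := mem_of_mem_slab (interior_subset (hbox _ _ hs hε')) (i := i)
        (by rw [F.X_pt]; linarith) (by rw [F.X_pt]; linarith)
      rw [F.Y_pt] at h1
      linarith
  · have h1 := X_mem_of_mem (interior_subset (hbox _ _ hε'' h0))
    rw [F.X_pt] at h1
    linarith
  · have h1 := X_mem_of_mem (interior_subset (hbox _ _ hε' h0))
    rw [F.X_pt] at h1
    linarith

lemma mem_interior_of_line {p : Plane} {i : ℕ} (hi : i + 1 ≤ r) (hX : F.X p = i + 1)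
    (h1 : (lo i : ℝ) < F.Y p) (h2 : F.Y p < Corridors.hi i) (h3 : (lo (i + 1) : ℝ) < F.Y p)
    (h4 : F.Y p < Corridors.hi (i + 1)) : p ∈ interior (region F r) := by
  refine mem_interior.2 ⟨_, ?_, F.isOpen_X_mem_Y_mem (isOpen_Ioo (a := (i : ℝ)) (b := i + 2))
    (isOpen_Ioo (a := max (lo i : ℝ) (lo (i + 1)))
      (b := min (Corridors.hi i : ℝ) (Corridors.hi (i + 1)))),
    ⟨by linarith, by linarith⟩, max_lt h1 h3, lt_min h2 h4⟩
  rintro z ⟨⟨hz1, hz2⟩, hz3, hz4⟩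
  rw [max_lt_iff] at hz3
  rw [lt_min_iff] at hz4
  rcases le_total (F.X z) (i + 1) with h5 | h5
  · exact ⟨i, by omega, ⟨hz1.le, h5⟩, hz3.1.le, hz4.1.le⟩
  · exact ⟨i + 1, hi, by push_cast; constructor <;> linarith, hz3.2.le, hz4.2.le⟩

lemma mem_interior_of_mem_open {p : Plane} {i : ℕ} (hi : i ≤ r)
    (hX : (i : ℝ) < F.X p ∧ F.X p < i + 1) (hY : (lo i : ℝ) < F.Y p ∧ F.Y p < Corridors.hi i) :
    p ∈ interior (region F r) := by
  refine mem_interior.2 ⟨_, ?_, F.isOpen_X_mem_Y_mem (isOpen_Ioo (a := (i : ℝ)) (b := i + 1))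
    (isOpen_Ioo (a := (lo i : ℝ)) (b := Corridors.hi i)), hX, hY⟩
  rintro z ⟨hz1, hz2⟩
  exact ⟨i, hi, ⟨hz1.1.le, hz1.2.le⟩, hz2.1.le, hz2.2.le⟩

lemma mem_interior_of_not_extreme {p : Plane} (hp : p ∈ region F r) (hext : ¬Extreme F r p) :
    p ∈ interior (region F r) := by
  obtain ⟨m, hm, hX, hY⟩ := hp
  unfold Extreme at hext
  push Not at hext
  obtain ⟨hs, h0, h1⟩ := hext
  rcases hX.1.eq_or_lt with h2 | h2
  · obtain ⟨i, rfl⟩ : ∃ i, m = i + 1 := by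
      refine ⟨m - 1, ?_⟩
      have : (0 : ℝ) < m := by linarith
      have : 0 < m := by exact_mod_cast this
      omega
    push_cast at h2 hX
    have h3 := hs i (by omega) ⟨by linarith, by linarith⟩
    have h4 := hs (i + 1) hm (by push_cast; exact hX)
    exact mem_interior_of_line hm h2.symm h3.1 h3.2 h4.1 h4.2
  rcases hX.2.eq_or_lt with h3 | h3
  · have hmr : m + 1 ≤ r := by
      have : (m : ℝ) + 1 < r + 1 := by linarith
      have : m + 1 < r + 1 := by exact_mod_cast this
      omega
    have h4 := hs m hm hX
    have h5 := hs (m + 1) hmr (by push_cast; constructor <;> linarith)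
    exact mem_interior_of_line hmr h3 h4.1 h4.2 h5.1 h5.2
  · exact mem_interior_of_mem_open hm ⟨h2, h3⟩ (hs m hm hX)

lemma frontier_region : frontier (region F r) = (poly F r).boundary ℝ := by
  ext p
  rw [Polygon.boundary, mem_iUnion]
  constructor
  · intro hp
    have hpR := isCompact_region.isClosed.frontier_subset hp
    refine exists_edge_of_extreme hpR ?_
    by_contra hext
    exact (mem_frontier_iff_notMem_interior hpR).1 hp (mem_interior_of_not_extreme hpR hext)
  · rintro ⟨e, he⟩
    obtain ⟨hpR, hext⟩ := mem_region_and_extreme_of_mem_edge he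
    exact (mem_frontier_iff_notMem_interior hpR).2 (not_mem_interior hext)

lemma closure_interior_region : closure (interior (region F r)) = region F r := by
  refine Subset.antisymm (closure_minimal interior_subset isCompact_region.isClosed) ?_
  rintro p ⟨i, hi, hX, hY⟩
  have hlh : (lo i : ℝ) < Corridors.hi i := by exact_mod_cast lo_lt_hi i
  set m := F.pt (i + 1 / 2) ((lo i + Corridors.hi i) / 2) with hm
  have hmX : F.X m = i + 1 / 2 := F.X_pt _ _
  have hmY : F.Y m = (lo i + Corridors.hi i) / 2 := F.Y_pt _ _
  have hcont : Continuous fun t : ℝ => (AffineMap.lineMap p m t : Plane) :=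
    AffineMap.lineMap_continuous
  have hlim : Tendsto (fun t : ℝ => (AffineMap.lineMap p m t : Plane)) (𝓝[>] 0) (𝓝 p) := by
    have := hcont.tendsto 0
    rw [AffineMap.lineMap_apply_zero] at this
    exact this.mono_left nhdsWithin_le_nhds
  refine mem_closure_of_tendsto hlim ?_
  filter_upwards [Ioo_mem_nhdsGT (zero_lt_one : (0 : ℝ) < 1)] with t ht
  have ht1 : 0 < 1 - t := by linarith [ht.2]
  refine mem_interior_of_mem_open hi ⟨?_, ?_⟩ ⟨?_, ?_⟩
  · rw [F.X_lineMap, hmX]; nlinarith [ht.1]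
  · rw [F.X_lineMap, hmX]; nlinarith [ht.1]
  · rw [F.Y_lineMap, hmY]; nlinarith [ht.1]
  · rw [F.Y_lineMap, hmY]; nlinarith [ht.1]

lemma isPreconnected_section (c : ℝ) :
    IsPreconnected (region F r ∩ {p : Plane | F.X p = c}) := by
  refine Convex.isPreconnected ?_
  have key : ∀ p q : Plane, p ∈ region F r → q ∈ region F r → F.X p = c → F.X q = c →
      F.Y p ≤ F.Y q → ∀ z, F.X z = c → F.Y p ≤ F.Y z → F.Y z ≤ F.Y q → z ∈ region F r := by
    rintro p q ⟨i, hi, hX, hY⟩ ⟨j, hj, hX', hY'⟩ hp hq - z hz h1 h2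
    rw [hp] at hX
    rw [hq] at hX'
    have hij : i ≤ j + 1 := by exact_mod_cast hX.1.trans hX'.2
    have hji : j ≤ i + 1 := by exact_mod_cast hX'.1.trans hX.2
    have hlh : (lo j : ℝ) ≤ Corridors.hi i := by
      have : lo j ≤ Corridors.hi i := by
        rcases (by omega : j = i ∨ j = i + 1 ∨ i = j + 1) with rfl | rfl | rfl
        · exact (lo_lt_hi _).le
        · exact (lo_succ_lt_hi _).le
        · exact (lo_lt_hi_succ _).le
      exact_mod_cast this
    rcases le_total (F.Y z) (Corridors.hi i) with h3 | h3
    · exact ⟨i, hi, by rwa [hz], by linarith, h3⟩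
    · exact ⟨j, hj, by rwa [hz], by linarith, by linarith⟩
  intro p hp
  rw [starConvex_iff_segment_subset]
  intro q hq z hz
  have hpX : F.X p = c := hp.2
  have hqX : F.X q = c := hq.2
  obtain ⟨hzX, hzY⟩ := (F.mem_segment_of_X_eq (hpX.trans hqX.symm)).1 hz
  have hzc : F.X z = c := hzX.trans hpX
  refine ⟨?_, hzc⟩
  rcases mem_uIcc.1 hzY with h | h
  · exact key p q hp.1 hq.1 hpX hqX (h.1.trans h.2) z hzc h.1 h.2
  · exact key q p hq.1 hp.1 hqX hpX (h.1.trans h.2) z hzc h.1 h.2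

lemma isAxisPolygon : IsAxisPolygon F (poly F r) (region F r) where
  simple := simple
  rectilinear := rectilinear
  isCompact := isCompact_region
  closure_interior := closure_interior_region
  frontier_eq := frontier_region
  sections := isPreconnected_section

end Corridors

namespace Corridors

variable {F : Frame} {r : ℕ}

/-! ### General position -/

lemma vx_le (r j : ℕ) : vx r j ≤ r + 1 := by
  unfold vx
  split_ifs <;> exact min_le_right _ _

/-- Vertices on a vertical line are adjacent. -/
lemma next_of_vx_eq {i j : ℕ} (hi : i < 2 * r + 4) (hj : j < 2 * r + 4) (hij : i < j)
    (h : vx r i = vx r j) : j = next r i ∨ i = next r j := by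
  unfold next
  unfold vx last at h
  split_ifs at h ⊢ <;> omega

/-- To the right of a vertex there is a slab whose height range does not contain the height of
the vertex in its interior, and this slab is passed on the way to any other vertex of the same
height. -/
lemma exists_blocking_slab {i j : ℕ} (hi : i < 2 * r + 4) (hj : j < 2 * r + 4)
    (hy : vy r i = vy r j) (hx : vx r i < vx r j) :
    ∃ m ≤ r, vx r i ≤ m ∧ m + 1 ≤ vx r j ∧ (vy r i ≤ lo m ∨ Corridors.hi m ≤ vy r i) := by
  have h1 := vx_le r j
  have hval : ∀ k < 2 * r + 4, vy r k = 0 ∨ vy r k = 3 ∨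
      (vy r k = 1 ∧ (vx r k % 4 = 1 ∨ vx r k % 4 = 2)) ∨
      (vy r k = 2 ∧ (vx r k % 4 = 3 ∨ vx r k % 4 = 0)) := by
    intro k hk
    unfold vx vy last
    have : r % 4 = 0 ∨ r % 4 = 1 ∨ r % 4 = 2 ∨ r % 4 = 3 := by omega
    rcases this with h | h | h | h <;> split_ifs <;> omega
  have hlo : ∀ k, k % 4 = 3 → lo k = 2 := fun k => lo_eq_two
  have hhi : ∀ k, k % 4 = 1 → Corridors.hi k = 1 := fun k => hi_eq_one
  rcases hval i hi with h2 | h2 | ⟨h2, h3⟩ | ⟨h2, h3⟩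
  · exact ⟨vx r i, by omega, le_rfl, hx, Or.inl (by omega)⟩
  · exact ⟨vx r i, by omega, le_rfl, hx, Or.inr (by rw [h2]; exact hi_le _)⟩
  · rcases h3 with h3 | h3
    · exact ⟨vx r i, by omega, le_rfl, hx, Or.inr (by rw [hhi _ h3, h2])⟩
    · have := hval j hj
      exact ⟨vx r i + 1, by omega, by omega, by omega,
        Or.inl (by rw [hlo _ (by omega), h2]; omega)⟩
  · rcases h3 with h3 | h3
    · exact ⟨vx r i, by omega, le_rfl, hx, Or.inl (by rw [hlo _ h3, h2])⟩
    · have := hval j hj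
      exact ⟨vx r i + 1, by omega, by omega, by omega,
        Or.inr (by rw [hhi _ (by omega), h2]; omega)⟩

lemma not_openSegment_subset_of_Y_eq {i j : Fin (2 * r + 4)}
    (hY : F.Y (poly F r i) = F.Y (poly F r j)) (hX : F.X (poly F r i) < F.X (poly F r j)) :
    ¬openSegment ℝ (poly F r i) (poly F r j) ⊆ interior (region F r) := by
  intro hsub
  rw [X_poly, X_poly] at hX
  rw [Y_poly, Y_poly] at hY
  obtain ⟨m, hm, h1, h2, h3⟩ := exists_blocking_slab i.2 j.2 (by exact_mod_cast hY)
    (by exact_mod_cast hX)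
  have h1' : (vx r i : ℝ) ≤ m := by exact_mod_cast h1
  have h2' : (m : ℝ) + 1 ≤ vx r j := by exact_mod_cast h2
  have hd : (0 : ℝ) < vx r j - vx r i := by linarith
  set t := ((m : ℝ) + 1 / 2 - vx r i) / (vx r j - vx r i) with ht
  have ht0 : 0 < t := div_pos (by linarith) hd
  have ht1 : t < 1 := (div_lt_one hd).2 (by linarith)
  have htX : t * ((vx r j : ℝ) - vx r i) = m + 1 / 2 - vx r i := div_mul_cancel₀ _ hd.ne'
  set z : Plane := AffineMap.lineMap (poly F r i) (poly F r j) t with hz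
  have hzX : F.X z = m + 1 / 2 := by rw [hz, F.X_lineMap, X_poly, X_poly, htX]; ring
  have hzY : F.Y z = vy r i := by rw [hz, F.Y_lineMap, Y_poly, Y_poly, ← hY]; ring
  refine not_mem_interior (p := z) (Or.inl ⟨m, hm, ?_, ?_⟩) (hsub ?_)
  · rw [hzX]; constructor <;> linarith
  · rw [hzY]; exact_mod_cast h3
  · rw [openSegment_eq_image_lineMap]
    exact ⟨t, ⟨ht0, ht1⟩, rfl⟩

lemma not_openSegment_subset_of_next (i : Fin (2 * r + 4)) :
    ¬openSegment ℝ (poly F r i) (poly F r (finRotate _ i)) ⊆ interior (region F r) := by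
  intro hsub
  obtain ⟨z, hz⟩ : (openSegment ℝ (poly F r i) (poly F r (finRotate _ i))).Nonempty :=
    ⟨_, midpoint_mem_openSegment ..⟩
  refine isAxisPolygon.not_mem_interior_of_mem_edge (F := F) (i := i) ?_ (hsub hz)
  rw [Polygon.edgeSet, affineSegment_eq_segment]
  exact openSegment_subset_segment _ _ _ hz

lemma not_openSegment_subset {i j : Fin (2 * r + 4)} (hij : i ≠ j)
    (h : F.X (poly F r i) = F.X (poly F r j) ∨ F.Y (poly F r i) = F.Y (poly F r j)) :
    ¬openSegment ℝ (poly F r i) (poly F r j) ⊆ interior (region F r) := by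
  rcases lt_trichotomy (F.X (poly F r i)) (F.X (poly F r j)) with hX | hX | hX
  · exact not_openSegment_subset_of_Y_eq (h.resolve_left hX.ne) hX
  · rw [X_poly, X_poly] at hX
    have hX' : vx r i = vx r j := by exact_mod_cast hX
    have hadj : j = finRotate _ i ∨ i = finRotate _ j := by
      simp only [Fin.ext_iff, val_finRotate]
      rcases lt_or_gt_of_ne (fun h' => hij (Fin.ext h') : (i : ℕ) ≠ j) with h1 | h1
      · exact next_of_vx_eq i.2 j.2 h1 hX'
      · exact (next_of_vx_eq j.2 i.2 h1 hX'.symm).symm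
    rcases hadj with rfl | rfl
    · exact not_openSegment_subset_of_next i
    · rw [openSegment_symm]
      exact not_openSegment_subset_of_next j
  · rw [openSegment_symm]
    exact not_openSegment_subset_of_Y_eq (h.resolve_left hX.ne').symm hX

/-! ### One beacon for each witness -/

/-- The witnesses: points at middle height, separated from each other by a low and a high
corridor. -/
noncomputable def witness (F : Frame) (k : ℕ) : Plane := F.pt (4 * k + 1 / 2) (3 / 2)

lemma witness_mem {k : ℕ} (hk : k < r / 4 + 1) : witness F k ∈ region F r := by
  refine ⟨4 * k, by omega, ?_, ?_⟩
  · rw [witness, F.X_pt]; push_cast; constructor <;> linarith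
  · rw [witness, F.Y_pt, lo_eq_zero (by omega), hi_eq_three (by omega)]
    push_cast; constructor <;> norm_num

lemma edge_subset (i : Fin (2 * r + 4)) : (poly F r).edgeSet ℝ i ⊆ region F r :=
  fun _ hp => isAxisPolygon.mem_of_mem_edge (F := F) hp

/-- A beacon above height `1` cannot attract through a low corridor, and one below height `2` not
through a high corridor. -/
lemma not_attracts_both {k m : ℕ} (hkm : k < m) {b : Plane}
    (h1 : Attracts (poly F r) (region F r) b (witness F k))
    (h2 : Attracts (poly F r) (region F r) b (witness F m)) : False := by
  have hE : ∀ i, Vert F (poly F r) i ∨ Horiz F (poly F r) i := fun i =>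
    (vert_or_horiz i).symm.imp And.right And.right
  have hkX : F.X (witness F k) = 4 * k + 1 / 2 := F.X_pt _ _
  have hkY : F.Y (witness F k) = 3 / 2 := F.Y_pt _ _
  have hmX : F.X (witness F m) = 4 * m + 1 / 2 := F.X_pt _ _
  have hmY : F.Y (witness F m) = 3 / 2 := F.Y_pt _ _
  have hkm' : (k : ℝ) + 1 ≤ m := by exact_mod_cast hkm
  have hlow : ∀ z ∈ region F r, (4 * k + 1 : ℝ) < F.X z → F.X z < 4 * k + 2 → F.Y z ≤ 1 := by
    intro z hz hz1 hz2
    have := (mem_of_mem_slab hz (i := 4 * k + 1) (by push_cast; linarith)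
      (by push_cast; linarith)).2
    rw [hi_eq_one (by omega)] at this
    exact_mod_cast this
  have hhigh : ∀ z ∈ region F r, (4 * k + 3 : ℝ) < F.X z → F.X z < 4 * k + 4 → 2 ≤ F.Y z := by
    intro z hz hz1 hz2
    have := (mem_of_mem_slab hz (i := 4 * k + 3) (by push_cast; linarith)
      (by push_cast; linarith)).1
    rw [lo_eq_two (by omega)] at this
    exact_mod_cast this
  rcases lt_or_ge 1 (F.Y b) with hb | hb
  · rcases lt_or_ge (4 * k + 1 : ℝ) (F.X b) with hbX | hbX
    · exact not_attracts_of_wall F.negY (c := 4 * k + 1) (d := 4 * k + 2) (h := -1)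
        (fun i => (hE i).imp id neg_inj.2) edge_subset (by linarith)
        (fun z hz hz1 hz2 => neg_le_neg (hlow z hz hz1 hz2)) hbX (neg_lt_neg hb)
        (by simp only [Frame.negY_X, hkX]; linarith)
        (by simp only [Frame.negY_Y, hkY]; linarith) h1
    · exact not_attracts_of_wall F.negX.negY (c := -(4 * k + 2)) (d := -(4 * k + 1)) (h := -1)
        (fun i => (hE i).imp neg_inj.2 neg_inj.2) edge_subset (by linarith)
        (fun z hz hz1 hz2 => neg_le_neg (hlow z hz (neg_lt_neg_iff.1 hz2) (neg_lt_neg_iff.1 hz1)))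
        (by simp only [Frame.negY_X, Frame.negX_X]; linarith) (neg_lt_neg hb)
        (by simp only [Frame.negY_X, Frame.negX_X, hmX]; linarith)
        (by simp only [Frame.negY_Y, Frame.negX_Y, hmY]; linarith) h2
  · rcases lt_or_ge (4 * k + 3 : ℝ) (F.X b) with hbX | hbX
    · exact not_attracts_of_wall F (c := 4 * k + 3) (d := 4 * k + 4) (h := 2) hE edge_subset
        (by linarith) hhigh hbX (by linarith) (by linarith) (by linarith) h1
    · exact not_attracts_of_wall F.negX (c := -(4 * k + 4)) (d := -(4 * k + 3)) (h := 2)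
        (fun i => (hE i).imp neg_inj.2 id) edge_subset (by linarith)
        (fun z hz hz1 hz2 => hhigh z hz (neg_lt_neg_iff.1 hz2) (neg_lt_neg_iff.1 hz1))
        (by simp only [Frame.negX_X]; linarith) (by simp only [Frame.negX_Y]; linarith)
        (by simp only [Frame.negX_X, hmX]; linarith)
        (by simp only [Frame.negX_Y, hmY]; linarith) h2

lemma le_card_of_covers {S : Finset Plane} (hS : Covers (poly F r) (region F r) S) :
    r / 4 + 1 ≤ S.card := by
  have hex : ∀ k : ℕ, ∃ b, k < r / 4 + 1 →
      b ∈ S ∧ Attracts (poly F r) (region F r) b (witness F k) := by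
    intro k
    by_cases hk : k < r / 4 + 1
    · obtain ⟨b, hb⟩ := hS.2 _ (witness_mem hk)
      exact ⟨b, fun _ => hb⟩
    · exact ⟨0, fun h => absurd h hk⟩
  choose f hf using hex
  rw [← Finset.card_range (r / 4 + 1)]
  refine Finset.card_le_card_of_injOn f (fun k hk => (hf k (by simpa using hk)).1) ?_
  intro k hk m hm hkm
  have hk' := (hf k (by simpa using hk)).2
  have hm' := (hf m (by simpa using hm)).2
  rw [hkm] at hk'
  by_contra hne
  rcases lt_or_gt_of_ne hne with h | h
  · exact not_attracts_both h hk' hm'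
  · exact not_attracts_both h hm' hk'

lemma isSimpleRectilinearPolygon :
    IsSimpleRectilinearPolygon (poly (Frame.std 0) r) (region (Frame.std 0) r) where
  simple := simple
  rectilinear := rectilinear (F := Frame.std 0)
  isCompact := isCompact_region
  closure_interior := closure_interior_region
  frontier_eq := frontier_region

lemma numReflex_eq : numReflex (poly F r) (region F r) = r := by
  have := (isAxisPolygon (F := F) (r := r)).card_eq
  omega

end Corridors

/-! ### Covering monotone polygons -/

theorem theorem3 :
    (∀ (n : ℕ) (v : Polygon Plane n) (P : Set Plane),
      IsSimpleRectilinearPolygon v P → IsMonotonePolygon P →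
        (n + 4) / 8 = numReflex v P / 4 + 1 ∧
        ∃ S : Finset Plane, S.card = (n + 4) / 8 ∧ Covers v P S) ∧
    (∀ r : ℕ, ∃ (v : Polygon Plane (2 * r + 4)) (P : Set Plane),
      IsSimpleRectilinearPolygon v P ∧ IsMonotonePolygon P ∧ InGeneralPosition v P ∧
        numReflex v P = r ∧
        ∀ S : Finset Plane, Covers v P S → r / 4 + 1 ≤ S.card) := by
  refine ⟨fun n v P hv hP => ?_, fun r => ?_⟩
  · obtain ⟨F, h⟩ := hv.exists_frame hP
    have hn : (n + 4) / 8 = numReflex v P / 4 + 1 := by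
      have := h.card_eq
      omega
    exact ⟨hn, h.exists_covers hn.ge⟩
  · exact ⟨Corridors.poly (Frame.std 0) r, Corridors.region (Frame.std 0) r,
      Corridors.isSimpleRectilinearPolygon, Or.inl Corridors.isPreconnected_section,
      fun i j hij _ _ h => Corridors.not_openSegment_subset hij h, Corridors.numReflex_eq,
      fun S hS => Corridors.le_card_of_covers hS⟩
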